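/- **Conventions.** Manifolds are smooth, finite-dimensional, Hausdorff, second countable and without boundary. Let $\mathfrak g$ be a finite-dimensional real Lie algebra and $t\in(S^2\mathfrak g)^{\mathfrak g}$ an invariant symmetric tensor; write $t^\sharp:\mathfrak g^*\to\mathfrak g$, $\alpha\mapsto t(\alpha,\cdot)$, and $\phi(\alpha,\beta,\gamma)=\frac14\langle[t^\sharp\alpha,t^\sharp\beta],\gamma\rangle$. For a subspace $W\subset\mathfrak g$ put $W^\perp=t^\sharp(\operatorname{Ann}W)$. When $t$ is non-degenerate ($t^\sharp$ is bijective), a subalgebra $\mathfrak c$ is *Lagrangian* if $\mathfrak c^\perp=\mathfrak c$. A *$\mathfrak g$-quasi-Poisson manifold* is a manifold $M$ with an action of $\mathfrak g$ (a Lie algebra morphism $\rho$ from $\mathfrak g$ to smooth vector fields) and a $\mathfrak g$-invariant bivector field $\pi$ with $\frac12[\pi,\pi]=\rho^{\otimes3}(\phi)$, where $\frac12[\pi,\pi](df,dg,dh)=\{f,\{g,h\}\}+\{g,\{h,f\}\}+\{h,\{f,g\}\}$ and $\{f,g\}=\pi(df,dg)$. Put $\sigma=\pi+\frac12\rho^{\otimes2}(t)$;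 $M$ is *quasi-Poisson-commutative* if $\sigma=0$. A function $f$ on $M$ is *left-central* if $\sigma(df,\cdot)=0$ and *right-central* if $\sigma(\cdot,df)=0$. A *left (right) central map* is a smooth $\mathfrak g$-equivariant map $\mu:M\to N$ to a quasi-Poisson-commutative manifold such that $f\circ\mu$ is left- (right-) central for every $f\in C^\infty(N)$. A *central pair* $N_L\xleftarrow{\mu_L}M\xrightarrow{\mu_R}N_R$ consists of a left central map $\mu_L$ and a right central map $\mu_R$. It is *split-symplectic* if $t$ is non-degenerate, every tangent vector of $M$ is of the form $\rho(u)+\pi(\alpha,\cdot)$ with $u\in\mathfrak g$ and $\alpha$ a covector (that is, $T^{big}M=TM$), and $\mathfrak g$ acts transitively on $N_L$ and on $N_R$ (i.e. the vector fields $\rho(u)$ span all tangent spaces) with Lagrangian stabilizers of all points. For a subalgebra $\mathfrak c\subset\mathfrak g$, the $\mathfrak c$-orbit of a point consists of the points reached from it by concatenations of $C^1$ curves $\gamma$ with $\gamma'(s)=\rho(w(s))_{\gamma(s)}$, $w$ a continuous path in $\mathfrak c$. It is an immersed submanifold with tangent spaces $\rho(\mathfrak c)_x$. That $M/\mathfrak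 c$ *is a manifold* means that there are a manifold, denoted $M/\mathfrak c$, and a surjective submersion $p:M\to M/\mathfrak c$ whose fibres are the $\mathfrak c$-orbits (with $\ker dp_x=\rho(\mathfrak c)_x$). The *symplectic leaf* through a point of a Poisson manifold is its orbit under the Hamiltonian vector fields: the set of points reached by concatenations of $C^1$ curves whose velocity is $\sum_i a_i(s)X_{g_i}$ for finitely many Hamiltonian vector fields $X_{g_i}$ and continuous coefficients $a_i$. **Theorem (Split-symplectic central reduction).** Let $N_L\xleftarrow{\mu_L}M\xrightarrow{\mu_R}N_R$ be a split-symplectic central pair, $\mathfrak c\subset\mathfrak g$ a Lagrangian Lie subalgebra, and $\mathcal O_L\subset N_L$, $\mathcal O_R\subset N_R$ two $\mathfrak c$-orbits such that $\mu_L\times\mu_R$ is transverse to $\mathcal O_L\times\mathcal O_R$. Suppose that $M/\mathfrak c$ is a manifold, with projection $p:M\to M/\mathfrak c$. Put $$Z=\mu_L^{-1}(\mathcal O_L)\cap\mu_R^{-1}(\mathcal O_R),\quad S=Z/\mathfrak c=p(Z)\subset M/\mathfrak c,$$ $$T_xZ=\{v\in T_xM:\ d\mu_L(v)\in\rho(\mathfrak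 c)_{\mu_L(x)},\ d\mu_R(v)\in\rho(\mathfrak c)_{\mu_R(x)}\}\quad(x\in Z).$$ Then there is a Poisson structure $\pi_{red}$ on $M/\mathfrak c$ with $p_*\pi=\pi_{red}$, and for it: 1. at every point $p(x)$, $x\in Z$, the tangent space $dp(T_xZ)$ of $S$ equals the image of $\pi_{red}:T^*_{p(x)}(M/\mathfrak c)\to T_{p(x)}(M/\mathfrak c)$; 2. every connected component of the immersed submanifold $S$ is a symplectic leaf of $M/\mathfrak c$: for $q\in S$, the set of points joined to $q$ by piecewise $C^1$ curves in $S$ tangent to $S$ (velocities in the image of $\pi_{red}$) is the symplectic leaf through $q$; 3. if $\mathcal O_L$ and $\mathcal O_R$ are embedded submanifolds with tangent spaces $\rho(\mathfrak c)_y$, then $S$ is an embedded submanifold of $M/\mathfrak c$, with tangent spaces the images of $\pi_{red}$, and for every $q\in S$ the connected component of $q$ in $S$ is the symplectic leaf through $q$. In particular, if $S$ is non-empty and connected, then it is a symplectic leaf of $M/\mathfrak c$. -/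

import Mathlib

open Set
open scoped Manifold ContDiff TensorProduct

namespace CentralReduction

noncomputable section

/-! ### Linear algebra of a Lie algebra with an element `t ∈ 𝔤 ⊗ 𝔤` -/

section Algebra

variable {𝔤 : Type*} [LieRing 𝔤] [LieAlgebra ℝ 𝔤]

/-- `t` is a symmetric `𝔤`-invariant tensor, i.e. `t ∈ (S²𝔤)^𝔤`. -/
def IsInvariantSymmetric (t : 𝔤 ⊗[ℝ] 𝔤) : Prop :=
  TensorProduct.comm ℝ 𝔤 𝔤 t = t ∧ ∀ u : 𝔤, ⁅u, t⁆ = 0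

/-- The map `t♯ : 𝔤* → 𝔤`, `α ↦ t(α, ·)`. -/
def sharp (t : 𝔤 ⊗[ℝ] 𝔤) : Module.Dual ℝ 𝔤 →ₗ[ℝ] 𝔤 :=
  (TensorProduct.lid ℝ 𝔤).toLinearMap ∘ₗ
    (LinearMap.applyₗ t : ((𝔤 ⊗[ℝ] 𝔤) →ₗ[ℝ] (ℝ ⊗[ℝ] 𝔤)) →ₗ[ℝ] (ℝ ⊗[ℝ] 𝔤)) ∘ₗ
      (LinearMap.rTensorHom 𝔤 : Module.Dual ℝ 𝔤 →ₗ[ℝ] ((𝔤 ⊗[ℝ] 𝔤) →ₗ[ℝ] (ℝ ⊗[ℝ] 𝔤)))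

theorem sharp_tmul (a b : 𝔤) (α : Module.Dual ℝ 𝔤) : sharp (a ⊗ₜ[ℝ] b) α = α a • b := by
  simp [sharp]

/-- `t` is non-degenerate. -/
def IsNondegenerate (t : 𝔤 ⊗[ℝ] 𝔤) : Prop :=
  Function.Bijective (sharp t)

/-- `t` as a bilinear form on `𝔤*`. -/
def pairing (t : 𝔤 ⊗[ℝ] 𝔤) (α β : Module.Dual ℝ 𝔤) : ℝ := β (sharp t α)

/-- The `3`-vector `φ(α, β, γ) = ¼ ⟨[t♯ α, t♯ β], γ⟩`. -/
def cartan (t : 𝔤 ⊗[ℝ] 𝔤) (α β γ : Module.Dual ℝ 𝔤) : ℝ :=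
  (1 / 4) * γ ⁅sharp t α, sharp t β⁆

/-- `W^⊥ = t(Ann W, ·) ⊆ 𝔤`. -/
def perp (t : 𝔤 ⊗[ℝ] 𝔤) (W : Submodule ℝ 𝔤) : Submodule ℝ 𝔤 :=
  W.dualAnnihilator.map (sharp t)

/-- `W` is Lagrangian: `W^⊥ = W` (used only for non-degenerate `t`). -/
def IsLagrangian (t : 𝔤 ⊗[ℝ] 𝔤) (W : Submodule ℝ 𝔤) : Prop :=
  perp t W = W

end Algebra

/-! ### Orbits of families of vector fields, embedded submanifolds, bivector fields -/

section Manifolds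

variable {E : Type*} [NormedAddCommGroup E] [NormedSpace ℝ E]
  {M : Type*} [TopologicalSpace M] [ChartedSpace E M]

/-- The differential of a real-valued function at `x`, as a covector. -/
def dR (f : M → ℝ) (x : M) : TangentSpace 𝓘(ℝ, E) x →L[ℝ] ℝ :=
  mfderiv 𝓘(ℝ, E) 𝓘(ℝ, ℝ) f x

/-- `x` and `y` are joined by a `C¹` curve `γ : [0,1] → M` whose velocity is a combination
`γ'(s) = ∑ᵢ aᵢ(s) Xᵢ(γ(s))` of finitely many vector fields of the family `F`, with continuous
coefficients `aᵢ`. -/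
def Joined (F : Set (∀ x : M, TangentSpace 𝓘(ℝ, E) x)) (x y : M) : Prop :=
  ∃ (k : ℕ) (X : Fin k → ∀ x : M, TangentSpace 𝓘(ℝ, E) x) (a : Fin k → ℝ → ℝ) (γ : ℝ → M),
    (∀ i, X i ∈ F) ∧ (∀ i, Continuous (a i)) ∧ γ 0 = x ∧ γ 1 = y ∧
    ∀ s ∈ Icc (0 : ℝ) 1, HasMFDerivWithinAt 𝓘(ℝ, ℝ) 𝓘(ℝ, E) γ (Icc 0 1) s
      ((1 : ℝ →L[ℝ] ℝ).smulRight (∑ i, a i s • X i (γ s)))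

/-- The orbit through `x` of a family of vector fields: the points reached from `x` by
concatenations of curves as above. -/
def orbit (F : Set (∀ x : M, TangentSpace 𝓘(ℝ, E) x)) (x : M) : Set M :=
  {y | Relation.ReflTransGen (Joined F) x y}

/-- `S` is an embedded submanifold of `M` whose tangent space at each of its points `x` is `T x`:
locally `S` is the zero set of a smooth submersion `h` with `ker (dh)ₓ = T x`. -/
def IsEmbeddedSubmanifold (S : Set M) (T : ∀ x : M, Set (TangentSpace 𝓘(ℝ, E) x)) : Prop :=
  ∀ x ∈ S, ∃ U : Set M, IsOpen U ∧ x ∈ U ∧ ∃ (k : ℕ) (h : M → (Fin k → ℝ)),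
    ContMDiffOn 𝓘(ℝ, E) 𝓘(ℝ, Fin k → ℝ) ∞ h U ∧ (∀ y ∈ U, y ∈ S ↔ h y = 0) ∧
    ∀ y ∈ U ∩ S, Function.Surjective (mfderiv 𝓘(ℝ, E) 𝓘(ℝ, Fin k → ℝ) h y) ∧
      T y = {v | mfderiv 𝓘(ℝ, E) 𝓘(ℝ, Fin k → ℝ) h y v = 0}

/-- `x` and `y` are joined by a `C¹` curve that runs in `S` and whose velocity lies in `T`. -/
def JoinedTangentially (S : Set M) (T : ∀ x : M, Set (TangentSpace 𝓘(ℝ, E) x)) (x y : M) : Prop :=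
  ∃ γ : ℝ → M, ContMDiffOn 𝓘(ℝ, ℝ) 𝓘(ℝ, E) 1 γ (Icc 0 1) ∧ γ 0 = x ∧ γ 1 = y ∧
    ∀ s ∈ Icc (0 : ℝ) 1, γ s ∈ S ∧
      mfderivWithin 𝓘(ℝ, ℝ) 𝓘(ℝ, E) γ (Icc 0 1) s (1 : ℝ) ∈ T (γ s)

/-- For an immersed submanifold `S` with tangent spaces `T x`: the connected component of `x` in
`S` (for the manifold topology of `S`), i.e. the set of points of `S` that are joined to `x` by
piecewise `C¹` curves in `S` tangent to `S`. -/
def immersedComponent (S : Set M) (T : ∀ x : M, Set (TangentSpace 𝓘(ℝ, E) x)) (x : M) : Set M :=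
  {y | Relation.ReflTransGen (JoinedTangentially S T) x y}

variable (E M) in
/-- A smooth bivector field on `M`. -/
structure Bivector where
  /-- The skew-symmetric bilinear form on each cotangent space. -/
  form : ∀ x : M, (TangentSpace 𝓘(ℝ, E) x →L[ℝ] ℝ) →ₗ[ℝ] (TangentSpace 𝓘(ℝ, E) x →L[ℝ] ℝ) →ₗ[ℝ] ℝ
  skew : ∀ x α β, form x α β = -form x β α
  smooth : ∀ f g : M → ℝ, ContMDiff 𝓘(ℝ, E) 𝓘(ℝ, ℝ) ∞ f → ContMDiff 𝓘(ℝ, E) 𝓘(ℝ, ℝ) ∞ g →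
    ContMDiff 𝓘(ℝ, E) 𝓘(ℝ, ℝ) ∞ (fun x => form x (dR f x) (dR g x))

namespace Bivector

/-- The bracket `{f, g} = π(df, dg)`. -/
def bracket (π : Bivector E M) (f g : M → ℝ) (x : M) : ℝ := π.form x (dR f x) (dR g x)

/-- The cyclic sum `{f,{g,h}} + {g,{h,f}} + {h,{f,g}}`. For smooth functions this is the value
of `[π,π]/2` (Schouten bracket) on `(df, dg, dh)`. -/
def jacobiator (π : Bivector E M) (f g h : M → ℝ) (x : M) : ℝ :=
  π.bracket f (π.bracket g h) x + π.bracket g (π.bracket h f) x + π.bracket h (π.bracket f g) x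

/-- `π` is a Poisson structure: `[π,π] = 0`. -/
def IsPoisson (π : Bivector E M) : Prop :=
  ∀ f g h : M → ℝ, ContMDiff 𝓘(ℝ, E) 𝓘(ℝ, ℝ) ∞ f → ContMDiff 𝓘(ℝ, E) 𝓘(ℝ, ℝ) ∞ g →
    ContMDiff 𝓘(ℝ, E) 𝓘(ℝ, ℝ) ∞ h → ∀ x, π.jacobiator f g h x = 0

/-- The characteristic distribution: the image of `α ↦ π(α, ·)`, `T*ₓM → TₓM`. -/
def image (π : Bivector E M) (x : M) : Set (TangentSpace 𝓘(ℝ, E) x) :=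
  {v | ∃ α : TangentSpace 𝓘(ℝ, E) x →L[ℝ] ℝ,
    ∀ β : TangentSpace 𝓘(ℝ, E) x →L[ℝ] ℝ, β v = π.form x α β}

/-- The family of Hamiltonian vector fields `π(dg, ·)`, `g ∈ C^∞(M)`. -/
def hamiltonianFields (π : Bivector E M) : Set (∀ x : M, TangentSpace 𝓘(ℝ, E) x) :=
  {X | ∃ g : M → ℝ, ContMDiff 𝓘(ℝ, E) 𝓘(ℝ, ℝ) ∞ g ∧
    ∀ (x : M) (β : TangentSpace 𝓘(ℝ, E) x →L[ℝ] ℝ), β (X x) = π.form x (dR g x) β}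

/-- The symplectic leaf through `x` of a Poisson structure: the orbit of `x` under the
Hamiltonian vector fields. -/
def symplecticLeaf (π : Bivector E M) (x : M) : Set M := orbit π.hamiltonianFields x

end Bivector

end Manifolds

/-! ### Lie algebra actions and quasi-Poisson manifolds -/

section QuasiPoisson

variable {𝔤 : Type*} [LieRing 𝔤] [LieAlgebra ℝ 𝔤]
  {E : Type*} [NormedAddCommGroup E] [NormedSpace ℝ E]
  {M : Type*} [TopologicalSpace M] [ChartedSpace E M]

variable (𝔤 E M) in
/-- A smooth action of the Lie algebra `𝔤` on `M`: a Lie algebra morphism from `𝔤` to smooth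
vector fields. -/
structure Action [IsManifold 𝓘(ℝ, E) ∞ M] where
  ρ : 𝔤 →ₗ[ℝ] (∀ x : M, TangentSpace 𝓘(ℝ, E) x)
  smooth : ∀ u : 𝔤, ContMDiff 𝓘(ℝ, E) 𝓘(ℝ, E).tangent ∞
    (fun x => (⟨x, ρ u x⟩ : TangentBundle 𝓘(ℝ, E) M))
  map_lie : ∀ u v : 𝔤, ρ ⁅u, v⁆ = VectorField.mlieBracket 𝓘(ℝ, E) (ρ u) (ρ v)

namespace Action

variable [IsManifold 𝓘(ℝ, E) ∞ M]

/-- The map `ρ* : T*ₓM → 𝔤*`, `⟨ρ* α, u⟩ = α(ρ(u)ₓ)`. -/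
def pullback (A : Action 𝔤 E M) (x : M) (α : TangentSpace 𝓘(ℝ, E) x →L[ℝ] ℝ) :
    Module.Dual ℝ 𝔤 where
  toFun u := α (A.ρ u x)
  map_add' u v := by simp
  map_smul' c u := by simp

/-- The stabilizer `{u ∈ 𝔤 | ρ(u)ₓ = 0}` of a point. -/
def stabilizer (A : Action 𝔤 E M) (x : M) : Submodule ℝ 𝔤 where
  carrier := {u | A.ρ u x = 0}
  add_mem' {u v} hu hv := by
    simp only [mem_ofPred_eq] at hu hv ⊢
    simp [hu, hv]
  zero_mem' := by simp
  smul_mem' c u hu := by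
    simp only [mem_ofPred_eq] at hu ⊢
    simp [hu]

/-- The subspace `ρ(𝔠)ₓ ⊆ TₓM`; it is the tangent space at `x` of the `𝔠`-orbit of `x`. -/
def orbitTangent (A : Action 𝔤 E M) (𝔠 : LieSubalgebra ℝ 𝔤) (x : M) :
    Set (TangentSpace 𝓘(ℝ, E) x) :=
  {v | ∃ u ∈ 𝔠, v = A.ρ u x}

/-- The `𝔠`-orbit of `x`. -/
def orbitOf (A : Action 𝔤 E M) (𝔠 : LieSubalgebra ℝ 𝔤) (x : M) : Set M :=
  orbit {X | ∃ u ∈ 𝔠, X = A.ρ u} x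

/-- `O` is a `𝔠`-orbit. -/
def IsOrbit (A : Action 𝔤 E M) (𝔠 : LieSubalgebra ℝ 𝔤) (O : Set M) : Prop :=
  ∃ x, O = A.orbitOf 𝔠 x

/-- The action is transitive: the vector fields `ρ(u)`, `u ∈ 𝔤`, span every tangent space. -/
def IsTransitive (A : Action 𝔤 E M) : Prop :=
  ∀ (x : M) (v : TangentSpace 𝓘(ℝ, E) x), ∃ u : 𝔤, A.ρ u x = v

/-- `p : M → Q` exhibits the manifold `Q` as `M/𝔠`: it is a surjective submersion whose fibres
are the `𝔠`-orbits; the tangent space `ker dp` of a fibre is that of the orbit. -/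
structure IsQuotient (A : Action 𝔤 E M) (𝔠 : LieSubalgebra ℝ 𝔤)
    {F : Type*} [NormedAddCommGroup F] [NormedSpace ℝ F]
    {Q : Type*} [TopologicalSpace Q] [ChartedSpace F Q] (p : M → Q) : Prop where
  smooth : ContMDiff 𝓘(ℝ, E) 𝓘(ℝ, F) ∞ p
  surjective : Function.Surjective p
  submersion : ∀ x, Function.Surjective (mfderiv 𝓘(ℝ, E) 𝓘(ℝ, F) p x)
  fibre : ∀ x y, p x = p y ↔ y ∈ A.orbitOf 𝔠 x
  ker : ∀ x, {v | mfderiv 𝓘(ℝ, E) 𝓘(ℝ, F) p x v = 0} = A.orbitTangent 𝔠 x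

end Action

variable (E M) in
/-- A `𝔤`-quasi-Poisson structure on `M`: an action `ρ` of `𝔤` and a `𝔤`-invariant bivector
field `π` with `[π,π]/2 = ρ^{⊗3}(φ)`. -/
structure QuasiPoisson [IsManifold 𝓘(ℝ, E) ∞ M] (t : 𝔤 ⊗[ℝ] 𝔤) extends Action 𝔤 E M where
  π : Bivector E M
  invariant : ∀ (u : 𝔤) (f g : M → ℝ), ContMDiff 𝓘(ℝ, E) 𝓘(ℝ, ℝ) ∞ f →
    ContMDiff 𝓘(ℝ, E) 𝓘(ℝ, ℝ) ∞ g → ∀ x,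
    dR (π.bracket f g) x (ρ u x) =
      π.bracket (fun y => dR f y (ρ u y)) g x + π.bracket f (fun y => dR g y (ρ u y)) x
  jacobi : ∀ f g h : M → ℝ, ContMDiff 𝓘(ℝ, E) 𝓘(ℝ, ℝ) ∞ f → ContMDiff 𝓘(ℝ, E) 𝓘(ℝ, ℝ) ∞ g →
    ContMDiff 𝓘(ℝ, E) 𝓘(ℝ, ℝ) ∞ h → ∀ x, π.jacobiator f g h x =
      cartan t (toAction.pullback x (dR f x)) (toAction.pullback x (dR g x))
        (toAction.pullback x (dR h x))

namespace QuasiPoisson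

variable [IsManifold 𝓘(ℝ, E) ∞ M] {t : 𝔤 ⊗[ℝ] 𝔤}

/-- `σ = π + ½ ρ^{⊗2}(t)`. -/
def σ (P : QuasiPoisson E M t) (x : M) (α β : TangentSpace 𝓘(ℝ, E) x →L[ℝ] ℝ) : ℝ :=
  P.π.form x α β + (1 / 2) * pairing t (P.toAction.pullback x α) (P.toAction.pullback x β)

/-- `f` is left-central: `σ(df, ·) = 0`. -/
def IsLeftCentral (P : QuasiPoisson E M t) (f : M → ℝ) : Prop :=
  ∀ (x : M) (β : TangentSpace 𝓘(ℝ, E) x →L[ℝ] ℝ), P.σ x (dR f x) β = 0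

/-- `f` is right-central: `σ(·, df) = 0`. -/
def IsRightCentral (P : QuasiPoisson E M t) (f : M → ℝ) : Prop :=
  ∀ (x : M) (α : TangentSpace 𝓘(ℝ, E) x →L[ℝ] ℝ), P.σ x α (dR f x) = 0

/-- Quasi-Poisson-commutative: `σ = 0`. -/
def IsCommutative (P : QuasiPoisson E M t) : Prop :=
  ∀ (x : M) (α β : TangentSpace 𝓘(ℝ, E) x →L[ℝ] ℝ), P.σ x α β = 0

/-- `T^{big}M = TM`: every tangent vector is of the form `ρ(u) + π(α, ·)`. -/
def HasFullBigDistribution (P : QuasiPoisson E M t) : Prop :=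
  ∀ (x : M) (v : TangentSpace 𝓘(ℝ, E) x),
    ∃ (u : 𝔤) (α : TangentSpace 𝓘(ℝ, E) x →L[ℝ] ℝ),
      ∀ β : TangentSpace 𝓘(ℝ, E) x →L[ℝ] ℝ, β v = β (P.ρ u x) + P.π.form x α β

variable {F : Type*} [NormedAddCommGroup F] [NormedSpace ℝ F]
  {N : Type*} [TopologicalSpace N] [ChartedSpace F N] [IsManifold 𝓘(ℝ, F) ∞ N]

/-- A smooth `𝔤`-equivariant map. -/
def IsEquivariant (P : QuasiPoisson E M t) (C : QuasiPoisson F N t) (μ : M → N) : Prop :=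
  ContMDiff 𝓘(ℝ, E) 𝓘(ℝ, F) ∞ μ ∧
    ∀ (u : 𝔤) (x : M), mfderiv 𝓘(ℝ, E) 𝓘(ℝ, F) μ x (P.ρ u x) = C.ρ u (μ x)

/-- A left central map to a quasi-Poisson-commutative manifold. -/
structure IsLeftCentralMap (P : QuasiPoisson E M t) (C : QuasiPoisson F N t) (μ : M → N) :
    Prop where
  commutative : C.IsCommutative
  equivariant : P.IsEquivariant C μ
  central : ∀ f : N → ℝ, ContMDiff 𝓘(ℝ, F) 𝓘(ℝ, ℝ) ∞ f → P.IsLeftCentral (f ∘ μ)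

/-- A right central map to a quasi-Poisson-commutative manifold. -/
structure IsRightCentralMap (P : QuasiPoisson E M t) (C : QuasiPoisson F N t) (μ : M → N) :
    Prop where
  commutative : C.IsCommutative
  equivariant : P.IsEquivariant C μ
  central : ∀ f : N → ℝ, ContMDiff 𝓘(ℝ, F) 𝓘(ℝ, ℝ) ∞ f → P.IsRightCentral (f ∘ μ)

end QuasiPoisson

end QuasiPoisson

/-! ### Central pairs and their reduction -/

section CentralPair

variable {𝔤 : Type*} [LieRing 𝔤] [LieAlgebra ℝ 𝔤] {t : 𝔤 ⊗[ℝ] 𝔤}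
  {E : Type*} [NormedAddCommGroup E] [NormedSpace ℝ E]
  {M : Type*} [TopologicalSpace M] [ChartedSpace E M] [IsManifold 𝓘(ℝ, E) ∞ M]
  {EL : Type*} [NormedAddCommGroup EL] [NormedSpace ℝ EL]
  {NL : Type*} [TopologicalSpace NL] [ChartedSpace EL NL] [IsManifold 𝓘(ℝ, EL) ∞ NL]
  {ER : Type*} [NormedAddCommGroup ER] [NormedSpace ℝ ER]
  {NR : Type*} [TopologicalSpace NR] [ChartedSpace ER NR] [IsManifold 𝓘(ℝ, ER) ∞ NR]

/-- A central pair `N_L ← M → N_R`. -/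
structure IsCentralPair (P : QuasiPoisson E M t) (CL : QuasiPoisson EL NL t)
    (CR : QuasiPoisson ER NR t) (μL : M → NL) (μR : M → NR) : Prop where
  left : P.IsLeftCentralMap CL μL
  right : P.IsRightCentralMap CR μR

/-- A split-symplectic central pair. -/
structure IsSplitSymplecticPair (P : QuasiPoisson E M t) (CL : QuasiPoisson EL NL t)
    (CR : QuasiPoisson ER NR t) (μL : M → NL) (μR : M → NR) : Prop
    extends IsCentralPair P CL CR μL μR where
  nondegenerate : IsNondegenerate t
  bigLeaf : P.HasFullBigDistribution
  transitive_left : CL.toAction.IsTransitive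
  transitive_right : CR.toAction.IsTransitive
  lagrangian_left : ∀ y, IsLagrangian t (CL.toAction.stabilizer y)
  lagrangian_right : ∀ y, IsLagrangian t (CR.toAction.stabilizer y)

/-- `μ_L × μ_R : M → N_L × N_R` is transverse to `O_L × O_R`, where `O_L` and `O_R` are
`𝔠`-orbits (so that their tangent spaces are given by `ρ(𝔠)`). -/
def IsTransverse (𝔠 : LieSubalgebra ℝ 𝔤) (AL : Action 𝔤 EL NL) (AR : Action 𝔤 ER NR)
    (μL : M → NL) (μR : M → NR) (OL : Set NL) (OR : Set NR) : Prop :=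
  ∀ x ∈ μL ⁻¹' OL ∩ μR ⁻¹' OR,
    ∀ (a : TangentSpace 𝓘(ℝ, EL) (μL x)) (b : TangentSpace 𝓘(ℝ, ER) (μR x)),
      ∃ v : TangentSpace 𝓘(ℝ, E) x,
        ∃ l ∈ AL.orbitTangent 𝔠 (μL x), ∃ r ∈ AR.orbitTangent 𝔠 (μR x),
          a = mfderiv 𝓘(ℝ, E) 𝓘(ℝ, EL) μL x v + l ∧ b = mfderiv 𝓘(ℝ, E) 𝓘(ℝ, ER) μR x v + r

/-- The tangent space at `x` of `μ_L⁻¹(O_L) ∩ μ_R⁻¹(O_R)`, for `𝔠`-orbits `O_L`, `O_R`. -/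
def levelTangent (𝔠 : LieSubalgebra ℝ 𝔤) (AL : Action 𝔤 EL NL) (AR : Action 𝔤 ER NR)
    (μL : M → NL) (μR : M → NR) (x : M) : Set (TangentSpace 𝓘(ℝ, E) x) :=
  {v | mfderiv 𝓘(ℝ, E) 𝓘(ℝ, EL) μL x v ∈ AL.orbitTangent 𝔠 (μL x) ∧
    mfderiv 𝓘(ℝ, E) 𝓘(ℝ, ER) μR x v ∈ AR.orbitTangent 𝔠 (μR x)}

end CentralPair

/-- `πQ = p_* π`. -/
def IsPushforward {E : Type*} [NormedAddCommGroup E] [NormedSpace ℝ E]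
    {M : Type*} [TopologicalSpace M] [ChartedSpace E M]
    {F : Type*} [NormedAddCommGroup F] [NormedSpace ℝ F]
    {Q : Type*} [TopologicalSpace Q] [ChartedSpace F Q]
    (p : M → Q) (π : Bivector E M) (πQ : Bivector F Q) : Prop :=
  ∀ (x : M) (α β : TangentSpace 𝓘(ℝ, F) (p x) →L[ℝ] ℝ),
    πQ.form (p x) α β = π.form x (α.comp (mfderiv 𝓘(ℝ, E) 𝓘(ℝ, F) p x))
      (β.comp (mfderiv 𝓘(ℝ, E) 𝓘(ℝ, F) p x))

end

end CentralReduction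

set_option linter.unusedSectionVars false

namespace CentralReduction

open Filter Topology

/-! ### Differentials, charts and local sections. -/

section Calculus

variable {E : Type*} [NormedAddCommGroup E] [NormedSpace ℝ E]
  {M : Type*} [TopologicalSpace M] [ChartedSpace E M]
  {F : Type*} [NormedAddCommGroup F] [NormedSpace ℝ F]
  {N : Type*} [TopologicalSpace N] [ChartedSpace F N]

/-! Write π♯ for `anchor`, ρ* for `pullback`, t♯ for `sharp`. A covector pulled back from M/𝔠 kills
ρ(𝔠), so its image under ρ* lies in Ann 𝔠 and, 𝔠 being Lagrangian, t♯ sends that image into 𝔠. Hence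
φ vanishes on basic functions. Their brackets are constant on 𝔠-orbits, so π descends to a Poisson
structure (`QuasiPoisson.reduced`, `QuasiPoisson.isPoisson_reduced`).

Centrality of the two maps means dμ_L(π♯γ) = ½ρ(t♯ρ*γ) and dμ_R(π♯γ) = −½ρ(t♯ρ*γ). For basic γ both
are in ρ(𝔠), so the image of π_red lies in dp(TZ). The reverse inclusion is the heart of the proof
(`IsSplitSymplecticPair.map_levelSpace`). Let β kill the image of π_red and put γ = p*β, a = t♯ρ*γ ∈
𝔠. Then π♯γ = ρ(c) with c ∈ 𝔠, and centrality puts ½a − c and ½a + c in the stabilizers of μ_L(x)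
and μ_R(x). These are Lagrangian, so the two elements are t♯ρ*β_L and t♯ρ*β_R for covectors β_L, β_R
on N_L, N_R. Since T^big M = TM, a covector is determined by ρ* and π♯ of it, which gives γ =
μ_L*β_L + μ_R*β_R. Finally ½a ∓ c ∈ 𝔠 and t is non-degenerate, so ρ*β_L and ρ*β_R kill 𝔠, and γ
kills TZ.

For the leaves, a Hamiltonian curve in M/𝔠 lifts locally to M with velocity in ρ(𝔠) plus Hamiltonian
fields of basic functions; μ_L and μ_R send such curves into 𝔠-orbits, so S is invariant
(`IsCentralPair.mem_image_of_joined`). Conversely, a curve tangent to S stays in one leaf because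
π_red has constant rank on S: transversality expresses the rank through the dimensions of ρ(𝔠) on
the two orbits, and these are constant along orbits (`Action.finrank_orbitSpace_eq`). Constant rank
makes the coefficients of the velocity in Hamiltonian fields continuous. If the orbits are embedded,
their local equations, pulled back along a local section of p, cut out S. -/

theorem exists_vector_of_dual {V : Type*} [AddCommGroup V] [Module ℝ V] [TopologicalSpace V]
    [IsTopologicalAddGroup V] [ContinuousSMul ℝ V] [T2Space V] [FiniteDimensional ℝ V]
    (φ : (V →L[ℝ] ℝ) →ₗ[ℝ] ℝ) : ∃ v : V, ∀ β : V →L[ℝ] ℝ, β v = φ β := by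
  obtain ⟨v, hv⟩ := (Module.evalEquiv ℝ V).surjective
    (φ ∘ₗ (LinearMap.toContinuousLinearMap (𝕜 := ℝ) (E := V) (F' := ℝ)).toLinearMap)
  refine ⟨v, fun β => ?_⟩
  have := LinearMap.congr_fun hv β.toLinearMap
  exact this

theorem eq_of_forall_dual {V : Type*} [AddCommGroup V] [Module ℝ V] [TopologicalSpace V]
    [IsTopologicalAddGroup V] [ContinuousSMul ℝ V] [T2Space V] [FiniteDimensional ℝ V]
    {v w : V} (h : ∀ β : V →L[ℝ] ℝ, β v = β w) : v = w := by
  rw [← sub_eq_zero, ← Module.forall_dual_apply_eq_zero_iff ℝ]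
  intro f
  simpa [sub_eq_zero] using h (LinearMap.toContinuousLinearMap f)

instance (x : M) [FiniteDimensional ℝ E] : FiniteDimensional ℝ (TangentSpace 𝓘(ℝ, E) x) :=
  inferInstanceAs (FiniteDimensional ℝ E)

instance (x : M) : T2Space (TangentSpace 𝓘(ℝ, E) x) :=
  inferInstanceAs (T2Space E)

theorem finrank_tangentSpace (x : M) :
    Module.finrank ℝ (TangentSpace 𝓘(ℝ, E) x) = Module.finrank ℝ E := rfl

theorem dR_comp {f : N → ℝ} {p : M → N} {x : M}
    (hf : MDifferentiableAt 𝓘(ℝ, F) 𝓘(ℝ, ℝ) f (p x))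
    (hp : MDifferentiableAt 𝓘(ℝ, E) 𝓘(ℝ, F) p x) :
    dR (E := E) (f ∘ p) x = (dR f (p x)).comp (mfderiv 𝓘(ℝ, E) 𝓘(ℝ, F) p x) :=
  mfderiv_comp x hf hp

theorem dR_clm_comp {Ψ : M → F} {x : M} (ℓ : F →L[ℝ] ℝ)
    (hp : MDifferentiableAt 𝓘(ℝ, E) 𝓘(ℝ, F) Ψ x) (v : TangentSpace 𝓘(ℝ, E) x) :
    dR (E := E) (fun y => ℓ (Ψ y)) x v = ℓ (mfderiv 𝓘(ℝ, E) 𝓘(ℝ, F) Ψ x v) := by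
  have h := mfderiv_comp x ((ℓ.contMDiff (n := 1)).mdifferentiableAt (by simp)) hp
  rw [ℓ.mfderiv_eq] at h
  exact DFunLike.congr_fun h v

/-- A smooth map between manifolds, in the extended charts around `x` and `p x`. -/
theorem contDiffOn_writtenInExtChartAt {p : N → M} [IsManifold 𝓘(ℝ, F) ∞ N]
    [IsManifold 𝓘(ℝ, E) ∞ M] {x : N} {O : Set N}
    (hO : IsOpen O) (hx : x ∈ O) (hp : ContMDiffOn 𝓘(ℝ, F) 𝓘(ℝ, E) ∞ p O) :
    ∃ A : Set F, IsOpen A ∧ extChartAt 𝓘(ℝ, F) x x ∈ A ∧ A ⊆ (extChartAt 𝓘(ℝ, F) x).target ∧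
      (∀ w ∈ A, (extChartAt 𝓘(ℝ, F) x).symm w ∈ O ∧
        p ((extChartAt 𝓘(ℝ, F) x).symm w) ∈ (extChartAt 𝓘(ℝ, E) (p x)).source) ∧
      ContDiffOn ℝ ∞ (writtenInExtChartAt 𝓘(ℝ, F) 𝓘(ℝ, E) x p) A := by
  let φ := extChartAt 𝓘(ℝ, F) x
  let ψ := extChartAt 𝓘(ℝ, E) (p x)
  have h1 : IsOpen (O ∩ p ⁻¹' ψ.source) :=
    hp.continuousOn.isOpen_inter_preimage hO (isOpen_extChartAt_source (p x))
  have hA : IsOpen (φ.target ∩ φ.symm ⁻¹' (O ∩ p ⁻¹' ψ.source)) :=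
    (continuousOn_extChartAt_symm x).isOpen_inter_preimage (isOpen_extChartAt_target x) h1
  refine ⟨_, hA, ⟨mem_extChartAt_target x, ?_⟩, inter_subset_left,
    fun w (hw : w ∈ φ.target ∩ φ.symm ⁻¹' (O ∩ p ⁻¹' ψ.source)) => hw.2, ?_⟩
  · change φ.symm (φ x) ∈ O ∩ p ⁻¹' ψ.source
    rw [extChartAt_to_inv]
    exact ⟨hx, mem_extChartAt_source (p x)⟩
  · rw [← contMDiffOn_iff_contDiffOn]
    have c1 : ContMDiffOn 𝓘(ℝ, F) 𝓘(ℝ, F) ∞ φ.symm (φ.target ∩ φ.symm ⁻¹' (O ∩ p ⁻¹' ψ.source)) :=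
      (contMDiffOn_extChartAt_symm x).mono inter_subset_left
    have c2 : ContMDiffOn 𝓘(ℝ, E) 𝓘(ℝ, E) ∞ ψ ψ.source := by
      rw [extChartAt_source]; exact contMDiffOn_extChartAt
    exact c2.comp (hp.comp c1 fun w hw => (hw.2.1 : φ.symm w ∈ O)) fun w hw => hw.2.2

variable [FiniteDimensional ℝ E] [IsManifold 𝓘(ℝ, E) ∞ M]

/-- Every chart extends, after shrinking, to a globally defined smooth map. -/
theorem exists_smooth_chart [T2Space M] (x : M) : ∃ Ψ : M → E, ContMDiff 𝓘(ℝ, E) 𝓘(ℝ, E) ∞ Ψ ∧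
    (∀ᶠ y in 𝓝 x, Ψ y = extChartAt 𝓘(ℝ, E) x y) ∧
    ∀ᶠ y in 𝓝 x, Function.Bijective (mfderiv 𝓘(ℝ, E) 𝓘(ℝ, E) Ψ y) := by
  let b : SmoothBumpFunction 𝓘(ℝ, E) x := Classical.arbitrary _
  have h1 : (fun y => b y • extChartAt 𝓘(ℝ, E) x y) =ᶠ[𝓝 x] extChartAt 𝓘(ℝ, E) x := by
    filter_upwards [b.eventuallyEq_one] with y hy
    simp [hy]
  refine ⟨fun y => b y • extChartAt 𝓘(ℝ, E) x y, ?_, h1, ?_⟩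
  · exact b.contMDiff_smul (contMDiffOn_extChartAt (n := ∞))
  · filter_upwards [h1.eventuallyEq_nhds, extChartAt_source_mem_nhds (I := 𝓘(ℝ, E)) x] with y hy hy'
    rw [hy.mfderiv_eq]
    have : IsManifold 𝓘(ℝ, E) 1 M := IsManifold.of_le (n := ∞) (by norm_num)
    have := isInvertible_mfderiv_extChartAt (I := 𝓘(ℝ, E)) (𝕜 := ℝ) hy'
    obtain ⟨e, he⟩ := this
    rw [← he]
    exact e.bijective

/-- A linear functional of a globally extended chart does it. Thus hypotheses on smooth functions,
such as centrality or constancy of brackets, become pointwise statements about arbitrary covectors.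
-/
theorem exists_dR_eq [T2Space M] (x : M) (α : TangentSpace 𝓘(ℝ, E) x →L[ℝ] ℝ) :
    ∃ f : M → ℝ, ContMDiff 𝓘(ℝ, E) 𝓘(ℝ, ℝ) ∞ f ∧ dR f x = α := by
  obtain ⟨Ψ, hΨ, -, hb⟩ := exists_smooth_chart (E := E) x
  let e := (LinearEquiv.ofBijective (mfderiv 𝓘(ℝ, E) 𝓘(ℝ, E) Ψ x).toLinearMap hb.self_of_nhds)
  let ℓ : E →L[ℝ] ℝ := LinearMap.toContinuousLinearMap
    ((α.toLinearMap ∘ₗ e.symm.toLinearMap : E →ₗ[ℝ] ℝ))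
  refine ⟨fun y => ℓ (Ψ y), ℓ.contMDiff.comp hΨ, ?_⟩
  ext v
  rw [dR_clm_comp ℓ (hΨ.mdifferentiableAt (by simp))]
  change α (e.symm (e v)) = α v
  simp

/-- The inverse function theorem, with a smooth inverse on the whole target. -/
theorem exists_smooth_inverse {V W : Type*} [NormedAddCommGroup V] [NormedSpace ℝ V]
    [NormedAddCommGroup W] [NormedSpace ℝ W] [CompleteSpace V] {g : V → W} {A : Set V}
    (hA : IsOpen A) (hg : ContDiffOn ℝ ∞ g A) {a : V} (ha : a ∈ A) {g' : V ≃L[ℝ] W}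
    (hg' : HasFDerivAt g (g' : V →L[ℝ] W) a) :
    ∃ e : OpenPartialHomeomorph V W, ⇑e = g ∧ a ∈ e.source ∧ e.source ⊆ A ∧
      ContDiffOn ℝ ∞ e.symm e.target := by
  have hn : (∞ : WithTop ℕ∞) ≠ 0 := by simp
  have hga : ContDiffAt ℝ ∞ g a := hg.contDiffAt (hA.mem_nhds ha)
  -- Invertibility of the derivative is an open condition. Restricting the local inverse to `B`
  -- makes it smooth at every point of its target, not only at `g a`.
  let B : Set V := A ∩ fderiv ℝ g ⁻¹' Set.range ((↑) : (V ≃L[ℝ] W) → V →L[ℝ] W)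
  have hB : IsOpen B :=
    (hg.continuousOn_fderiv_of_isOpen hA (by simp)).isOpen_inter_preimage hA
      ContinuousLinearEquiv.isOpen
  have haB : a ∈ B := ⟨ha, g', hg'.fderiv.symm⟩
  let e := (hga.toOpenPartialHomeomorph g hg' hn).restrOpen B hB
  have hsrc : e.source ⊆ B := by
    intro v hv
    exact hv.2
  refine ⟨e, rfl, ⟨hga.mem_toOpenPartialHomeomorph_source hg' hn, haB⟩,
    fun v hv => (hsrc hv).1, fun w hw => ?_⟩
  obtain ⟨hA', f', hf'⟩ := hsrc (e.map_target hw)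
  refine (e.contDiffAt_symm (f₀' := f') hw ?_ ?_).contDiffWithinAt
  · rw [hf']
    exact ((hg.contDiffAt (hA.mem_nhds hA')).differentiableAt hn).hasFDerivAt
  · exact hg.contDiffAt (hA.mem_nhds hA')

/-- A submersion has smooth local sections through every point. -/
theorem exists_local_section {p : N → M} [FiniteDimensional ℝ F] [IsManifold 𝓘(ℝ, F) ∞ N] (x : N)
    (hp : ContMDiff 𝓘(ℝ, F) 𝓘(ℝ, E) ∞ p)
    (hs : Function.Surjective (mfderiv 𝓘(ℝ, F) 𝓘(ℝ, E) p x)) :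
    ∃ τ : M → N, ∃ U : Set M, IsOpen U ∧ p x ∈ U ∧ ContMDiffOn 𝓘(ℝ, E) 𝓘(ℝ, F) ∞ τ U ∧
      τ (p x) = x ∧ ∀ y ∈ U, p (τ y) = y := by
  let φ := extChartAt 𝓘(ℝ, F) x
  let ψ := extChartAt 𝓘(ℝ, E) (p x)
  obtain ⟨R, hR⟩ := (mfderiv 𝓘(ℝ, F) 𝓘(ℝ, E) p x).toLinearMap.exists_rightInverse_of_surjective
    (LinearMap.range_eq_top.2 hs)
  let R' : E →L[ℝ] F := LinearMap.toContinuousLinearMap (R : E →ₗ[ℝ] F)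
  let pt : F → E := writtenInExtChartAt 𝓘(ℝ, F) 𝓘(ℝ, E) x p
  obtain ⟨A, hAo, hxA, hAt, hAp, hpt⟩ :=
    contDiffOn_writtenInExtChartAt isOpen_univ (mem_univ x) hp.contMDiffOn
  have hder : HasFDerivAt pt (mfderiv 𝓘(ℝ, F) 𝓘(ℝ, E) p x : F →L[ℝ] E) (φ x) := by
    have := (hp.mdifferentiableAt (x := x) (by simp)).hasMFDerivAt.2
    exact HasFDerivWithinAt.hasFDerivAt (s := Set.range 𝓘(ℝ, F)) this (by simp)
  -- An affine slice along a right inverse of dp: in charts, p ∘ j has the identity as derivative at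
  -- the base point, so it can be inverted, and j after this inverse is the section.
  let j : E → F := fun w => φ x + R' (w - ψ (p x))
  have hj : ContDiff ℝ ∞ j := by fun_prop
  have hj0 : j (ψ (p x)) = φ x := by simp [j]
  let g : E → E := pt ∘ j
  have hg : ContDiffOn ℝ ∞ g (j ⁻¹' A) := hpt.comp hj.contDiffOn fun _ h => h
  have hgd : HasFDerivAt g ((ContinuousLinearEquiv.refl ℝ E : E ≃L[ℝ] E) : E →L[ℝ] E) (ψ (p x)) := by
    have h1 : HasFDerivAt j R' (ψ (p x)) := by
      have := (hasFDerivAt_id (𝕜 := ℝ) (ψ (p x))).sub_const (ψ (p x))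
      exact (R'.hasFDerivAt.comp _ this).const_add (φ x)
    have h2 := (hj0.symm ▸ hder : HasFDerivAt pt _ (j (ψ (p x)))).comp (ψ (p x)) h1
    refine h2.congr_fderiv ?_
    ext v
    exact LinearMap.congr_fun hR v
  obtain ⟨e, heg, hsrc, hsA, hinv⟩ := exists_smooth_inverse (hAo.preimage hj.continuous) hg
    (a := ψ (p x)) (by rw [mem_preimage, hj0]; exact hxA) hgd
  have hg0 : g (ψ (p x)) = ψ (p x) := by
    change pt (j (ψ (p x))) = _
    rw [hj0]; simp [pt, φ, ψ, writtenInExtChartAt]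
  have hsymm0 : e.symm (ψ (p x)) = ψ (p x) := by
    have := e.left_inv hsrc
    rwa [heg, hg0] at this
  have hU : IsOpen (ψ.source ∩ ψ ⁻¹' e.target) :=
    (continuousOn_extChartAt (p x)).isOpen_inter_preimage (isOpen_extChartAt_source (p x))
      e.open_target
  refine ⟨fun y => φ.symm (j (e.symm (ψ y))), _, hU, ⟨mem_extChartAt_source (p x), ?_⟩, ?_, ?_, ?_⟩
  · have := e.map_source hsrc
    rwa [heg, hg0] at this
  · have c1 : ContMDiffOn 𝓘(ℝ, E) 𝓘(ℝ, E) ∞ ψ (ψ.source ∩ ψ ⁻¹' e.target) := by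
      refine contMDiffOn_extChartAt.mono ?_
      rw [← extChartAt_source 𝓘(ℝ, E)]
      exact inter_subset_left
    have c2 : ContMDiffOn 𝓘(ℝ, E) 𝓘(ℝ, F) ∞ (fun w => j (e.symm w)) e.target :=
      (hj.comp_contDiffOn hinv).contMDiffOn
    have c3 : ContMDiffOn 𝓘(ℝ, F) 𝓘(ℝ, F) ∞ φ.symm φ.target := contMDiffOn_extChartAt_symm x
    exact c3.comp (c2.comp c1 fun y hy => hy.2) fun y hy => hAt (hsA (e.map_target hy.2))
  · change φ.symm (j (e.symm (ψ (p x)))) = x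
    rw [hsymm0, hj0]; exact extChartAt_to_inv x
  · intro y hy
    have h1 := hsA (e.map_target hy.2)
    have h2 := e.right_inv hy.2
    rw [heg] at h2
    exact ψ.injOn (hAp _ h1).2 hy.1 h2

end Calculus

end CentralReduction

namespace CentralReduction

open Filter Topology

/-! ### Curves with prescribed velocity and orbits of families of vector fields. -/

section Curves

variable {E : Type*} [NormedAddCommGroup E] [NormedSpace ℝ E]
  {M : Type*} [TopologicalSpace M] [ChartedSpace E M]
  {F : Type*} [NormedAddCommGroup F] [NormedSpace ℝ F]
  {N : Type*} [TopologicalSpace N] [ChartedSpace F N]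

/-- The curve `γ` has velocity `v` at `s`, within the set `T` of times. -/
def HasVelocityWithinAt (γ : ℝ → M) (T : Set ℝ) (s : ℝ) (v : TangentSpace 𝓘(ℝ, E) (γ s)) : Prop :=
  HasMFDerivWithinAt 𝓘(ℝ, ℝ) 𝓘(ℝ, E) γ T s ((1 : ℝ →L[ℝ] ℝ).smulRight v)

theorem HasVelocityWithinAt.mono {γ : ℝ → M} {T T' : Set ℝ} {s : ℝ}
    {v : TangentSpace 𝓘(ℝ, E) (γ s)} (h : HasVelocityWithinAt γ T s v) (hT : T' ⊆ T) :
    HasVelocityWithinAt γ T' s v :=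
  HasMFDerivWithinAt.mono h hT

theorem HasVelocityWithinAt.continuousWithinAt {γ : ℝ → M} {T : Set ℝ} {s : ℝ}
    {v : TangentSpace 𝓘(ℝ, E) (γ s)} (h : HasVelocityWithinAt γ T s v) :
    ContinuousWithinAt γ T s := h.1

theorem HasVelocityWithinAt.comp {γ : ℝ → M} {T : Set ℝ} {s : ℝ}
    {v : TangentSpace 𝓘(ℝ, E) (γ s)} (h : HasVelocityWithinAt γ T s v) {μ : M → N}
    (hμ : MDifferentiableAt 𝓘(ℝ, E) 𝓘(ℝ, F) μ (γ s)) :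
    HasVelocityWithinAt (fun r => μ (γ r)) T s (mfderiv 𝓘(ℝ, E) 𝓘(ℝ, F) μ (γ s) v) := by
  have h1 := hμ.hasMFDerivAt.comp_hasMFDerivWithinAt s h
  exact h1.congr_mfderiv (ContinuousLinearMap.ext_ring
    (map_smul (mfderiv 𝓘(ℝ, E) 𝓘(ℝ, F) μ (γ s)) (1 : ℝ) v))

theorem hasVelocityWithinAt_iff {γ : ℝ → E} {T : Set ℝ} {s : ℝ} {v : E} :
    HasVelocityWithinAt (E := E) γ T s v ↔ HasDerivWithinAt γ v T s := by
  refine Iff.trans hasMFDerivWithinAt_iff_hasFDerivWithinAt ?_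
  rw [hasDerivWithinAt_iff_hasFDerivWithinAt]
  have : ContinuousLinearMap.toSpanSingleton ℝ v = (1 : ℝ →L[ℝ] ℝ).smulRight v :=
    ContinuousLinearMap.ext_ring (by simp)
  rw [this]
  rfl

/-- Affine reparametrization of a curve. -/
theorem HasVelocityWithinAt.comp_affine {γ : ℝ → M} {a b : ℝ} {r : ℝ} {T T' : Set ℝ}
    {v : TangentSpace 𝓘(ℝ, E) (γ (a + r * b))} (h : HasVelocityWithinAt γ T (a + r * b) v)
    (hT : ∀ r ∈ T', a + r * b ∈ T) :
    HasVelocityWithinAt (fun r => γ (a + r * b)) T' r (b • v) := by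
  have h0 : HasDerivAt (fun r : ℝ => a + r * b) b r := by
    simpa using ((hasDerivAt_id r).mul_const b).const_add a
  have h1 : HasVelocityWithinAt (E := ℝ) (fun r : ℝ => a + r * b) T' r b :=
    hasVelocityWithinAt_iff.2 h0.hasDerivWithinAt
  have h2 := HasMFDerivWithinAt.comp (g := γ) (f := fun r : ℝ => a + r * b) r h h1 hT
  refine h2.congr_mfderiv (ContinuousLinearMap.ext_ring ?_)
  change ((1 : ℝ) * b) • v = (1 : ℝ) • (b • v)
  simp

theorem joined_iff {G : Set (∀ x : M, TangentSpace 𝓘(ℝ, E) x)} {x y : M} :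
    Joined G x y ↔ ∃ (k : ℕ) (X : Fin k → ∀ x : M, TangentSpace 𝓘(ℝ, E) x) (a : Fin k → ℝ → ℝ)
      (γ : ℝ → M), (∀ i, X i ∈ G) ∧ (∀ i, Continuous (a i)) ∧ γ 0 = x ∧ γ 1 = y ∧
      ∀ s ∈ Icc (0 : ℝ) 1, HasVelocityWithinAt γ (Icc 0 1) s (∑ i, a i s • X i (γ s)) :=
  Iff.rfl

/-- A curve between arbitrary times, with coefficients that are continuous between these times,
joins its end points. -/
theorem joined_of_uIcc {G : Set (∀ x : M, TangentSpace 𝓘(ℝ, E) x)} {k : ℕ}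
    {X : Fin k → ∀ x : M, TangentSpace 𝓘(ℝ, E) x} {c : Fin k → ℝ → ℝ} {γ : ℝ → M} {a b : ℝ}
    (hX : ∀ i, X i ∈ G) (hc : ∀ i, ContinuousOn (c i) (uIcc a b))
    (hγ : ∀ s ∈ uIcc a b, HasVelocityWithinAt γ (uIcc a b) s (∑ i, c i s • X i (γ s))) :
    Joined G (γ a) (γ b) := by
  have key : ∀ r ∈ Icc (0 : ℝ) 1, a + r * (b - a) ∈ uIcc a b := by
    intro r hr
    rw [← segment_eq_uIcc, segment_eq_image']
    exact ⟨r, hr, by simp⟩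
  -- `Joined` asks for coefficients continuous on all of ℝ, while `c` is controlled only between `a`
  -- and `b`; clamping the time to [0,1] extends them.
  let pr : ℝ → ℝ := fun r => (projIcc (0 : ℝ) 1 zero_le_one r : ℝ)
  have hpr : Continuous pr := continuous_subtype_val.comp continuous_projIcc
  have hprm : ∀ r, pr r ∈ Icc (0 : ℝ) 1 := fun r => (projIcc (0 : ℝ) 1 zero_le_one r).2
  have hpre : ∀ r ∈ Icc (0 : ℝ) 1, pr r = r := fun r hr => by simp [pr, projIcc_of_mem _ hr]
  refine joined_iff.2 ⟨k, X, fun i r => (b - a) * c i (a + pr r * (b - a)),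
    fun r => γ (a + r * (b - a)), hX, fun i => ?_, by simp, by simp, fun r hr => ?_⟩
  · refine continuous_const.mul ?_
    exact (hc i).comp_continuous (by fun_prop) fun r => key _ (hprm r)
  · have := (hγ _ (key r hr)).comp_affine (T' := Icc 0 1) key
    rw [Finset.smul_sum] at this
    simpa only [hpre r hr, smul_smul] using this

/-- The same curve run from 1 to 0: `joined_of_uIcc` does not order its end points, and its factor
`b - a` supplies the sign. -/
theorem Joined.symm {G : Set (∀ x : M, TangentSpace 𝓘(ℝ, E) x)} {x y : M} (h : Joined G x y) :
    Joined G y x := by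
  obtain ⟨k, X, a, γ, hX, ha, rfl, rfl, hγ⟩ := joined_iff.1 h
  refine joined_of_uIcc (c := a) hX (fun i => (ha i).continuousOn) ?_
  rwa [uIcc_of_ge zero_le_one]

theorem mem_orbit_self (G : Set (∀ x : M, TangentSpace 𝓘(ℝ, E) x)) (x : M) : x ∈ orbit G x :=
  Relation.ReflTransGen.refl

theorem mem_orbit_symm {G : Set (∀ x : M, TangentSpace 𝓘(ℝ, E) x)} {x y : M} (h : y ∈ orbit G x) :
    x ∈ orbit G y := by
  have : Std.Symm (Joined G) := ⟨fun _ _ h => h.symm⟩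
  exact Relation.ReflTransGen.stdSymm.symm _ _ h

theorem mem_orbit_trans {G : Set (∀ x : M, TangentSpace 𝓘(ℝ, E) x)} {x y z : M}
    (h : y ∈ orbit G x) (h' : z ∈ orbit G y) : z ∈ orbit G x :=
  Relation.ReflTransGen.trans h h'

/-- A local comparison of the points of a curve extends to its end points. -/
theorem forall_Icc_of_local {R : ℝ → ℝ → Prop} (hR : ∀ r s t, R r s → R s t → R r t)
    (h : ∀ s ∈ Icc (0 : ℝ) 1, ∀ᶠ r in 𝓝[Icc 0 1] s, R s r ∧ R r s) :
    ∀ r ∈ Icc (0 : ℝ) 1, ∀ s ∈ Icc (0 : ℝ) 1, R r s := by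
  intro r hr s hs
  exact isPreconnected_Icc.induction₂' R h (fun r s t _ _ _ => hR r s t) hr hs

/-- A smooth function that is annihilated by a family of vector fields is constant on orbits. -/
theorem eq_of_mem_orbit {G : Set (∀ x : M, TangentSpace 𝓘(ℝ, E) x)} {f : M → ℝ}
    (hf : MDifferentiable 𝓘(ℝ, E) 𝓘(ℝ, ℝ) f) (h : ∀ X ∈ G, ∀ x, dR f x (X x) = 0) {x y : M}
    (hy : y ∈ orbit G x) : f y = f x := by
  induction hy with
  | refl => rfl
  | tail _ hj ih =>
    rw [← ih]
    obtain ⟨k, X, a, γ, hX, ha, rfl, rfl, hγ⟩ := joined_iff.1 hj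
    have h1 : ∀ s ∈ Icc (0 : ℝ) 1, HasDerivWithinAt (fun r => f (γ r)) 0 (Icc 0 1) s := by
      intro s hs
      have := hasVelocityWithinAt_iff.1 ((hγ s hs).comp (hf (γ s)))
      have h0 : dR f (γ s) (∑ i, a i s • X i (γ s)) = 0 := by
        rw [map_sum]
        exact Finset.sum_eq_zero fun i _ => by rw [map_smul, h (X i) (hX i) (γ s), smul_zero]
      exact h0 ▸ this
    exact (constant_of_derivWithin_zero (fun s hs => (h1 s hs).differentiableWithinAt)
      (fun s hs => (h1 s (Ico_subset_Icc_self hs)).derivWithin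
        (uniqueDiffOn_Icc zero_lt_one s (Ico_subset_Icc_self hs))) 1 (by simp))

end Curves

end CentralReduction

namespace CentralReduction

open Filter Topology

noncomputable section

/-! ### The tensor t, Lagrangian subspaces and the anchor of a bivector. -/

section Algebra

variable {𝔤 : Type*} [LieRing 𝔤] [LieAlgebra ℝ 𝔤]

theorem pairing_comm (t : 𝔤 ⊗[ℝ] 𝔤) (ht : IsInvariantSymmetric t) (α β : Module.Dual ℝ 𝔤) :
    pairing t α β = pairing t β α := by
  have key : ∀ s : 𝔤 ⊗[ℝ] 𝔤, pairing (TensorProduct.comm ℝ 𝔤 𝔤 s) α β = pairing s β α := by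
    intro s
    induction s with
    | zero => simp [pairing, sharp]
    | tmul a b => simp [pairing, sharp_tmul, mul_comm]
    | add x y hx hy =>
      have hadd : ∀ (x y : 𝔤 ⊗[ℝ] 𝔤) (α β : Module.Dual ℝ 𝔤),
          pairing (x + y) α β = pairing x α β + pairing y α β := by
        intro x y α β; simp [pairing, sharp]
      rw [map_add, hadd, hadd, hx, hy]
  rw [← key t, ht.1]

theorem IsLagrangian.sharp_mem {t : 𝔤 ⊗[ℝ] 𝔤} {W : Submodule ℝ 𝔤} (h : IsLagrangian t W)
    {α : Module.Dual ℝ 𝔤} (hα : ∀ u ∈ W, α u = 0) : sharp t α ∈ W := by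
  rw [← h]
  exact ⟨α, (Submodule.mem_dualAnnihilator α).2 hα, rfl⟩

theorem IsLagrangian.exists_sharp_eq {t : 𝔤 ⊗[ℝ] 𝔤} {W : Submodule ℝ 𝔤} (h : IsLagrangian t W)
    {u : 𝔤} (hu : u ∈ W) : ∃ α : Module.Dual ℝ 𝔤, (∀ u ∈ W, α u = 0) ∧ sharp t α = u := by
  rw [← h] at hu
  obtain ⟨α, hα, rfl⟩ := hu
  exact ⟨α, (Submodule.mem_dualAnnihilator α).1 hα, rfl⟩

end Algebra

section Anchor

variable {E : Type*} [NormedAddCommGroup E] [NormedSpace ℝ E] [FiniteDimensional ℝ E]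
  {M : Type*} [TopologicalSpace M] [ChartedSpace E M]

namespace Bivector

theorem exists_anchor (π : Bivector E M) (x : M) (α : TangentSpace 𝓘(ℝ, E) x →L[ℝ] ℝ) :
    ∃ v : TangentSpace 𝓘(ℝ, E) x, ∀ β : TangentSpace 𝓘(ℝ, E) x →L[ℝ] ℝ, β v = π.form x α β :=
  exists_vector_of_dual (π.form x α)

/-- The map `α ↦ π(α, ·)`, `T*ₓM → TₓM`. -/
def anchor (π : Bivector E M) (x : M) :
    (TangentSpace 𝓘(ℝ, E) x →L[ℝ] ℝ) →ₗ[ℝ] TangentSpace 𝓘(ℝ, E) x where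
  toFun α := (π.exists_anchor x α).choose
  map_add' α β := eq_of_forall_dual fun γ => by
    refine ((π.exists_anchor x (α + β)).choose_spec γ).trans ?_
    rw [map_add γ, (π.exists_anchor x α).choose_spec, (π.exists_anchor x β).choose_spec, map_add,
      LinearMap.add_apply]
  map_smul' c α := eq_of_forall_dual fun γ => by
    refine ((π.exists_anchor x (c • α)).choose_spec γ).trans ?_
    rw [RingHom.id_apply, map_smul γ, (π.exists_anchor x α).choose_spec, map_smul,
      LinearMap.smul_apply]

theorem apply_anchor (π : Bivector E M) (x : M) (α β : TangentSpace 𝓘(ℝ, E) x →L[ℝ] ℝ) :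
    β (π.anchor x α) = π.form x α β :=
  (π.exists_anchor x α).choose_spec β

theorem image_eq_range (π : Bivector E M) (x : M) :
    π.image x = (LinearMap.range (π.anchor x) : Set (TangentSpace 𝓘(ℝ, E) x)) := by
  ext v
  constructor
  · rintro ⟨α, hα⟩
    exact ⟨α, eq_of_forall_dual fun β => by rw [hα, apply_anchor]⟩
  · rintro ⟨α, rfl⟩
    exact ⟨α, fun β => π.apply_anchor x α β⟩

/-- The Hamiltonian vector field of `g`. -/
def hamiltonian (π : Bivector E M) (g : M → ℝ) (x : M) : TangentSpace 𝓘(ℝ, E) x :=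
  π.anchor x (dR g x)

theorem hamiltonian_mem (π : Bivector E M) {g : M → ℝ} (hg : ContMDiff 𝓘(ℝ, E) 𝓘(ℝ, ℝ) ∞ g) :
    π.hamiltonian g ∈ π.hamiltonianFields :=
  ⟨g, hg, fun x β => π.apply_anchor x _ β⟩

theorem eq_hamiltonian_of_mem (π : Bivector E M) {X : ∀ x : M, TangentSpace 𝓘(ℝ, E) x}
    (hX : X ∈ π.hamiltonianFields) :
    ∃ g, ContMDiff 𝓘(ℝ, E) 𝓘(ℝ, ℝ) ∞ g ∧ X = π.hamiltonian g := by
  obtain ⟨g, hg, h⟩ := hX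
  refine ⟨g, hg, funext fun x => eq_of_forall_dual fun β => ?_⟩
  rw [h, hamiltonian, apply_anchor]

theorem dR_hamiltonian (π : Bivector E M) (f g : M → ℝ) (x : M) :
    dR (E := E) f x (π.hamiltonian g x) = π.bracket g f x :=
  π.apply_anchor x _ _

end Bivector

end Anchor

/-! ### Descent of π to a Poisson structure on the quotient. -/

section Pushforward

variable {𝔤 : Type*} [LieRing 𝔤] [LieAlgebra ℝ 𝔤] {t : 𝔤 ⊗[ℝ] 𝔤}
  {E : Type*} [NormedAddCommGroup E] [NormedSpace ℝ E] [FiniteDimensional ℝ E]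
  {M : Type*} [TopologicalSpace M] [T2Space M] [ChartedSpace E M] [IsManifold 𝓘(ℝ, E) ∞ M]
  {F : Type*} [NormedAddCommGroup F] [NormedSpace ℝ F] [FiniteDimensional ℝ F]
  {Q : Type*} [TopologicalSpace Q] [T2Space Q] [ChartedSpace F Q] [IsManifold 𝓘(ℝ, F) ∞ Q]

theorem Action.IsQuotient.dR_comp_apply {A : Action 𝔤 E M} {𝔠 : LieSubalgebra ℝ 𝔤} {p : M → Q}
    (hp : A.IsQuotient (F := F) 𝔠 p) {f : Q → ℝ} (hf : ContMDiff 𝓘(ℝ, F) 𝓘(ℝ, ℝ) ∞ f)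
    {u : 𝔤} (hu : u ∈ 𝔠) (x : M) : dR (f ∘ p) x (A.ρ u x) = 0 := by
  rw [dR_comp (hf.mdifferentiableAt (by simp)) (hp.smooth.mdifferentiableAt (by simp))]
  have h : A.ρ u x ∈ {v | mfderiv 𝓘(ℝ, E) 𝓘(ℝ, F) p x v = 0} := by
    rw [hp.ker]; exact ⟨u, hu, rfl⟩
  change dR f (p x) (mfderiv 𝓘(ℝ, E) 𝓘(ℝ, F) p x (A.ρ u x)) = 0
  rw [show mfderiv 𝓘(ℝ, E) 𝓘(ℝ, F) p x (A.ρ u x) = 0 from h, map_zero]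

/-- The bracket of two basic functions is constant on the fibres of the quotient. -/
theorem QuasiPoisson.bracket_comp_eq (P : QuasiPoisson E M t) {𝔠 : LieSubalgebra ℝ 𝔤} {p : M → Q}
    (hp : P.toAction.IsQuotient (F := F) 𝔠 p) {f g : Q → ℝ} (hf : ContMDiff 𝓘(ℝ, F) 𝓘(ℝ, ℝ) ∞ f)
    (hg : ContMDiff 𝓘(ℝ, F) 𝓘(ℝ, ℝ) ∞ g) {x y : M} (hxy : p x = p y) :
    P.π.bracket (f ∘ p) (g ∘ p) x = P.π.bracket (f ∘ p) (g ∘ p) y := by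
  have hfp := hf.comp hp.smooth
  have hgp := hg.comp hp.smooth
  refine (eq_of_mem_orbit (E := E) ((P.π.smooth _ _ hfp hgp).mdifferentiable (by simp)) ?_
    ((hp.fibre x y).1 hxy)).symm
  rintro X ⟨u, hu, rfl⟩ z
  -- The derivative of a basic function along ρ(u), u ∈ 𝔠, vanishes identically, so both terms of
  -- the invariance identity are brackets with a constant.
  have h0 : ∀ {k : Q → ℝ}, ContMDiff 𝓘(ℝ, F) 𝓘(ℝ, ℝ) ∞ k →
      dR (E := E) (fun y => dR (k ∘ p) y (P.ρ u y)) z = dR (fun _ => (0 : ℝ)) z := by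
    intro k hk
    congr 1
    exact funext fun y => hp.dR_comp_apply hk hu y
  have h1 : dR (E := E) (fun _ : M => (0 : ℝ)) z = 0 := mfderiv_const
  refine (P.invariant u _ _ hfp hgp z).trans ?_
  unfold Bivector.bracket
  rw [h0 hf, h0 hg, h1]
  simp

/-- The pullback of a covector under the differential of `p` at `x`. -/
def pullCovector (p : M → Q) (x : M) : (F →L[ℝ] ℝ) →ₗ[ℝ] (TangentSpace 𝓘(ℝ, E) x →L[ℝ] ℝ) where
  toFun α := ContinuousLinearMap.comp (M₂ := TangentSpace 𝓘(ℝ, F) (p x)) α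
    (mfderiv 𝓘(ℝ, E) 𝓘(ℝ, F) p x)
  map_add' _ _ := rfl
  map_smul' _ _ := rfl

/-- Extend α and β to differentials of functions on Q; the bracket of their pullbacks is constant on
fibres. Typing covectors on the model space `F` allows the same α at `p x` and `p y` without a
transport. -/
theorem QuasiPoisson.form_pullCovector_eq (P : QuasiPoisson E M t) {𝔠 : LieSubalgebra ℝ 𝔤}
    {p : M → Q} (hp : P.toAction.IsQuotient (F := F) 𝔠 p) (α β : F →L[ℝ] ℝ)
    {x y : M}
    (hxy : p x = p y) :
    P.π.form x (pullCovector (F := F) p x α) (pullCovector (F := F) p x β) =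
      P.π.form y (pullCovector (F := F) p y α) (pullCovector (F := F) p y β) := by
  obtain ⟨f, hf, hfα⟩ := exists_dR_eq (E := F) (p x) α
  obtain ⟨g, hg, hgβ⟩ := exists_dR_eq (E := F) (p x) β
  have key : ∀ {k : Q → ℝ} {κ : F →L[ℝ] ℝ}, ContMDiff 𝓘(ℝ, F) 𝓘(ℝ, ℝ) ∞ k → ∀ q z, q = p z →
      dR k q = κ → dR (E := E) (k ∘ p) z = pullCovector (F := F) p z κ := by
    rintro k κ hk q z rfl rfl
    exact dR_comp (hk.mdifferentiableAt (by simp)) (hp.smooth.mdifferentiableAt (by simp))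
  rw [← key hf _ x rfl hfα, ← key hg _ x rfl hgβ, ← key hf _ y hxy hfα, ← key hg _ y hxy hgβ]
  exact P.bracket_comp_eq hp hf hg hxy

/-- The bivector field `p_* π` on the quotient. -/
def QuasiPoisson.reduced (P : QuasiPoisson E M t) {𝔠 : LieSubalgebra ℝ 𝔤}
    {p : M → Q} (hp : P.toAction.IsQuotient (F := F) 𝔠 p) : Bivector F Q where
  form q := (P.π.form (Function.surjInv hp.surjective q)).compl₁₂ (pullCovector (F := F) p _)
    (pullCovector (F := F) p _)
  skew q α β := P.π.skew _ _ _
  smooth f g hf hg := by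
    intro q
    obtain ⟨x, rfl⟩ := hp.surjective q
    -- The chosen preimages do not vary smoothly. By independence of the preimage they may be
    -- replaced near `p x` by a smooth section, along which the bracket upstairs is smooth.
    obtain ⟨τ, U, hU, hxU, hτ, -, hpτ⟩ := exists_local_section x hp.smooth (hp.submersion x)
    have h1 : ContMDiffAt 𝓘(ℝ, F) 𝓘(ℝ, ℝ) ∞
        (fun y => P.π.bracket (f ∘ p) (g ∘ p) (τ y)) (p x) :=
      ContMDiffAt.comp (p x) (P.π.smooth _ _ (hf.comp hp.smooth) (hg.comp hp.smooth)).contMDiffAt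
        (hτ.contMDiffAt (hU.mem_nhds hxU))
    refine h1.congr_of_eventuallyEq ?_
    filter_upwards [hU.mem_nhds hxU] with y hy
    have h2 : ∀ {k : Q → ℝ}, ContMDiff 𝓘(ℝ, F) 𝓘(ℝ, ℝ) ∞ k →
        dR (E := E) (k ∘ p) (τ y) = pullCovector (F := F) p (τ y) (dR (E := F) k y) := by
      intro k hk
      rw [dR_comp (hk.mdifferentiableAt (by simp)) (hp.smooth.mdifferentiableAt (by simp))]
      have : ∀ q, q = y → pullCovector (E := E) (F := F) p (τ y) (dR (E := F) k q) =
        pullCovector (F := F) p (τ y) (dR (E := F) k y) := by rintro q rfl; rfl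
      exact this _ (hpτ y hy)
    change P.π.form _ (pullCovector (F := F) p _ (dR (E := F) f y)) (pullCovector (F := F) p _ (dR (E := F) g y)) =
      P.π.form _ _ _
    rw [h2 hf, h2 hg]
    exact P.form_pullCovector_eq hp _ _
      ((Function.surjInv_eq hp.surjective y).trans (hpτ y hy).symm)

theorem QuasiPoisson.isPushforward_reduced (P : QuasiPoisson E M t) {𝔠 : LieSubalgebra ℝ 𝔤}
    {p : M → Q} (hp : P.toAction.IsQuotient (F := F) 𝔠 p) :
    IsPushforward (E := E) (F := F) p P.π (P.reduced hp) := fun x α β =>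
  P.form_pullCovector_eq hp α β (Function.surjInv_eq hp.surjective (p x))

theorem QuasiPoisson.bracket_reduced (P : QuasiPoisson E M t) {𝔠 : LieSubalgebra ℝ 𝔤}
    {p : M → Q} (hp : P.toAction.IsQuotient (F := F) 𝔠 p) {f g : Q → ℝ}
    (hf : ContMDiff 𝓘(ℝ, F) 𝓘(ℝ, ℝ) ∞ f) (hg : ContMDiff 𝓘(ℝ, F) 𝓘(ℝ, ℝ) ∞ g) :
    (P.reduced hp).bracket f g ∘ p = P.π.bracket (f ∘ p) (g ∘ p) := by
  funext x
  have hpx := hp.smooth.mdifferentiableAt (x := x) (by simp)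
  simp only [Bivector.bracket, Function.comp_apply]
  rw [dR_comp (hf.mdifferentiableAt (by simp)) hpx, dR_comp (hg.mdifferentiableAt (by simp)) hpx]
  exact P.isPushforward_reduced hp x _ _

/-- The Jacobiator of basic functions is ¼⟨[t♯α, t♯β], γ⟩ with α, β, γ ∈ Ann 𝔠. Both t♯α and t♯β lie
in 𝔠, so does their bracket, and γ kills it. -/
theorem QuasiPoisson.isPoisson_reduced (P : QuasiPoisson E M t) {𝔠 : LieSubalgebra ℝ 𝔤}
    (h𝔠 : IsLagrangian t 𝔠.toSubmodule) {p : M → Q}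
    (hp : P.toAction.IsQuotient (F := F) 𝔠 p) : (P.reduced hp).IsPoisson := by
  intro f g h hf hg hh q
  obtain ⟨x, rfl⟩ := hp.surjective q
  have step : ∀ {a b c : Q → ℝ}, ContMDiff 𝓘(ℝ, F) 𝓘(ℝ, ℝ) ∞ a → ContMDiff 𝓘(ℝ, F) 𝓘(ℝ, ℝ) ∞ b →
      ContMDiff 𝓘(ℝ, F) 𝓘(ℝ, ℝ) ∞ c → (P.reduced hp).bracket a ((P.reduced hp).bracket b c) (p x) =
        P.π.bracket (a ∘ p) (P.π.bracket (b ∘ p) (c ∘ p)) x := by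
    intro a b c ha hb hc
    rw [← P.bracket_reduced hp hb hc]
    exact congrFun (P.bracket_reduced hp ha ((P.reduced hp).smooth b c hb hc)) x
  have h1 := P.jacobi _ _ _ (hf.comp hp.smooth) (hg.comp hp.smooth) (hh.comp hp.smooth) x
  unfold Bivector.jacobiator at h1 ⊢
  rw [step hf hg hh, step hg hh hf, step hh hf hg, h1]
  have hann : ∀ {k : Q → ℝ}, ContMDiff 𝓘(ℝ, F) 𝓘(ℝ, ℝ) ∞ k → ∀ u ∈ 𝔠.toSubmodule,
      P.toAction.pullback x (dR (k ∘ p) x) u = 0 := fun hk u hu => hp.dR_comp_apply hk hu x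
  have h2 := 𝔠.lie_mem (h𝔠.sharp_mem (hann hf)) (h𝔠.sharp_mem (hann hg))
  unfold cartan
  rw [hann hh _ h2, mul_zero]

theorem QuasiPoisson.anchor_reduced (P : QuasiPoisson E M t) {𝔠 : LieSubalgebra ℝ 𝔤}
    {p : M → Q} (hp : P.toAction.IsQuotient (F := F) 𝔠 p) (x : M)
    (α : TangentSpace 𝓘(ℝ, F) (p x) →L[ℝ] ℝ) :
    (P.reduced hp).anchor (p x) α = mfderiv 𝓘(ℝ, E) 𝓘(ℝ, F) p x
      (P.π.anchor x (α.comp (mfderiv 𝓘(ℝ, E) 𝓘(ℝ, F) p x))) := by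
  refine eq_of_forall_dual fun β => ?_
  rw [Bivector.apply_anchor, P.isPushforward_reduced hp x, ← Bivector.apply_anchor]
  rfl

end Pushforward

end

end CentralReduction

namespace CentralReduction

open Filter Topology

noncomputable section

/-! ### Dimension counts and covectors of central maps. -/

section LinearAlgebra

theorem exists_dual_separating {V : Type*} [AddCommGroup V] [Module ℝ V] [TopologicalSpace V]
    [IsTopologicalAddGroup V] [ContinuousSMul ℝ V] [T2Space V] [FiniteDimensional ℝ V]
    {W : Submodule ℝ V} {v : V} (hv : v ∉ W) :
    ∃ β : V →L[ℝ] ℝ, β v ≠ 0 ∧ ∀ w ∈ W, β w = 0 := by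
  obtain ⟨f, hf, hW⟩ := Submodule.exists_le_ker_of_notMem hv
  exact ⟨LinearMap.toContinuousLinearMap f, hf, fun w hw => hW hw⟩

/-- Transversality of `f` to `U` makes V → W/U surjective, and its kernel is the preimage of `U`. -/
theorem finrank_comap_add {V W : Type*} [AddCommGroup V] [Module ℝ V] [AddCommGroup W] [Module ℝ W]
    [FiniteDimensional ℝ V] [FiniteDimensional ℝ W] (f : V →ₗ[ℝ] W) (U : Submodule ℝ W)
    (h : LinearMap.range f ⊔ U = ⊤) :
    Module.finrank ℝ (U.comap f) + Module.finrank ℝ W =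
      Module.finrank ℝ V + Module.finrank ℝ U := by
  have h1 := (U.mkQ ∘ₗ f).finrank_range_add_finrank_ker
  have h2 : LinearMap.range (U.mkQ ∘ₗ f) = ⊤ := by
    have := congrArg (Submodule.map U.mkQ) h
    rwa [Submodule.map_sup, Submodule.map_top, Submodule.range_mkQ, Submodule.mkQ_map_self,
      sup_bot_eq, ← LinearMap.range_comp] at this
  have h3 : LinearMap.ker (U.mkQ ∘ₗ f) = U.comap f := by
    rw [LinearMap.ker_comp, Submodule.ker_mkQ]
  rw [h2, h3, finrank_top] at h1
  have h4 := U.finrank_quotient_add_finrank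
  omega

theorem finrank_submodule_prod {V W : Type*} [AddCommGroup V] [Module ℝ V] [AddCommGroup W]
    [Module ℝ W] [FiniteDimensional ℝ V] [FiniteDimensional ℝ W] (A : Submodule ℝ V)
    (B : Submodule ℝ W) :
    Module.finrank ℝ (A.prod B) = Module.finrank ℝ A + Module.finrank ℝ B := by
  let e : (A.prod B) ≃ₗ[ℝ] A × B :=
    { toFun x := (⟨x.1.1, x.2.1⟩, ⟨x.1.2, x.2.2⟩)
      invFun y := ⟨(y.1.1, y.2.1), y.1.2, y.2.2⟩
      map_add' _ _ := rfl
      map_smul' _ _ := rfl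
      left_inv _ := rfl
      right_inv _ := rfl }
  rw [e.finrank_eq, Module.finrank_prod]

end LinearAlgebra

section ActionLemmas

variable {𝔤 : Type*} [LieRing 𝔤] [LieAlgebra ℝ 𝔤]
  {E : Type*} [NormedAddCommGroup E] [NormedSpace ℝ E]
  {M : Type*} [TopologicalSpace M] [ChartedSpace E M] [IsManifold 𝓘(ℝ, E) ∞ M]

/-- The infinitesimal action at a point. -/
def Action.eval (A : Action 𝔤 E M) (x : M) : 𝔤 →ₗ[ℝ] TangentSpace 𝓘(ℝ, E) x :=
  LinearMap.proj x ∘ₗ A.ρ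

/-- The subspace `ρ(𝔠)ₓ`. -/
def Action.orbitSpace (A : Action 𝔤 E M) (𝔠 : LieSubalgebra ℝ 𝔤) (x : M) :
    Submodule ℝ (TangentSpace 𝓘(ℝ, E) x) :=
  𝔠.toSubmodule.map (A.eval x)

theorem Action.mem_orbitSpace {A : Action 𝔤 E M} {𝔠 : LieSubalgebra ℝ 𝔤} {x : M}
    {v : TangentSpace 𝓘(ℝ, E) x} : v ∈ A.orbitSpace 𝔠 x ↔ v ∈ A.orbitTangent 𝔠 x :=
  ⟨fun ⟨u, hu, h⟩ => ⟨u, hu, h.symm⟩, fun ⟨u, hu, h⟩ => ⟨u, hu, h.symm⟩⟩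

/-- The range of the dual of u ↦ ρ(u)ₓ is the annihilator of its kernel, which is the stabilizer. -/
theorem Action.exists_pullback_eq [FiniteDimensional ℝ E] (A : Action 𝔤 E M) (x : M)
    {α : Module.Dual ℝ 𝔤} (hα : ∀ u ∈ A.stabilizer x, α u = 0) :
    ∃ β : TangentSpace 𝓘(ℝ, E) x →L[ℝ] ℝ, A.pullback x β = α := by
  have h : α ∈ LinearMap.range (A.eval x).dualMap := by
    rw [LinearMap.range_dualMap_eq_dualAnnihilator_ker, Submodule.mem_dualAnnihilator]
    exact fun u hu => hα u hu
  obtain ⟨f, hf⟩ := h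
  exact ⟨LinearMap.toContinuousLinearMap f, hf⟩

end ActionLemmas

section CentralPair

variable {𝔤 : Type*} [LieRing 𝔤] [LieAlgebra ℝ 𝔤] {t : 𝔤 ⊗[ℝ] 𝔤}
  {E : Type*} [NormedAddCommGroup E] [NormedSpace ℝ E] [FiniteDimensional ℝ E]
  {M : Type*} [TopologicalSpace M] [ChartedSpace E M] [IsManifold 𝓘(ℝ, E) ∞ M]
  {F : Type*} [NormedAddCommGroup F] [NormedSpace ℝ F] [FiniteDimensional ℝ F]
  {N : Type*} [TopologicalSpace N] [T2Space N] [ChartedSpace F N] [IsManifold 𝓘(ℝ, F) ∞ N]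

theorem QuasiPoisson.IsEquivariant.pullback_comp {P : QuasiPoisson E M t} {C : QuasiPoisson F N t}
    {μ : M → N} (hμ : P.IsEquivariant C μ) (x : M) (β : TangentSpace 𝓘(ℝ, F) (μ x) →L[ℝ] ℝ) :
    P.toAction.pullback x (β.comp (mfderiv 𝓘(ℝ, E) 𝓘(ℝ, F) μ x)) =
      C.toAction.pullback (μ x) β :=
  LinearMap.ext fun u => congrArg β (hμ.2 u x)

/-- This is σ(μ*β, ·) = 0 solved for π, centrality being passed from functions to covectors;
equivariance identifies ρ*(μ*β) with the pullback of β on N. -/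
theorem QuasiPoisson.IsLeftCentralMap.form_comp {P : QuasiPoisson E M t} {C : QuasiPoisson F N t}
    {μ : M → N} (hμ : P.IsLeftCentralMap C μ) (x : M) (β : TangentSpace 𝓘(ℝ, F) (μ x) →L[ℝ] ℝ)
    (γ : TangentSpace 𝓘(ℝ, E) x →L[ℝ] ℝ) :
    P.π.form x (β.comp (mfderiv 𝓘(ℝ, E) 𝓘(ℝ, F) μ x)) γ =
      -(1 / 2) * pairing t (C.toAction.pullback (μ x) β) (P.toAction.pullback x γ) := by
  obtain ⟨f, hf, rfl⟩ := exists_dR_eq (E := F) (μ x) β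
  have h := hμ.central f hf x γ
  unfold QuasiPoisson.σ at h
  rw [dR_comp (hf.mdifferentiableAt (by simp)) (hμ.equivariant.1.mdifferentiableAt (by simp)),
    hμ.equivariant.pullback_comp] at h
  linarith

theorem QuasiPoisson.IsRightCentralMap.form_comp {P : QuasiPoisson E M t} {C : QuasiPoisson F N t}
    {μ : M → N} (hμ : P.IsRightCentralMap C μ) (x : M) (β : TangentSpace 𝓘(ℝ, F) (μ x) →L[ℝ] ℝ)
    (γ : TangentSpace 𝓘(ℝ, E) x →L[ℝ] ℝ) :
    P.π.form x γ (β.comp (mfderiv 𝓘(ℝ, E) 𝓘(ℝ, F) μ x)) =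
      -(1 / 2) * pairing t (P.toAction.pullback x γ) (C.toAction.pullback (μ x) β) := by
  obtain ⟨f, hf, rfl⟩ := exists_dR_eq (E := F) (μ x) β
  have h := hμ.central f hf x γ
  unfold QuasiPoisson.σ at h
  rw [dR_comp (hf.mdifferentiableAt (by simp)) (hμ.equivariant.1.mdifferentiableAt (by simp)),
    hμ.equivariant.pullback_comp] at h
  linarith

/-- The moment map property, dual to `form_comp`. The covector μ*β sits in the first slot of π here
and in the second for right central maps; moving it by skew-symmetry is what makes the signs of ½
opposite. -/
theorem QuasiPoisson.IsLeftCentralMap.mfderiv_anchor {P : QuasiPoisson E M t}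
    {C : QuasiPoisson F N t} {μ : M → N} (hμ : P.IsLeftCentralMap C μ)
    (ht : IsInvariantSymmetric t) (x : M) (γ : TangentSpace 𝓘(ℝ, E) x →L[ℝ] ℝ) :
    mfderiv 𝓘(ℝ, E) 𝓘(ℝ, F) μ x (P.π.anchor x γ) =
      C.ρ ((1 / 2 : ℝ) • sharp t (P.toAction.pullback x γ)) (μ x) := by
  refine eq_of_forall_dual fun β => ?_
  have h1 := P.π.apply_anchor x γ (β.comp (mfderiv 𝓘(ℝ, E) 𝓘(ℝ, F) μ x))
  rw [P.π.skew, hμ.form_comp, pairing_comm t ht] at h1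
  refine h1.trans ?_
  change _ = C.toAction.pullback (μ x) β ((1 / 2 : ℝ) • sharp t (P.toAction.pullback x γ))
  rw [map_smul, smul_eq_mul]
  unfold pairing
  ring

theorem QuasiPoisson.IsRightCentralMap.mfderiv_anchor {P : QuasiPoisson E M t}
    {C : QuasiPoisson F N t} {μ : M → N} (hμ : P.IsRightCentralMap C μ)
    (x : M) (γ : TangentSpace 𝓘(ℝ, E) x →L[ℝ] ℝ) :
    mfderiv 𝓘(ℝ, E) 𝓘(ℝ, F) μ x (P.π.anchor x γ) =
      C.ρ ((-(1 / 2) : ℝ) • sharp t (P.toAction.pullback x γ)) (μ x) := by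
  refine eq_of_forall_dual fun β => ?_
  have h1 := P.π.apply_anchor x γ (β.comp (mfderiv 𝓘(ℝ, E) 𝓘(ℝ, F) μ x))
  rw [hμ.form_comp] at h1
  refine h1.trans ?_
  change _ = C.toAction.pullback (μ x) β ((-(1 / 2) : ℝ) • sharp t (P.toAction.pullback x γ))
  rw [map_smul, smul_eq_mul]
  rfl

end CentralPair

/-! ### The tangent space of the reduced space as the image of the reduced Poisson structure. -/

section SplitSymplectic

variable {𝔤 : Type*} [LieRing 𝔤] [LieAlgebra ℝ 𝔤] {t : 𝔤 ⊗[ℝ] 𝔤}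
  {E : Type*} [NormedAddCommGroup E] [NormedSpace ℝ E] [FiniteDimensional ℝ E]
  {M : Type*} [TopologicalSpace M] [T2Space M] [ChartedSpace E M] [IsManifold 𝓘(ℝ, E) ∞ M]
  {EL : Type*} [NormedAddCommGroup EL] [NormedSpace ℝ EL] [FiniteDimensional ℝ EL]
  {NL : Type*} [TopologicalSpace NL] [T2Space NL] [ChartedSpace EL NL] [IsManifold 𝓘(ℝ, EL) ∞ NL]
  {ER : Type*} [NormedAddCommGroup ER] [NormedSpace ℝ ER] [FiniteDimensional ℝ ER]
  {NR : Type*} [TopologicalSpace NR] [T2Space NR] [ChartedSpace ER NR] [IsManifold 𝓘(ℝ, ER) ∞ NR]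
  {F : Type*} [NormedAddCommGroup F] [NormedSpace ℝ F] [FiniteDimensional ℝ F]
  {Q : Type*} [TopologicalSpace Q] [T2Space Q] [ChartedSpace F Q] [IsManifold 𝓘(ℝ, F) ∞ Q]
  {P : QuasiPoisson E M t} {CL : QuasiPoisson EL NL t} {CR : QuasiPoisson ER NR t}
  {μL : M → NL} {μR : M → NR} {𝔠 : LieSubalgebra ℝ 𝔤} {p : M → Q}

/-- Both kinds of pulled back covectors have π♯ along the action: −½t♯ from the left map directly,
+½t♯ from the right map after skew-symmetry. -/
theorem IsCentralPair.anchor_add (hpair : IsCentralPair P CL CR μL μR)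
    (ht : IsInvariantSymmetric t) {x : M}
    (βL : TangentSpace 𝓘(ℝ, EL) (μL x) →L[ℝ] ℝ) (βR : TangentSpace 𝓘(ℝ, ER) (μR x) →L[ℝ] ℝ) :
    P.π.anchor x (βL.comp (mfderiv 𝓘(ℝ, E) 𝓘(ℝ, EL) μL x) +
        βR.comp (mfderiv 𝓘(ℝ, E) 𝓘(ℝ, ER) μR x)) =
      P.ρ ((1 / 2 : ℝ) • (sharp t (CR.toAction.pullback (μR x) βR) -
        sharp t (CL.toAction.pullback (μL x) βL))) x := by
  refine eq_of_forall_dual fun γ => ?_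
  rw [P.π.apply_anchor, map_add, LinearMap.add_apply, hpair.left.form_comp, P.π.skew x _ γ,
    hpair.right.form_comp, pairing_comm t ht (P.toAction.pullback x γ)]
  change _ = P.toAction.pullback x γ ((1 / 2 : ℝ) • (sharp t (CR.toAction.pullback (μR x) βR) -
        sharp t (CL.toAction.pullback (μL x) βL)))
  rw [map_smul, map_sub, smul_eq_mul]
  unfold pairing
  ring

/-- The hypotheses are tuned so that the difference δ of the two sides satisfies ρ*δ = 0, by adding
`hl` and `hr`, and π♯δ = 0, by subtracting them. Such a δ kills every ρ(u) + π(α, ·), hence every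
tangent vector. -/
theorem IsSplitSymplecticPair.covector_eq (hpair : IsSplitSymplecticPair P CL CR μL μR)
    (ht : IsInvariantSymmetric t) {x : M} {γ : TangentSpace 𝓘(ℝ, E) x →L[ℝ] ℝ}
    {βL : TangentSpace 𝓘(ℝ, EL) (μL x) →L[ℝ] ℝ} {βR : TangentSpace 𝓘(ℝ, ER) (μR x) →L[ℝ] ℝ}
    {c : 𝔤} (hc : P.π.anchor x γ = P.ρ c x)
    (hl : sharp t (CL.toAction.pullback (μL x) βL) =
      (1 / 2 : ℝ) • sharp t (P.toAction.pullback x γ) - c)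
    (hr : sharp t (CR.toAction.pullback (μR x) βR) =
      (1 / 2 : ℝ) • sharp t (P.toAction.pullback x γ) + c) :
    γ = βL.comp (mfderiv 𝓘(ℝ, E) 𝓘(ℝ, EL) μL x) + βR.comp (mfderiv 𝓘(ℝ, E) 𝓘(ℝ, ER) μR x) := by
  rw [← sub_eq_zero]
  set δ := γ - (βL.comp (mfderiv 𝓘(ℝ, E) 𝓘(ℝ, EL) μL x) +
    βR.comp (mfderiv 𝓘(ℝ, E) 𝓘(ℝ, ER) μR x)) with hδ
  have h1 : P.toAction.pullback x δ = P.toAction.pullback x γ -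
      (CL.toAction.pullback (μL x) βL + CR.toAction.pullback (μR x) βR) := by
    rw [← hpair.left.equivariant.pullback_comp, ← hpair.right.equivariant.pullback_comp]
    exact LinearMap.ext fun u => rfl
  have h2 : P.toAction.pullback x δ = 0 := by
    apply hpair.nondegenerate.1
    rw [h1, map_sub, map_add, hl, hr, map_zero]
    module
  have h3 : P.π.anchor x δ = 0 := by
    rw [hδ, map_sub, hc, hpair.anchor_add ht, hl, hr]
    have : (1 / 2 : ℝ) • ((1 / 2 : ℝ) • sharp t (P.toAction.pullback x γ) + c -
        ((1 / 2 : ℝ) • sharp t (P.toAction.pullback x γ) - c)) = c := by module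
    rw [this, sub_self]
  ext v
  obtain ⟨u, α, h⟩ := hpair.bigLeaf x v
  rw [h δ, P.π.skew, ← P.π.apply_anchor, h3]
  have := LinearMap.congr_fun h2 u
  change δ (P.ρ u x) = 0 at this
  rw [this]
  simp

/-- `levelTangent` as a subspace. -/
def levelSpace (𝔠 : LieSubalgebra ℝ 𝔤) (AL : Action 𝔤 EL NL) (AR : Action 𝔤 ER NR)
    (μL : M → NL) (μR : M → NR) (x : M) : Submodule ℝ (TangentSpace 𝓘(ℝ, E) x) :=
  ((AL.orbitSpace 𝔠 (μL x)).prod (AR.orbitSpace 𝔠 (μR x))).comap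
    ((mfderiv 𝓘(ℝ, E) 𝓘(ℝ, EL) μL x).toLinearMap.prod (mfderiv 𝓘(ℝ, E) 𝓘(ℝ, ER) μR x).toLinearMap)

theorem mem_levelSpace {AL : Action 𝔤 EL NL} {AR : Action 𝔤 ER NR} {x : M}
    {v : TangentSpace 𝓘(ℝ, E) x} :
    v ∈ levelSpace 𝔠 AL AR μL μR x ↔
      mfderiv 𝓘(ℝ, E) 𝓘(ℝ, EL) μL x v ∈ AL.orbitSpace 𝔠 (μL x) ∧
      mfderiv 𝓘(ℝ, E) 𝓘(ℝ, ER) μR x v ∈ AR.orbitSpace 𝔠 (μR x) := Iff.rfl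

theorem coe_levelSpace {AL : Action 𝔤 EL NL} {AR : Action 𝔤 ER NR} {x : M} :
    (levelSpace (E := E) 𝔠 AL AR μL μR x : Set (TangentSpace 𝓘(ℝ, E) x)) =
      levelTangent 𝔠 AL AR μL μR x := by
  ext v
  exact and_congr Action.mem_orbitSpace Action.mem_orbitSpace

theorem Action.IsQuotient.mem_orbitSpace_iff (hp : P.toAction.IsQuotient (F := F) 𝔠 p) {x : M}
    {v : TangentSpace 𝓘(ℝ, E) x} :
    v ∈ P.toAction.orbitSpace 𝔠 x ↔ mfderiv 𝓘(ℝ, E) 𝓘(ℝ, F) p x v = 0 := by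
  rw [Action.mem_orbitSpace, ← hp.ker]
  rfl

theorem IsCentralPair.orbitSpace_le_levelSpace (hpair : IsCentralPair P CL CR μL μR) (x : M) :
    P.toAction.orbitSpace 𝔠 x ≤ levelSpace 𝔠 CL.toAction CR.toAction μL μR x := by
  rintro _ ⟨u, hu, rfl⟩
  exact mem_levelSpace.2 ⟨⟨u, hu, (hpair.left.equivariant.2 u x).symm⟩,
    ⟨u, hu, (hpair.right.equivariant.2 u x).symm⟩⟩

/-- For γ vanishing on ρ(𝔠), the element t♯ρ*γ lies in 𝔠, and ±½ of it generates the images under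
dμ_L and dμ_R. -/
theorem IsCentralPair.anchor_mem_levelSpace (hpair : IsCentralPair P CL CR μL μR)
    (ht : IsInvariantSymmetric t) (h𝔠 : IsLagrangian t 𝔠.toSubmodule) {x : M}
    {γ : TangentSpace 𝓘(ℝ, E) x →L[ℝ] ℝ} (hγ : ∀ u ∈ 𝔠.toSubmodule, P.toAction.pullback x γ u = 0) :
    P.π.anchor x γ ∈ levelSpace 𝔠 CL.toAction CR.toAction μL μR x := by
  have h := h𝔠.sharp_mem hγ
  rw [mem_levelSpace, hpair.left.mfderiv_anchor ht, hpair.right.mfderiv_anchor]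
  exact ⟨⟨_, 𝔠.toSubmodule.smul_mem _ h, rfl⟩, ⟨_, 𝔠.toSubmodule.smul_mem _ h, rfl⟩⟩

theorem Action.IsQuotient.pullback_comp_apply (hp : P.toAction.IsQuotient (F := F) 𝔠 p) {x : M}
    (α : TangentSpace 𝓘(ℝ, F) (p x) →L[ℝ] ℝ) : ∀ u ∈ 𝔠.toSubmodule,
      P.toAction.pullback x (α.comp (mfderiv 𝓘(ℝ, E) 𝓘(ℝ, F) p x)) u = 0 := by
  intro u hu
  change α (mfderiv 𝓘(ℝ, E) 𝓘(ℝ, F) p x (P.ρ u x)) = 0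
  rw [(hp.mem_orbitSpace_iff (v := P.ρ u x)).1 ⟨u, hu, rfl⟩, map_zero]

/-- The tangent space of the reduced space is the image of the reduced Poisson structure. -/
theorem IsSplitSymplecticPair.map_levelSpace (hpair : IsSplitSymplecticPair P CL CR μL μR)
    (ht : IsInvariantSymmetric t) (h𝔠 : IsLagrangian t 𝔠.toSubmodule)
    (hp : P.toAction.IsQuotient (F := F) 𝔠 p) (x : M) :
    (levelSpace 𝔠 CL.toAction CR.toAction μL μR x).map
        (mfderiv 𝓘(ℝ, E) 𝓘(ℝ, F) p x).toLinearMap =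
      LinearMap.range ((P.reduced hp).anchor (p x)) := by
  apply le_antisymm
  · rintro _ ⟨v, hv, rfl⟩
    -- By duality it suffices that every β killing the image of π_red vanishes on dp(v); by
    -- skew-symmetry such a β lies in the kernel of the reduced anchor.
    by_contra hnot
    obtain ⟨β, hβv, hβ⟩ := exists_dual_separating hnot
    apply hβv
    set γ := β.comp (mfderiv 𝓘(ℝ, E) 𝓘(ℝ, F) p x) with hγ
    have h1 : (P.reduced hp).anchor (p x) β = 0 := by
      refine eq_of_forall_dual fun α => ?_
      rw [Bivector.apply_anchor, Bivector.skew, ← Bivector.apply_anchor, hβ _ ⟨α, rfl⟩]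
      simp
    rw [P.anchor_reduced, ← hp.mem_orbitSpace_iff] at h1
    obtain ⟨c, hc𝔠, hc⟩ := h1
    have hc : P.π.anchor x γ = P.ρ c x := hc.symm
    have ha := h𝔠.sharp_mem (hp.pullback_comp_apply β)
    set a := sharp t (P.toAction.pullback x γ) with ha'
    -- dμ_L(π♯γ) is ½ρ(a) by centrality and ρ(c) by equivariance, so ½a − c acts trivially at `μL
    -- x`. On the right the sign of ½a changes.
    have hL : (1 / 2 : ℝ) • a - c ∈ CL.toAction.stabilizer (μL x) := by
      have h2 := hpair.left.mfderiv_anchor ht x γ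
      rw [hc, hpair.left.equivariant.2] at h2
      change CL.ρ _ (μL x) = 0
      rw [map_sub, Pi.sub_apply, h2, sub_self]
    have hR : (1 / 2 : ℝ) • a + c ∈ CR.toAction.stabilizer (μR x) := by
      have h2 := hpair.right.mfderiv_anchor x γ
      rw [hc, hpair.right.equivariant.2] at h2
      change CR.ρ _ (μR x) = 0
      rw [map_add, Pi.add_apply, h2, ← Pi.add_apply, ← map_add, neg_smul, add_neg_cancel, map_zero]
      rfl
    obtain ⟨lamL, hL0, hL'⟩ := (hpair.lagrangian_left (μL x)).exists_sharp_eq hL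
    obtain ⟨lamR, hR0, hR'⟩ := (hpair.lagrangian_right (μR x)).exists_sharp_eq hR
    obtain ⟨βL, rfl⟩ := CL.toAction.exists_pullback_eq (μL x) hL0
    obtain ⟨βR, rfl⟩ := CR.toAction.exists_pullback_eq (μR x) hR0
    have hγ' := hpair.covector_eq ht hc hL' hR'
    change γ v = 0
    obtain ⟨⟨u, hu, hu'⟩, w, hw, hw'⟩ := mem_levelSpace.1 hv
    rw [hγ']
    change βL (mfderiv 𝓘(ℝ, E) 𝓘(ℝ, EL) μL x v) + βR (mfderiv 𝓘(ℝ, E) 𝓘(ℝ, ER) μR x v) = 0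
    -- For non-degenerate t and Lagrangian 𝔠, t♯α ∈ 𝔠 holds only for α ∈ Ann 𝔠.
    have half : ∀ b : 𝔤, b ∈ 𝔠.toSubmodule → ∀ α : Module.Dual ℝ 𝔤, sharp t α ∈ 𝔠.toSubmodule →
        α b = 0 := by
      intro b hb α hα
      obtain ⟨α', h1, h2⟩ := h𝔠.exists_sharp_eq hα
      rw [← hpair.nondegenerate.1 h2]
      exact h1 b hb
    have hLu := half u hu (CL.toAction.pullback (μL x) βL) (by
      rw [hL']; exact 𝔠.toSubmodule.sub_mem (𝔠.toSubmodule.smul_mem _ ha) hc𝔠)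
    have hRw := half w hw (CR.toAction.pullback (μR x) βR) (by
      rw [hR']; exact 𝔠.toSubmodule.add_mem (𝔠.toSubmodule.smul_mem _ ha) hc𝔠)
    rw [← hu', ← hw']
    change CL.toAction.pullback (μL x) βL u + CR.toAction.pullback (μR x) βR w = 0
    rw [hLu, hRw, add_zero]
  · rintro _ ⟨α, rfl⟩
    rw [P.anchor_reduced]
    exact ⟨_, hpair.anchor_mem_levelSpace ht h𝔠 (hp.pullback_comp_apply α), rfl⟩

/-- The rank of the reduced Poisson structure at points of the reduced space. -/
theorem IsSplitSymplecticPair.finrank_range_anchor (hpair : IsSplitSymplecticPair P CL CR μL μR)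
    (ht : IsInvariantSymmetric t) (h𝔠 : IsLagrangian t 𝔠.toSubmodule)
    (hp : P.toAction.IsQuotient (F := F) 𝔠 p) {OL : Set NL} {OR : Set NR}
    (htrans : IsTransverse (E := E) 𝔠 CL.toAction CR.toAction μL μR OL OR) {x : M}
    (hx : x ∈ μL ⁻¹' OL ∩ μR ⁻¹' OR) :
    Module.finrank ℝ (LinearMap.range ((P.reduced hp).anchor (p x))) +
        (Module.finrank ℝ EL + Module.finrank ℝ ER) =
      Module.finrank ℝ F + (Module.finrank ℝ (CL.toAction.orbitSpace 𝔠 (μL x)) +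
        Module.finrank ℝ (CR.toAction.orbitSpace 𝔠 (μR x))) := by
  rw [← hpair.map_levelSpace ht h𝔠 hp x]
  -- Two counts are combined: dp(T_xZ) has dimension dim T_xZ − dim ker dp, because T_xZ contains
  -- ker dp = ρ(𝔠), and transversality gives the codimension of T_xZ in T_xM.
  have h1 := finrank_comap_add (mfderiv 𝓘(ℝ, E) 𝓘(ℝ, F) p x).toLinearMap
    ((levelSpace 𝔠 CL.toAction CR.toAction μL μR x).map
        (mfderiv 𝓘(ℝ, E) 𝓘(ℝ, F) p x).toLinearMap)
    (by rw [LinearMap.range_eq_top.2 (hp.submersion x), top_sup_eq])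
  rw [Submodule.comap_map_eq_self (fun v hv => hpair.orbitSpace_le_levelSpace x
    (hp.mem_orbitSpace_iff.2 hv))] at h1
  have h2 := finrank_comap_add
    ((mfderiv 𝓘(ℝ, E) 𝓘(ℝ, EL) μL x).toLinearMap.prod (mfderiv 𝓘(ℝ, E) 𝓘(ℝ, ER) μR x).toLinearMap)
    ((CL.toAction.orbitSpace 𝔠 (μL x)).prod (CR.toAction.orbitSpace 𝔠 (μR x))) (by
      rw [eq_top_iff]
      rintro ⟨a, b⟩ -
      obtain ⟨v, l, hl, r, hr, rfl, rfl⟩ := htrans x hx a b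
      exact Submodule.mem_sup.2 ⟨_, ⟨v, rfl⟩, (l, r),
        ⟨Action.mem_orbitSpace.2 hl, Action.mem_orbitSpace.2 hr⟩, rfl⟩)
  rw [Module.finrank_prod, finrank_submodule_prod] at h2
  simp only [finrank_tangentSpace] at h1 h2
  change Module.finrank ℝ (levelSpace 𝔠 CL.toAction CR.toAction μL μR x) + _ = _ at h2
  omega

end SplitSymplectic

end

end CentralReduction

namespace CentralReduction

open Filter Topology

noncomputable section

/-! ### Continuous coefficients in families of constant rank. -/

section Selection

variable {V : Type*} [NormedAddCommGroup V] [NormedSpace ℝ V] [FiniteDimensional ℝ V]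

theorem continuousOn_of_forall_dual {X : Type*} [TopologicalSpace X] {T : Set X} {f : X → V}
    (h : ∀ ℓ : V →L[ℝ] ℝ, ContinuousOn (fun s => ℓ (f s)) T) : ContinuousOn f T := by
  let e := (Module.finBasis ℝ V).equivFunL
  have h1 : ContinuousOn (fun s => e (f s)) T := by
    refine continuousOn_pi.2 fun i => ?_
    exact h ((ContinuousLinearMap.proj (R := ℝ) (φ := fun _ => ℝ) i).comp
      (e : V →L[ℝ] (Fin (Module.finrank ℝ V) → ℝ)))
  exact (e.symm.continuous.comp_continuousOn h1).congr fun s _ => (e.symm_apply_apply _).symm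

/-- A family of continuous vectors whose span has constant dimension contains a subfamily that is
a basis of the span nearby; the coefficients in it of a continuous vector are continuous. -/
theorem exists_continuous_coeffs_of_finrank_eq {T : Set ℝ} {s₀ : ℝ} (hs₀ : s₀ ∈ T) {ι : Type*}
    {W : ι → ℝ → V} {v : ℝ → V} (hW : ∀ i, ContinuousOn (W i) T) (hv : ContinuousOn v T)
    (hmem : ∀ s ∈ T, v s ∈ Submodule.span ℝ (range fun i => W i s))
    (hrank : ∀ s ∈ T, Module.finrank ℝ (Submodule.span ℝ (range fun i => W i s)) =
      Module.finrank ℝ (Submodule.span ℝ (range fun i => W i s₀))) :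
    ∃ (n : ℕ) (j : Fin n → ι) (b : Fin n → ℝ → ℝ), ∃ U ∈ 𝓝[T] s₀, U ⊆ T ∧
      (∀ i, ContinuousOn (b i) U) ∧ ∀ s ∈ U, v s = ∑ i, b i s • W (j i) s := by
  classical
  obtain ⟨κ, a, -, hspan, hind⟩ := exists_linearIndependent' ℝ (fun i => W i s₀)
  have : Finite κ := hind.finite
  have : Fintype κ := Fintype.ofFinite κ
  let n := Fintype.card κ
  let e := Fintype.equivFin κ
  let j : Fin n → ι := fun i => a (e.symm i)
  have hindj : LinearIndependent ℝ fun i => W (j i) s₀ := hind.comp e.symm e.symm.injective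
  have hn : Module.finrank ℝ (Submodule.span ℝ (range fun i => W i s₀)) = n := by
    rw [← hspan, finrank_span_eq_card hind]
  have hinj : LinearMap.ker (Fintype.linearCombination ℝ fun i => W (j i) s₀) = ⊥ :=
    LinearMap.ker_eq_bot.2 hindj.fintypeLinearCombination_injective
  obtain ⟨A, hA⟩ := (Fintype.linearCombination ℝ fun i => W (j i) s₀).exists_leftInverse_of_injective
    hinj
  let A' : V →L[ℝ] (Fin n → ℝ) := LinearMap.toContinuousLinearMap A
  -- The selected vectors, read through a left inverse `A` fixed at s₀, form a square matrix that is
  -- the identity at s₀ and so stays invertible nearby.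
  let D : ℝ → Matrix (Fin n) (Fin n) ℝ := fun s => Matrix.of fun k l => A' (W (j l) s) k
  have hDmul : ∀ s c, (D s).mulVec c = A (∑ i, c i • W (j i) s) := by
    intro s c
    rw [map_sum]
    ext k
    simp [D, A', Matrix.mulVec, dotProduct, mul_comm]
  have hD0 : D s₀ = 1 := by
    apply Matrix.toLin'.injective
    refine LinearMap.ext fun c => ?_
    rw [Matrix.toLin'_apply, hDmul, Matrix.toLin'_one]
    exact LinearMap.congr_fun hA c
  have hDc : ContinuousOn D T := by
    refine continuousOn_pi.2 fun k => continuousOn_pi.2 fun l => ?_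
    exact (continuous_apply k).comp_continuousOn (A'.continuous.comp_continuousOn (hW (j l)))
  have hdet : ContinuousOn (fun s => (D s).det) T :=
    (continuous_id.matrix_det).comp_continuousOn hDc
  have hadj : ContinuousOn (fun s => (D s).adjugate) T :=
    (continuous_id.matrix_adjugate).comp_continuousOn hDc
  -- This is D⁻¹A v with the inverse written through the adjugate, so that continuity only needs det
  -- D ≠ 0.
  let b : ℝ → Fin n → ℝ := fun s => (D s).det⁻¹ • (D s).adjugate.mulVec (A' (v s))
  have hbc : ContinuousOn b (T ∩ {s | (D s).det ≠ 0}) := by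
    have h0 : ContinuousOn (fun s => (D s).det⁻¹) (T ∩ {s | (D s).det ≠ 0}) :=
      (hdet.mono inter_subset_left).inv₀ fun s hs => hs.2
    have h1 : Continuous fun q : Matrix (Fin n) (Fin n) ℝ × (Fin n → ℝ) => q.1.mulVec q.2 :=
      continuous_fst.matrix_mulVec continuous_snd
    have h2 : ContinuousOn (fun s => A' (v s)) T := A'.continuous.comp_continuousOn hv
    have h3 : ContinuousOn (fun s => (D s).adjugate.mulVec (A' (v s))) T :=
      h1.comp_continuousOn (f := fun s => ((D s).adjugate, A' (v s))) (hadj.prodMk h2)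
    exact h0.smul (h3.mono inter_subset_left)
  refine ⟨n, j, fun i s => b s i, T ∩ {s | (D s).det ≠ 0}, ?_, inter_subset_left, fun i => ?_,
    fun s hs => ?_⟩
  · refine inter_mem self_mem_nhdsWithin ?_
    exact (hdet s₀ hs₀).eventually (isOpen_ne.mem_nhds (by simp [hD0]))
  · exact (continuous_apply i).comp_continuousOn hbc
  · have hcancel : ∀ c : Fin n → ℝ,
        (D s).det⁻¹ • (D s).adjugate.mulVec ((D s).mulVec c) = c := by
      intro c
      rw [Matrix.mulVec_mulVec, Matrix.adjugate_mul, Matrix.smul_mulVec, Matrix.one_mulVec,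
        smul_smul, inv_mul_cancel₀ hs.2, one_smul]
    have hind' : LinearIndependent ℝ fun i => W (j i) s := by
      rw [Fintype.linearIndependent_iff]
      intro c hc i
      have := hcancel c
      rw [hDmul, hc, map_zero, Matrix.mulVec_zero, smul_zero] at this
      rw [← this]; rfl
    have hle : Submodule.span ℝ (range fun i => W (j i) s) ≤
        Submodule.span ℝ (range fun i => W i s) :=
      Submodule.span_mono (by rintro _ ⟨i, rfl⟩; exact ⟨j i, rfl⟩)
    -- Here constancy of the rank enters: the subfamily, still independent at s, must span
    -- everything.
    have heq := Submodule.eq_of_le_of_finrank_eq hle (by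
      rw [finrank_span_eq_card hind', hrank s hs.1, hn, Fintype.card_fin])
    have hvs := hmem s hs.1
    rw [← heq] at hvs
    obtain ⟨c, hc⟩ := (Submodule.mem_span_range_iff_exists_fun ℝ).1 hvs
    have hbs : b s = c := by
      have := hcancel c
      rw [hDmul, hc] at this
      exact this
    simp only [hbs, hc]

/-- The dimension of the span of a family of continuous vectors is lower semicontinuous. -/
theorem eventually_finrank_span_le {T : Set ℝ} {s₀ : ℝ} {ι : Type*}
    {W : ι → ℝ → V} (hW : ∀ i, ContinuousWithinAt (W i) T s₀) :
    ∀ᶠ s in 𝓝[T] s₀, Module.finrank ℝ (Submodule.span ℝ (range fun i => W i s₀)) ≤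
      Module.finrank ℝ (Submodule.span ℝ (range fun i => W i s)) := by
  obtain ⟨κ, a, -, hspan, hind⟩ := exists_linearIndependent' ℝ (fun i => W i s₀)
  have : Finite κ := hind.finite
  have : Fintype κ := Fintype.ofFinite κ
  have h1 : ContinuousWithinAt (fun s k => W (a k) s) T s₀ := continuousWithinAt_pi.2 fun k => hW _
  filter_upwards [h1.eventually (hind.eventually)] with s hs
  rw [← hspan, finrank_span_eq_card hind, ← finrank_span_eq_card hs]
  exact Submodule.finrank_mono (Submodule.span_mono (by rintro _ ⟨i, rfl⟩; exact ⟨a i, rfl⟩))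

end Selection

/-! ### Continuous vector fields along curves in a manifold. -/

section Curves

variable {E : Type*} [NormedAddCommGroup E] [NormedSpace ℝ E] [FiniteDimensional ℝ E]
  {M : Type*} [TopologicalSpace M] [ChartedSpace E M]

theorem eventually_uIcc_subset {U : Set ℝ} {s₀ : ℝ} (hs₀ : s₀ ∈ Icc (0 : ℝ) 1)
    (hU : U ∈ 𝓝[Icc 0 1] s₀) : ∀ᶠ s in 𝓝[Icc 0 1] s₀, uIcc s₀ s ⊆ U ∩ Icc 0 1 := by
  obtain ⟨ε, hε, h⟩ := Metric.mem_nhdsWithin_iff.1 hU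
  filter_upwards [self_mem_nhdsWithin, mem_nhdsWithin_of_mem_nhds (Metric.ball_mem_nhds s₀ hε)]
    with s hs hs'
  have h1 : uIcc s₀ s ⊆ Icc 0 1 := ordConnected_Icc.uIcc_subset hs₀ hs
  have h2 : uIcc s₀ s ⊆ Metric.ball s₀ ε := by
    rw [Real.ball_eq_Ioo] at hs' ⊢
    exact ordConnected_Ioo.uIcc_subset ⟨by linarith, by linarith⟩ hs'
  exact fun r hr => ⟨h ⟨h2 hr, h1 hr⟩, h1 hr⟩

theorem eventually_joined_of_coeffs {G : Set (∀ x : M, TangentSpace 𝓘(ℝ, E) x)} {γ : ℝ → M}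
    {s₀ : ℝ} (hs₀ : s₀ ∈ Icc (0 : ℝ) 1) {U : Set ℝ} (hU : U ∈ 𝓝[Icc 0 1] s₀) {k : ℕ}
    {X : Fin k → ∀ x : M, TangentSpace 𝓘(ℝ, E) x} {c : Fin k → ℝ → ℝ} (hX : ∀ i, X i ∈ G)
    (hc : ∀ i, ContinuousOn (c i) U)
    (hγ : ∀ s ∈ U, HasVelocityWithinAt γ (Icc 0 1) s (∑ i, c i s • X i (γ s))) :
    ∀ᶠ s in 𝓝[Icc 0 1] s₀, Joined G (γ s₀) (γ s) := by
  filter_upwards [eventually_uIcc_subset hs₀ hU] with s hs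
  exact joined_of_uIcc hX (fun i => (hc i).mono fun r hr => (hs hr).1)
    fun r hr => (hγ r (hs hr).1).mono fun r hr => (hs hr).2

/-- The vector field `v` along the curve `γ` is continuous on `T`. -/
def ContinuousAlong (γ : ℝ → M) (T : Set ℝ) (v : ∀ s, TangentSpace 𝓘(ℝ, E) (γ s)) : Prop :=
  ∀ f : M → ℝ, ContMDiff 𝓘(ℝ, E) 𝓘(ℝ, ℝ) ∞ f → ContinuousOn (fun s => dR f (γ s) (v s)) T

theorem ContinuousAlong.continuousOn_mfderiv {F : Type*} [NormedAddCommGroup F] [NormedSpace ℝ F]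
    [FiniteDimensional ℝ F]
    {γ : ℝ → M} {T : Set ℝ} {v : ∀ s, TangentSpace 𝓘(ℝ, E) (γ s)}
    (h : ContinuousAlong γ T v) {Ψ : M → F} (hΨ : ContMDiff 𝓘(ℝ, E) 𝓘(ℝ, F) ∞ Ψ) :
    ContinuousOn (fun s => (mfderiv 𝓘(ℝ, E) 𝓘(ℝ, F) Ψ (γ s) (v s) : F)) T := by
  refine continuousOn_of_forall_dual fun ℓ => ?_
  refine (h _ (ℓ.contMDiff.comp hΨ)).congr fun s _ => ?_
  exact (dR_clm_comp ℓ (hΨ.mdifferentiableAt (by simp)) (v s)).symm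

variable [T2Space M] [IsManifold 𝓘(ℝ, E) ∞ M]

/-- The vector space case is applied in a globally smooth Ψ that restricts to a chart near `γ s₀`:
dΨ is bijective there, so it preserves spans, ranks and coefficients. -/
theorem ContinuousAlong.exists_coeffs {γ : ℝ → M} {T : Set ℝ} {s₀ : ℝ} (hs₀ : s₀ ∈ T)
    (hγ : ContinuousWithinAt γ T s₀) {ι : Type*} {X : ι → ∀ s, TangentSpace 𝓘(ℝ, E) (γ s)}
    {v : ∀ s, TangentSpace 𝓘(ℝ, E) (γ s)} (hX : ∀ i, ContinuousAlong γ T (X i))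
    (hv : ContinuousAlong γ T v)
    (hmem : ∀ s ∈ T, v s ∈ Submodule.span ℝ (range fun i => X i s))
    (hrank : ∀ s ∈ T, Module.finrank ℝ (Submodule.span ℝ (range fun i => X i s)) =
      Module.finrank ℝ (Submodule.span ℝ (range fun i => X i s₀))) :
    ∃ (n : ℕ) (j : Fin n → ι) (b : Fin n → ℝ → ℝ), ∃ U ∈ 𝓝[T] s₀, U ⊆ T ∧
      (∀ i, ContinuousOn (b i) U) ∧ ∀ s ∈ U, v s = ∑ i, b i s • X (j i) s := by
  obtain ⟨Ψ, hΨ, -, hbij⟩ := exists_smooth_chart (E := E) (γ s₀)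
  let T' : Set ℝ := T ∩ {s | Function.Bijective (mfderiv 𝓘(ℝ, E) 𝓘(ℝ, E) Ψ (γ s))}
  have hT' : T' ∈ 𝓝[T] s₀ := inter_mem self_mem_nhdsWithin (hγ.eventually hbij)
  let W : ι → ℝ → E := fun i s => mfderiv 𝓘(ℝ, E) 𝓘(ℝ, E) Ψ (γ s) (X i s)
  let L : ∀ s, TangentSpace 𝓘(ℝ, E) (γ s) →ₗ[ℝ] E := fun s =>
    (mfderiv 𝓘(ℝ, E) 𝓘(ℝ, E) Ψ (γ s)).toLinearMap
  have hspan : ∀ s, Submodule.span ℝ (range fun i => W i s) =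
      (Submodule.span ℝ (range fun i => X i s)).map (L s) := by
    intro s
    rw [Submodule.map_span, ← range_comp]
    rfl
  have hfr : ∀ s ∈ T', Module.finrank ℝ (Submodule.span ℝ (range fun i => W i s)) =
      Module.finrank ℝ (Submodule.span ℝ (range fun i => X i s)) := by
    intro s hs
    rw [hspan]
    exact (Submodule.equivMapOfInjective (L s) hs.2.1 _).finrank_eq.symm
  have hs₀' : s₀ ∈ T' := ⟨hs₀, hbij.self_of_nhds⟩
  obtain ⟨n, j, b, U, hU, hUT, hb, h⟩ := exists_continuous_coeffs_of_finrank_eq (W := W)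
    (v := fun s => L s (v s)) hs₀'
    (fun i => ((hX i).continuousOn_mfderiv hΨ).mono inter_subset_left)
    ((hv.continuousOn_mfderiv hΨ).mono inter_subset_left)
    (fun s hs => by rw [hspan]; exact ⟨_, hmem s hs.1, rfl⟩)
    (fun s hs => by rw [hfr s hs, hfr s₀ hs₀', hrank s hs.1])
  refine ⟨n, j, b, U, nhdsWithin_le_of_mem hT' hU, fun s hs => (hUT hs).1, hb, fun s hs => ?_⟩
  apply (hUT hs).2.1
  rw [map_sum]
  refine (h s hs).trans (Finset.sum_congr rfl fun i _ => ?_)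
  exact (map_smul (mfderiv 𝓘(ℝ, E) 𝓘(ℝ, E) Ψ (γ s)) (b i s) (X (j i) s)).symm

/-- A differentiable curve with continuous derivative is C¹; continuity tested on smooth functions
yields continuity in the chart. -/
theorem contMDiffOn_of_hasVelocity {γ : ℝ → M} {v : ∀ s, TangentSpace 𝓘(ℝ, E) (γ s)}
    (hγ : ∀ s ∈ Icc (0 : ℝ) 1, HasVelocityWithinAt γ (Icc 0 1) s (v s))
    (hv : ContinuousAlong γ (Icc 0 1) v) : ContMDiffOn 𝓘(ℝ, ℝ) 𝓘(ℝ, E) 1 γ (Icc 0 1) := by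
  intro s hs
  obtain ⟨Ψ, hΨ, hΨe, -⟩ := exists_smooth_chart (E := E) (γ s)
  refine contMDiffWithinAt_iff_target.2 ⟨(hγ s hs).continuousWithinAt, ?_⟩
  have hd : ∀ r ∈ Icc (0 : ℝ) 1, HasDerivWithinAt (fun r => Ψ (γ r))
      (mfderiv 𝓘(ℝ, E) 𝓘(ℝ, E) Ψ (γ r) (v r) : E) (Icc 0 1) r := fun r hr =>
    hasVelocityWithinAt_iff.1 ((hγ r hr).comp (hΨ.mdifferentiableAt (by simp)))
  have h1 : ContDiffOn ℝ 1 (fun r => Ψ (γ r)) (Icc 0 1) := by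
    rw [contDiffOn_one_iff_derivWithin (uniqueDiffOn_Icc zero_lt_one)]
    refine ⟨fun r hr => (hd r hr).differentiableWithinAt, ?_⟩
    refine (hv.continuousOn_mfderiv hΨ).congr fun r hr => ?_
    exact (hd r hr).derivWithin (uniqueDiffOn_Icc zero_lt_one r hr)
  refine (h1 s hs).contMDiffWithinAt.congr_of_eventuallyEq ?_ hΨe.self_of_nhds.symm
  filter_upwards [(hγ s hs).continuousWithinAt.eventually hΨe] with r hr
  exact hr.symm

theorem hasVelocityWithinAt_mfderivWithin {γ : ℝ → M} {T : Set ℝ} {s : ℝ}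
    (h : MDifferentiableWithinAt 𝓘(ℝ, ℝ) 𝓘(ℝ, E) γ T s) :
    HasVelocityWithinAt γ T s (mfderivWithin 𝓘(ℝ, ℝ) 𝓘(ℝ, E) γ T s (1 : ℝ)) := by
  refine h.hasMFDerivWithinAt.congr_mfderiv (ContinuousLinearMap.ext_ring ?_)
  exact (one_smul ℝ _).symm

theorem HasVelocityWithinAt.mfderivWithin_eq {γ : ℝ → M} {s : ℝ} (hs : s ∈ Icc (0 : ℝ) 1)
    {v : TangentSpace 𝓘(ℝ, E) (γ s)} (h : HasVelocityWithinAt γ (Icc 0 1) s v) :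
    mfderivWithin 𝓘(ℝ, ℝ) 𝓘(ℝ, E) γ (Icc 0 1) s (1 : ℝ) = v := by
  have hu : UniqueMDiffWithinAt 𝓘(ℝ, ℝ) (Icc (0 : ℝ) 1) s :=
    (uniqueDiffOn_Icc zero_lt_one s hs).uniqueMDiffWithinAt
  rw [HasMFDerivWithinAt.mfderivWithin h hu]
  exact one_smul ℝ v

theorem continuousAlong_mfderivWithin {γ : ℝ → M}
    (hγ : ContMDiffOn 𝓘(ℝ, ℝ) 𝓘(ℝ, E) 1 γ (Icc 0 1)) :
    ContinuousAlong γ (Icc 0 1) fun s => mfderivWithin 𝓘(ℝ, ℝ) 𝓘(ℝ, E) γ (Icc 0 1) s (1 : ℝ) := by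
  intro f hf
  have h1 : ContDiffOn ℝ 1 (fun s => f (γ s)) (Icc 0 1) :=
    contMDiffOn_iff_contDiffOn.1 ((hf.of_le (by simp)).comp_contMDiffOn hγ)
  have h2 := ((contDiffOn_one_iff_derivWithin (uniqueDiffOn_Icc zero_lt_one)).1 h1).2
  refine h2.congr fun s hs => ?_
  have h3 := (hasVelocityWithinAt_mfderivWithin (hγ.mdifferentiableOn (by simp) s hs)).comp
    (hf.mdifferentiableAt (by simp))
  exact ((hasVelocityWithinAt_iff.1 h3).derivWithin (uniqueDiffOn_Icc zero_lt_one s hs)).symm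

end Curves

end

end CentralReduction

namespace CentralReduction

open Filter Topology

noncomputable section

section Curves

variable {E : Type*} [NormedAddCommGroup E] [NormedSpace ℝ E] [FiniteDimensional ℝ E]
  {M : Type*} [TopologicalSpace M] [ChartedSpace E M]
  {F : Type*} [NormedAddCommGroup F] [NormedSpace ℝ F] [FiniteDimensional ℝ F]
  {N : Type*} [TopologicalSpace N] [ChartedSpace F N]

theorem ContinuousAlong.of_field {γ : ℝ → M} {T : Set ℝ} (hγ : ContinuousOn γ T)
    {X : ∀ x : M, TangentSpace 𝓘(ℝ, E) x}
    (hX : ∀ f : M → ℝ, ContMDiff 𝓘(ℝ, E) 𝓘(ℝ, ℝ) ∞ f → Continuous fun x => dR f x (X x)) :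
    ContinuousAlong γ T fun s => X (γ s) :=
  fun f hf => (hX f hf).comp_continuousOn hγ

theorem ContinuousAlong.sub {γ : ℝ → M} {T : Set ℝ} {v w : ∀ s, TangentSpace 𝓘(ℝ, E) (γ s)}
    (hv : ContinuousAlong γ T v) (hw : ContinuousAlong γ T w) :
    ContinuousAlong γ T fun s => v s - w s := by
  intro f hf
  simp only [map_sub]
  exact (hv f hf).sub (hw f hf)

theorem ContinuousAlong.sum_smul {γ : ℝ → M} {T : Set ℝ} {k : ℕ}
    {v : Fin k → ∀ s, TangentSpace 𝓘(ℝ, E) (γ s)} {a : Fin k → ℝ → ℝ}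
    (hv : ∀ i, ContinuousAlong γ T (v i)) (ha : ∀ i, ContinuousOn (a i) T) :
    ContinuousAlong γ T fun s => ∑ i, a i s • v i s := by
  intro f hf
  simp only [map_sum, map_smul, smul_eq_mul]
  exact continuousOn_finsetSum _ fun i _ => (ha i).mul (hv i f hf)

/-- A map carries curves tangent to a family of vector fields to curves tangent to another family,
if it carries the fields of the first family to combinations of fields of the second one. -/
theorem Joined.map {G : Set (∀ x : M, TangentSpace 𝓘(ℝ, E) x)}
    {G' : Set (∀ x : N, TangentSpace 𝓘(ℝ, F) x)} {μ : M → N}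
    (hμ : MDifferentiable 𝓘(ℝ, E) 𝓘(ℝ, F) μ) {m : ℕ}
    {Y : Fin m → ∀ x : N, TangentSpace 𝓘(ℝ, F) x} (hY : ∀ j, Y j ∈ G')
    (hG : ∀ X ∈ G, ∃ f : Fin m → M → ℝ, (∀ j, Continuous (f j)) ∧
      ∀ x, mfderiv 𝓘(ℝ, E) 𝓘(ℝ, F) μ x (X x) = ∑ j, f j x • Y j (μ x))
    {x y : M} (h : Joined G x y) : Joined G' (μ x) (μ y) := by
  obtain ⟨k, X, a, γ, hX, ha, rfl, rfl, hγ⟩ := joined_iff.1 h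
  choose f hf hfX using fun i => hG (X i) (hX i)
  refine joined_of_uIcc (k := k * m) (γ := fun s => μ (γ s)) (a := 0) (b := 1)
    (X := fun i => Y (finProdFinEquiv.symm i).2)
    (c := fun i s => a (finProdFinEquiv.symm i).1 s *
      f (finProdFinEquiv.symm i).1 (finProdFinEquiv.symm i).2 (γ s)) (fun i => hY _) ?_ ?_
  · intro i
    rw [uIcc_of_le zero_le_one]
    exact (ha _).continuousOn.mul
      ((hf _ _).comp_continuousOn fun s hs => (hγ s hs).continuousWithinAt)
  · rw [uIcc_of_le zero_le_one]
    intro s hs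
    have h1 := (hγ s hs).comp (hμ (γ s))
    have h2 : mfderiv 𝓘(ℝ, E) 𝓘(ℝ, F) μ (γ s) (∑ i, a i s • X i (γ s)) =
        ∑ i, (a (finProdFinEquiv.symm i).1 s *
          f (finProdFinEquiv.symm i).1 (finProdFinEquiv.symm i).2 (γ s)) •
          Y (finProdFinEquiv.symm i).2 (μ (γ s)) := by
      rw [Equiv.sum_comp (finProdFinEquiv.symm : Fin (k * m) ≃ Fin k × Fin m)
        (fun q => (a q.1 s * f q.1 q.2 (γ s)) • Y q.2 (μ (γ s))), Fintype.sum_prod_type, map_sum]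
      refine Finset.sum_congr rfl fun i _ => ?_
      rw [map_smul, hfX, Finset.smul_sum]
      exact Finset.sum_congr rfl fun j _ => smul_smul _ _ _
    exact h2 ▸ h1

/-- A function that is smooth on an open set agrees near each point of it with a globally smooth
function. -/
theorem exists_smooth_extension [T2Space M] [IsManifold 𝓘(ℝ, E) ∞ M] {f : M → ℝ} {U : Set M}
    (hU : IsOpen U) (hf : ContMDiffOn 𝓘(ℝ, E) 𝓘(ℝ, ℝ) ∞ f U) {x : M} (hx : x ∈ U) :
    ∃ g : M → ℝ, ContMDiff 𝓘(ℝ, E) 𝓘(ℝ, ℝ) ∞ g ∧ g =ᶠ[𝓝 x] f := by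
  obtain ⟨b, -, hb⟩ := (SmoothBumpFunction.nhds_basis_tsupport (I := 𝓘(ℝ, E)) x).mem_iff.1
    (hU.mem_nhds hx)
  refine ⟨fun y => b y • f y, contMDiff_of_tsupport fun y hy => ?_, ?_⟩
  · exact b.contMDiff.contMDiffAt.smul
      (hf.contMDiffAt (hU.mem_nhds (hb (tsupport_smul_subset_left _ _ hy))))
  · filter_upwards [b.eventuallyEq_one] with y hy
    simp [hy]

theorem Bivector.continuous_dR_hamiltonian (π : Bivector E M) {g : M → ℝ}
    (hg : ContMDiff 𝓘(ℝ, E) 𝓘(ℝ, ℝ) ∞ g) (f : M → ℝ) (hf : ContMDiff 𝓘(ℝ, E) 𝓘(ℝ, ℝ) ∞ f) :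
    Continuous fun x => dR f x (π.hamiltonian g x) := by
  simp only [π.dR_hamiltonian]
  exact (π.smooth g f hg hf).continuous

end Curves

section Action

variable {𝔤 : Type*} [LieRing 𝔤] [LieAlgebra ℝ 𝔤]
  {E : Type*} [NormedAddCommGroup E] [NormedSpace ℝ E] [FiniteDimensional ℝ E]
  {M : Type*} [TopologicalSpace M] [ChartedSpace E M] [IsManifold 𝓘(ℝ, E) ∞ M]

theorem Action.continuous_dR (A : Action 𝔤 E M) (u : 𝔤) (f : M → ℝ)
    (hf : ContMDiff 𝓘(ℝ, E) 𝓘(ℝ, ℝ) ∞ f) : Continuous fun x => dR f x (A.ρ u x) := by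
  have h1 : Continuous (tangentMap 𝓘(ℝ, E) 𝓘(ℝ, ℝ) f) := hf.continuous_tangentMap (by simp)
  have h2 := h1.comp (A.smooth u).continuous
  have h3 := (tangentBundleModelSpaceHomeomorph 𝓘(ℝ, ℝ)).continuous.comp h2
  exact continuous_snd.comp h3

theorem Action.IsOrbit.mem_of_mem_orbitOf {A : Action 𝔤 E M} {𝔠 : LieSubalgebra ℝ 𝔤} {O : Set M}
    (hO : A.IsOrbit 𝔠 O) {x y : M} (hx : x ∈ O) (hy : y ∈ A.orbitOf 𝔠 x) : y ∈ O := by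
  obtain ⟨z, rfl⟩ := hO
  exact mem_orbit_trans hx hy

theorem Action.IsOrbit.mem_iff {A : Action 𝔤 E M} {𝔠 : LieSubalgebra ℝ 𝔤} {O : Set M}
    (hO : A.IsOrbit 𝔠 O) {x y : M} (hy : y ∈ A.orbitOf 𝔠 x) : x ∈ O ↔ y ∈ O :=
  ⟨fun h => hO.mem_of_mem_orbitOf h hy, fun h => hO.mem_of_mem_orbitOf h (mem_orbit_symm hy)⟩

theorem Action.span_range_eq_orbitSpace (A : Action 𝔤 E M) (𝔠 : LieSubalgebra ℝ 𝔤) (x : M) :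
    Submodule.span ℝ (range fun u : 𝔠 => A.ρ u x) = A.orbitSpace 𝔠 x := by
  have : (range fun u : 𝔠 => A.ρ u x) = (A.orbitSpace 𝔠 x : Set (TangentSpace 𝓘(ℝ, E) x)) := by
    ext v
    constructor
    · rintro ⟨u, rfl⟩; exact ⟨u, u.2, rfl⟩
    · rintro ⟨u, hu, rfl⟩; exact ⟨⟨u, hu⟩, rfl⟩
  rw [this, Submodule.span_eq]

end Action

/-! ### Images of curves in 𝔠-orbits and local lifts from the quotient. -/

section Lift

variable {𝔤 : Type*} [LieRing 𝔤] [LieAlgebra ℝ 𝔤] [FiniteDimensional ℝ 𝔤] {t : 𝔤 ⊗[ℝ] 𝔤}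
  {E : Type*} [NormedAddCommGroup E] [NormedSpace ℝ E] [FiniteDimensional ℝ E]
  {M : Type*} [TopologicalSpace M] [T2Space M] [ChartedSpace E M] [IsManifold 𝓘(ℝ, E) ∞ M]
  {EN : Type*} [NormedAddCommGroup EN] [NormedSpace ℝ EN] [FiniteDimensional ℝ EN]
  {N : Type*} [TopologicalSpace N] [T2Space N] [ChartedSpace EN N] [IsManifold 𝓘(ℝ, EN) ∞ N]
  {F : Type*} [NormedAddCommGroup F] [NormedSpace ℝ F] [FiniteDimensional ℝ F]
  {Q : Type*} [TopologicalSpace Q] [T2Space Q] [ChartedSpace F Q] [IsManifold 𝓘(ℝ, F) ∞ Q]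
  {P : QuasiPoisson E M t} {𝔠 : LieSubalgebra ℝ 𝔤} {p : M → Q}

variable (F P 𝔠 p) in
/-- The vector fields `ρ(u)`, `u ∈ 𝔠`, and the Hamiltonian vector fields of basic functions. -/
def basicFields : Set (∀ x : M, TangentSpace 𝓘(ℝ, E) x) :=
  {X | ∃ u ∈ 𝔠, X = P.ρ u} ∪
    {X | ∃ g : Q → ℝ, ContMDiff 𝓘(ℝ, F) 𝓘(ℝ, ℝ) ∞ g ∧ X = P.π.hamiltonian (g ∘ p)}

theorem QuasiPoisson.mfderiv_hamiltonian_comp (P : QuasiPoisson E M t)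
    (hp : P.toAction.IsQuotient (F := F) 𝔠 p) {g : Q → ℝ} (hg : ContMDiff 𝓘(ℝ, F) 𝓘(ℝ, ℝ) ∞ g)
    (x : M) : mfderiv 𝓘(ℝ, E) 𝓘(ℝ, F) p x (P.π.hamiltonian (g ∘ p) x) =
      (P.reduced hp).hamiltonian g (p x) := by
  unfold Bivector.hamiltonian
  rw [P.anchor_reduced,
    dR_comp (hg.mdifferentiableAt (by simp)) (hp.smooth.mdifferentiableAt (by simp))]

/-- A map under which Hamiltonian vector fields of basic functions are infinitesimally in the
direction of `𝔠` takes curves tangent to `basicFields` into `𝔠`-orbits. -/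
theorem QuasiPoisson.mem_orbitOf_of_joined {C : QuasiPoisson EN N t} {μ : M → N}
    (h𝔠 : IsLagrangian t 𝔠.toSubmodule) (ht : IsInvariantSymmetric t)
    (hp : P.toAction.IsQuotient (F := F) 𝔠 p) (hμ : P.IsEquivariant C μ) {r : ℝ}
    (hr : ∀ (x : M) (γ : TangentSpace 𝓘(ℝ, E) x →L[ℝ] ℝ),
      mfderiv 𝓘(ℝ, E) 𝓘(ℝ, EN) μ x (P.π.anchor x γ) =
        C.ρ (r • sharp t (P.toAction.pullback x γ)) (μ x))
    {x y : M} (h : Joined (basicFields F P 𝔠 p) x y) : μ y ∈ C.toAction.orbitOf 𝔠 (μ x) := by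
  apply Relation.ReflTransGen.single
  let e := Module.finBasis ℝ 𝔠.toSubmodule
  -- The coordinates of 𝔠 are extended to functionals on all of 𝔤 so that t♯ can be applied to them.
  have hex : ∀ j, ∃ κ : Module.Dual ℝ 𝔤, κ ∘ₗ 𝔠.toSubmodule.subtype = e.coord j := fun j =>
    LinearMap.exists_extend (e.coord j)
  choose κ hκ using hex
  have hexp : ∀ u ∈ 𝔠, ∀ z : N, C.ρ u z = ∑ j, κ j u • C.ρ (e j : 𝔤) z := by
    intro u hu z
    have h1 : u = ∑ j, κ j u • (e j : 𝔤) := by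
      have h2 := congrArg Subtype.val (e.sum_repr ⟨u, hu⟩)
      rw [AddSubmonoidClass.coe_finsetSum] at h2
      refine h2.symm.trans (Finset.sum_congr rfl fun j _ => ?_)
      have h3 := LinearMap.congr_fun (hκ j) ⟨u, hu⟩
      change κ j u = e.repr ⟨u, hu⟩ j at h3
      rw [h3]; rfl
    conv_lhs => rw [h1]
    rw [map_sum, Finset.sum_apply]
    exact Finset.sum_congr rfl fun j _ => by rw [map_smul]; rfl
  refine Joined.map (G' := {X | ∃ u ∈ 𝔠, X = C.ρ u}) (hμ.1.mdifferentiable (by simp))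
    (Y := fun j => C.ρ (e j : 𝔤)) (fun j => ⟨_, (e j).2, rfl⟩) ?_ h
  rintro X (⟨u, hu, rfl⟩ | ⟨g, hg, rfl⟩)
  · exact ⟨fun j _ => κ j u, fun j => continuous_const, fun x => (hμ.2 u x).trans (hexp u hu _)⟩
  -- The j-th coordinate of r t♯ρ*d(g∘p) is, by symmetry of t, r times the derivative of g∘p along
  -- ρ(t♯κ_j); in this form it is continuous in x.
  · refine ⟨fun j x => r * dR (g ∘ p) x (P.ρ (sharp t (κ j)) x), fun j =>
      continuous_const.mul (P.toAction.continuous_dR _ _ (hg.comp hp.smooth)), fun x => ?_⟩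
    have hmem := h𝔠.sharp_mem (α := P.toAction.pullback x (dR (g ∘ p) x))
      fun u hu => hp.dR_comp_apply hg hu x
    refine (hr x _).trans ((hexp _ (𝔠.toSubmodule.smul_mem r hmem) _).trans ?_)
    refine Finset.sum_congr rfl fun j _ => ?_
    congr 1
    rw [map_smul, smul_eq_mul]
    congr 1
    exact pairing_comm t ht _ _

theorem QuasiPoisson.IsEquivariant.mem_orbitOf {C : QuasiPoisson EN N t} {μ : M → N}
    (hμ : P.IsEquivariant C μ) {x y : M} (h : y ∈ P.toAction.orbitOf 𝔠 x) :
    μ y ∈ C.toAction.orbitOf 𝔠 (μ x) := by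
  induction h with
  | refl => exact mem_orbit_self _ _
  | tail _ hj ih =>
    refine mem_orbit_trans ih ?_
    obtain ⟨k, X, a, γ, hX, ha, rfl, rfl, hγ⟩ := joined_iff.1 hj
    choose u hu hXu using hX
    refine Relation.ReflTransGen.single (joined_iff.2 ⟨k, fun i => C.ρ (u i), a, fun s => μ (γ s),
      fun i => ⟨u i, hu i, rfl⟩, ha, rfl, rfl, fun s hs => ?_⟩)
    have h1 := (hγ s hs).comp (hμ.1.mdifferentiableAt (by simp))
    have h2 : mfderiv 𝓘(ℝ, E) 𝓘(ℝ, EN) μ (γ s) (∑ i, a i s • X i (γ s)) =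
        ∑ i, a i s • C.ρ (u i) (μ (γ s)) := by
      rw [map_sum]
      exact Finset.sum_congr rfl fun i _ => by rw [map_smul, hXu, hμ.2]
    exact h2 ▸ h1

/-- Curves of Hamiltonian vector fields in the quotient lift locally, through any given point, to
curves tangent to `basicFields`. -/
theorem QuasiPoisson.eventually_exists_lift (hp : P.toAction.IsQuotient (F := F) 𝔠 p)
    {γ : ℝ → Q} {k : ℕ} {g : Fin k → Q → ℝ} (hg : ∀ i, ContMDiff 𝓘(ℝ, F) 𝓘(ℝ, ℝ) ∞ (g i))
    {a : Fin k → ℝ → ℝ} (ha : ∀ i, Continuous (a i))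
    (hγ : ∀ s ∈ Icc (0 : ℝ) 1, HasVelocityWithinAt γ (Icc 0 1) s
      (∑ i, a i s • (P.reduced hp).hamiltonian (g i) (γ s)))
    {s₀ : ℝ} (hs₀ : s₀ ∈ Icc (0 : ℝ) 1) {x₀ : M} (hx₀ : p x₀ = γ s₀) :
    ∀ᶠ s in 𝓝[Icc 0 1] s₀, ∃ x, p x = γ s ∧ Joined (basicFields F P 𝔠 p) x₀ x := by
  obtain ⟨τ, U, hU, hxU, hτ, hτx, hpτ⟩ := exists_local_section x₀ hp.smooth (hp.submersion x₀)
  have hγc : ContinuousOn γ (Icc 0 1) := fun s hs => (hγ s hs).continuousWithinAt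
  let T : Set ℝ := Icc 0 1 ∩ γ ⁻¹' U
  have hT : T ∈ 𝓝[Icc 0 1] s₀ := inter_mem self_mem_nhdsWithin
    ((hγc s₀ hs₀).preimage_mem_nhdsWithin (hU.mem_nhds (hx₀ ▸ hxU)))
  have hs₀T : s₀ ∈ T := ⟨hs₀, show γ s₀ ∈ U from hx₀ ▸ hxU⟩
  have hγT : ContinuousOn γ T := hγc.mono inter_subset_left
  have hτd : ∀ y ∈ U, MDifferentiableAt 𝓘(ℝ, F) 𝓘(ℝ, E) τ y := fun y hy =>
    (hτ.contMDiffAt (hU.mem_nhds hy)).mdifferentiableAt (by simp)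
  let x : ℝ → M := fun s => τ (γ s)
  have hxc : ContinuousOn x T := hτ.continuousOn.comp hγT fun s hs => hs.2
  let w : ∀ s, TangentSpace 𝓘(ℝ, F) (γ s) := fun s =>
    ∑ i, a i s • (P.reduced hp).hamiltonian (g i) (γ s)
  let x' : ∀ s, TangentSpace 𝓘(ℝ, E) (x s) := fun s => mfderiv 𝓘(ℝ, F) 𝓘(ℝ, E) τ (γ s) (w s)
  have hx' : ∀ s ∈ T, HasVelocityWithinAt x (Icc 0 1) s (x' s) := fun s hs =>
    (hγ s hs.1).comp (hτd _ hs.2)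
  let Y : Fin k → ∀ x : M, TangentSpace 𝓘(ℝ, E) x := fun i => P.π.hamiltonian (g i ∘ p)
  have hwc : ContinuousAlong γ T w := ContinuousAlong.sum_smul
    (fun i => ContinuousAlong.of_field hγT ((P.reduced hp).continuous_dR_hamiltonian (hg i)))
    fun i => (ha i).continuousOn
  -- Since τ is smooth only on `U`, the test function f∘τ is replaced near each time by a global
  -- smooth function.
  have hx'c : ContinuousAlong x T x' := by
    intro f hf s₁ hs₁
    obtain ⟨k, hk, hke⟩ := exists_smooth_extension hU
      (hf.comp_contMDiffOn hτ) (x := γ s₁) hs₁.2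
    refine (hwc k hk s₁ hs₁).congr_of_eventuallyEq_of_mem ?_ hs₁
    filter_upwards [(hγT s₁ hs₁).eventually hke.eventuallyEq_nhds, self_mem_nhdsWithin]
      with s hs hsT
    have h1 : dR (E := F) k (γ s) = dR (f ∘ τ) (γ s) := hs.mfderiv_eq
    rw [h1, dR_comp (hf.mdifferentiableAt (by simp)) (hτd _ hsT.2)]
    rfl
  have hYc : ContinuousAlong x T fun s => ∑ i, a i s • Y i (x s) := ContinuousAlong.sum_smul
    (fun i => ContinuousAlong.of_field hxc
      (P.π.continuous_dR_hamiltonian ((hg i).comp hp.smooth))) fun i => (ha i).continuousOn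
  have hspan := fun s => P.toAction.span_range_eq_orbitSpace 𝔠 (x s)
  -- The lifted velocity and the Hamiltonian combination upstairs project to the same vector, so
  -- they differ by an element of ker dp = ρ(𝔠).
  have hmem : ∀ s ∈ T, x' s - ∑ i, a i s • Y i (x s) ∈
      Submodule.span ℝ (range fun u : 𝔠 => P.ρ u (x s)) := by
    intro s hs
    rw [hspan, hp.mem_orbitSpace_iff, map_sub]
    have h1 : (mfderiv 𝓘(ℝ, E) 𝓘(ℝ, F) p (x s) (x' s) : F) = w s := by
      have h2 := mfderiv_comp (γ s) (hp.smooth.mdifferentiableAt (x := τ (γ s)) (by simp))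
        (hτd _ hs.2)
      have h3 : p ∘ τ =ᶠ[𝓝 (γ s)] id := by
        filter_upwards [hU.mem_nhds hs.2] with y hy using hpτ y hy
      rw [h3.mfderiv_eq, mfderiv_id] at h2
      exact (DFunLike.congr_fun h2 (w s)).symm
    have h4 : (mfderiv 𝓘(ℝ, E) 𝓘(ℝ, F) p (x s) (∑ i, a i s • Y i (x s)) : F) = w s := by
      have h5 : mfderiv 𝓘(ℝ, E) 𝓘(ℝ, F) p (x s) (∑ i, a i s • Y i (x s)) =
          ∑ i, a i s • (P.reduced hp).hamiltonian (g i) (p (x s)) := by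
        rw [map_sum]
        exact Finset.sum_congr rfl fun i _ => by
          rw [map_smul, P.mfderiv_hamiltonian_comp hp (hg i)]
      refine h5.trans ?_
      have h6 : ∀ q, q = γ s → ((∑ i, a i s • (P.reduced hp).hamiltonian (g i) q :
          TangentSpace 𝓘(ℝ, F) q) : F) = w s := by rintro q rfl; rfl
      exact h6 _ (hpτ _ hs.2)
    exact sub_eq_zero.2 (h1.trans h4.symm)
  -- ρ(𝔠) = ker dp has dimension dim M − dim M/𝔠 everywhere, which makes the 𝔠-coefficients of the
  -- difference continuous.
  have hrank : ∀ s, Module.finrank ℝ (Submodule.span ℝ (range fun u : 𝔠 => P.ρ u (x s))) +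
      Module.finrank ℝ F = Module.finrank ℝ E := by
    intro s
    have h1 := (mfderiv 𝓘(ℝ, E) 𝓘(ℝ, F) p (x s)).toLinearMap.finrank_range_add_finrank_ker
    have h2 : Submodule.span ℝ (range fun u : 𝔠 => P.ρ u (x s)) =
        LinearMap.ker (mfderiv 𝓘(ℝ, E) 𝓘(ℝ, F) p (x s)).toLinearMap := by
      rw [hspan]
      exact Submodule.ext fun v => hp.mem_orbitSpace_iff
    rw [LinearMap.range_eq_top.2 (hp.submersion _), finrank_top] at h1
    simp only [finrank_tangentSpace] at h1
    rw [h2]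
    omega
  obtain ⟨n, j, b, U', hU', hU'T, hb, hsum⟩ := ContinuousAlong.exists_coeffs (γ := x) hs₀T
    (hxc s₀ hs₀T) (X := fun (u : 𝔠) s => P.ρ u (x s))
    (v := fun s => x' s - ∑ i, a i s • Y i (x s))
    (fun u => ContinuousAlong.of_field hxc (P.toAction.continuous_dR u)) (hx'c.sub hYc) hmem
    (fun s _ => by have := hrank s; have := hrank s₀; omega)
  have hfin : ∀ᶠ s in 𝓝[Icc 0 1] s₀, Joined (basicFields F P 𝔠 p) (x s₀) (x s) := by
    refine eventually_joined_of_coeffs (U := U') hs₀ (nhdsWithin_le_of_mem hT hU') (k := n + k)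
      (X := Fin.append (fun i => P.ρ (j i : 𝔤)) Y) (c := Fin.append b a) ?_ ?_ ?_
    · refine Fin.addCases (fun i => ?_) fun i => ?_
      · rw [Fin.append_left]; exact Or.inl ⟨_, (j i).2, rfl⟩
      · rw [Fin.append_right]; exact Or.inr ⟨_, hg i, rfl⟩
    · refine Fin.addCases (fun i => ?_) fun i => ?_
      · rw [Fin.append_left]; exact hb i
      · rw [Fin.append_right]; exact (ha i).continuousOn
    · intro s hs
      rw [Fin.sum_univ_add]
      simp only [Fin.append_left, Fin.append_right]
      rw [← hsum s hs, sub_add_cancel]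
      exact hx' s (hU'T hs)
  have hx₀' : x s₀ = x₀ := by
    change τ (γ s₀) = x₀
    rw [← hx₀, hτx]
  rw [hx₀'] at hfin
  filter_upwards [hfin, hT] with s hs hsT
  exact ⟨x s, hpτ _ hsT.2, hs⟩

end Lift

end

end CentralReduction

namespace CentralReduction

open Filter Topology

noncomputable section

/-! ### Linear differential equations. -/

section LinearODE

variable {V : Type*} [NormedAddCommGroup V] [NormedSpace ℝ V]

/-- Local existence of solutions of linear differential equations. -/
theorem exists_solution_linear [CompleteSpace V] {B : ℝ → V →L[ℝ] V} (hB : Continuous B) (s₀ : ℝ)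
    (v₀ : V) :
    ∃ u : ℝ → V, u s₀ = v₀ ∧ ∀ᶠ s in 𝓝 s₀, HasDerivAt u (B s (u s)) s := by
  obtain ⟨δ, hδ, hBδ⟩ := Metric.mem_nhds_iff.1 (hB.continuousAt.eventually
    (Metric.ball_mem_nhds (B s₀) one_pos) : ∀ᶠ s in 𝓝 s₀, B s ∈ Metric.ball (B s₀) 1)
  have hK : ∀ s ∈ Metric.ball s₀ δ, ‖B s‖ ≤ ‖B s₀‖ + 1 := by
    intro s hs
    have h1 : ‖B s - B s₀‖ < 1 := by simpa [dist_eq_norm] using hBδ hs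
    linarith [norm_sub_norm_le (B s) (B s₀)]
  let K : NNReal := ⟨‖B s₀‖ + 1, by positivity⟩
  -- `L` bounds the right-hand side on the unit ball about v₀; ε ≤ 1/(L+1) then keeps the solution
  -- in that ball, and ε ≤ δ/2 keeps the times where ‖B‖ is bounded.
  let L : NNReal := K * (‖v₀‖₊ + 1)
  let ε : ℝ := min (δ / 2) (1 / (L + 1))
  have hε : 0 < ε := by positivity
  have hIcc : Icc (s₀ - ε) (s₀ + ε) ⊆ Metric.ball s₀ δ := by
    rw [Real.ball_eq_Ioo]
    have : ε ≤ δ / 2 := min_le_left _ _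
    exact fun s hs => ⟨by linarith [hs.1], by linarith [hs.2]⟩
  have hPL : IsPicardLindelof (fun s v => B s v)
      (⟨s₀, by constructor <;> linarith⟩ : Icc (s₀ - ε) (s₀ + ε)) v₀ 1 0 L K := by
    refine ⟨fun s hs => ?_, fun v _ => ?_, fun s hs v hv => ?_, ?_⟩
    · refine ((B s).lipschitz.weaken ?_).lipschitzOnWith
      exact hK s (hIcc hs)
    · exact (hB.clm_apply continuous_const).continuousOn
    · have h1 : ‖v‖ ≤ ‖v₀‖ + 1 := by
        have h2 : ‖v - v₀‖ ≤ 1 := by simpa [dist_eq_norm] using hv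
        linarith [norm_sub_norm_le v v₀]
      exact ((B s).le_opNorm v).trans
        (mul_le_mul (hK s (hIcc hs)) h1 (norm_nonneg _) (by positivity))
    · have h1 : max (s₀ + ε - s₀) (s₀ - (s₀ - ε)) = ε := by simp
      change (L : ℝ) * max (s₀ + ε - s₀) (s₀ - (s₀ - ε)) ≤ 1 - 0
      rw [h1, sub_zero]
      calc (L : ℝ) * ε ≤ (L + 1) * (1 / (L + 1)) :=
            mul_le_mul (by linarith) (min_le_right _ _) hε.le (by positivity)
        _ = 1 := by field_simp
  obtain ⟨u, hu₀, hu⟩ := hPL.exists_eq_forall_mem_Icc_hasDerivWithinAt₀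
  refine ⟨u, hu₀, ?_⟩
  filter_upwards [Ioo_mem_nhds (show s₀ - ε < s₀ by linarith) (show s₀ < s₀ + ε by linarith)]
    with s hs
  exact (hu s (Ioo_subset_Icc_self hs)).hasDerivAt (Icc_mem_nhds hs.1 hs.2)

/-- A solution of a linear differential equation that vanishes somewhere vanishes nearby. -/
theorem eventually_eq_zero_of_linear {A : ℝ → V →L[ℝ] V} {z : ℝ → V} {s₀ : ℝ}
    (hs₀ : s₀ ∈ Icc (0 : ℝ) 1) {K : ℝ} (hA : ∀ᶠ s in 𝓝[Icc 0 1] s₀, ‖A s‖ ≤ K)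
    (hz : ∀ᶠ s in 𝓝[Icc 0 1] s₀, HasDerivWithinAt z (A s (z s)) (Icc 0 1) s) (hz₀ : z s₀ = 0) :
    ∀ᶠ s in 𝓝[Icc 0 1] s₀, z s = 0 := by
  filter_upwards [eventually_uIcc_subset hs₀ (hA.and hz)] with s hs
  have key : ∀ r ∈ Icc (0 : ℝ) 1, s₀ + r * (s - s₀) ∈ uIcc s₀ s := by
    intro r hr
    rw [← segment_eq_uIcc, segment_eq_image']
    exact ⟨r, hr, by simp⟩
  have hd : ∀ r ∈ Icc (0 : ℝ) 1, HasDerivWithinAt (fun r => z (s₀ + r * (s - s₀)))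
      (((s - s₀) • A (s₀ + r * (s - s₀))) (z (s₀ + r * (s - s₀)))) (Icc 0 1) r := by
    intro r hr
    exact hasVelocityWithinAt_iff.1 (HasVelocityWithinAt.comp_affine
      (hasVelocityWithinAt_iff.2 (hs (key r hr)).1.2) fun r hr => (hs (key r hr)).2)
  -- Rescaling has moved s₀ to 0 and s to 1, so forward uniqueness against the zero solution covers
  -- times on either side of s₀.
  have huniq := ODE_solution_unique_of_mem_Icc_right (a := 0) (b := 1)
    (v := fun r => ((s - s₀) • A (s₀ + r * (s - s₀)) : V →L[ℝ] V)) (s := fun _ => univ)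
    (f := fun r => z (s₀ + r * (s - s₀))) (g := fun _ => 0) (K := Real.toNNReal (|s - s₀| * K))
    (fun r hr => by
      refine (ContinuousLinearMap.lipschitz _ |>.weaken ?_).lipschitzOnWith
      rw [← NNReal.coe_le_coe, coe_nnnorm, norm_smul, Real.norm_eq_abs]
      exact (mul_le_mul_of_nonneg_left (hs (key r (Ico_subset_Icc_self hr))).1.1
        (abs_nonneg _)).trans (Real.le_coe_toNNReal _))
    (fun r hr => (hd r hr).continuousWithinAt)
    (fun r hr => (hd r (Ico_subset_Icc_self hr)).mono_of_mem_nhdsWithin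
      (Icc_mem_nhdsGE_of_mem hr))
    (fun _ _ => mem_univ _) continuousOn_const
    (fun r hr => by rw [map_zero]; exact hasDerivWithinAt_const _ _ _)
    (fun _ _ => mem_univ _) (by simpa using hz₀)
  simpa using huniq (right_mem_Icc.2 zero_le_one)

end LinearODE

/-! ### Constancy of the dimension of ρ(𝔠) along orbits. -/

section ChartField

variable {𝔤 : Type*} [LieRing 𝔤] [LieAlgebra ℝ 𝔤]
  {E : Type*} [NormedAddCommGroup E] [NormedSpace ℝ E] [FiniteDimensional ℝ E]
  {M : Type*} [TopologicalSpace M] [ChartedSpace E M] [IsManifold 𝓘(ℝ, E) ∞ M]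

theorem two_le_infty : (1 : WithTop ℕ∞) + 1 ≤ ∞ := by
  rw [one_add_one_eq_two]
  exact WithTop.coe_le_coe.2 (le_top : (2 : ℕ∞) ≤ ⊤)

/-- The vector fields of an action in the extended chart at `x₀`. -/
def Action.chartField (A : Action 𝔤 E M) (x₀ : M) (z : E) : 𝔤 →ₗ[ℝ] E where
  toFun u := VectorField.mpullback 𝓘(ℝ, E) 𝓘(ℝ, E) (extChartAt 𝓘(ℝ, E) x₀).symm (A.ρ u) z
  map_add' u v := by
    simp only [VectorField.mpullback_apply, map_add, Pi.add_apply]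
    rfl
  map_smul' c u := by
    simp only [VectorField.mpullback_apply, map_smul, Pi.smul_apply, RingHom.id_apply]
    rfl

theorem contMDiffAt_extChartAt_symm {x₀ : M} {z : E}
    (hz : z ∈ (extChartAt 𝓘(ℝ, E) x₀).target) :
    ContMDiffAt 𝓘(ℝ, E) 𝓘(ℝ, E) ∞ (extChartAt 𝓘(ℝ, E) x₀).symm z :=
  (contMDiffOn_extChartAt_symm x₀).contMDiffAt ((isOpen_extChartAt_target x₀).mem_nhds hz)

theorem mfderivWithin_range_eq {x₀ : M} {z : E} :
    mfderivWithin 𝓘(ℝ, E) 𝓘(ℝ, E) (extChartAt 𝓘(ℝ, E) x₀).symm (range 𝓘(ℝ, E)) z =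
      mfderiv 𝓘(ℝ, E) 𝓘(ℝ, E) (extChartAt 𝓘(ℝ, E) x₀).symm z := by
  rw [ModelWithCorners.range_eq_univ, mfderivWithin_univ]

theorem isInvertible_mfderiv_extChartAt_symm {x₀ : M} {z : E}
    (hz : z ∈ (extChartAt 𝓘(ℝ, E) x₀).target) :
    (mfderiv 𝓘(ℝ, E) 𝓘(ℝ, E) (extChartAt 𝓘(ℝ, E) x₀).symm z).IsInvertible := by
  have : IsManifold 𝓘(ℝ, E) 1 M := IsManifold.of_le (n := ∞) (by norm_num)
  rw [← mfderivWithin_range_eq]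
  exact isInvertible_mfderivWithin_extChartAt_symm hz

theorem Action.contDiffAt_chartField (A : Action 𝔤 E M) (u : 𝔤) {x₀ : M} {z : E}
    (hz : z ∈ (extChartAt 𝓘(ℝ, E) x₀).target) :
    ContDiffAt ℝ 1 (fun z => A.chartField x₀ z u) z := by
  have h := ContMDiffAt.mpullback_vectorField_preimage (n := ∞) (m := 1)
    (f := (extChartAt 𝓘(ℝ, E) x₀).symm) (((A.smooth u).of_le (by norm_num)).contMDiffAt)
    (contMDiffAt_extChartAt_symm hz) (isInvertible_mfderiv_extChartAt_symm hz) two_le_infty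
  exact contMDiffAt_vectorSpace_iff_contDiffAt.1 h

/-- Lie brackets are natural under pullback to the chart, where they become commutators of
derivatives. -/
theorem Action.chartField_lie (A : Action 𝔤 E M) (u v : 𝔤) {x₀ : M} {z : E}
    (hz : z ∈ (extChartAt 𝓘(ℝ, E) x₀).target) :
    A.chartField x₀ z ⁅u, v⁆ =
      fderiv ℝ (fun z => A.chartField x₀ z v) z (A.chartField x₀ z u) -
      fderiv ℝ (fun z => A.chartField x₀ z u) z (A.chartField x₀ z v) := by
  have : IsManifold 𝓘(ℝ, E) (minSmoothness ℝ 2) M := by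
    rw [minSmoothness_of_isRCLikeNormedField, ← one_add_one_eq_two]
    exact IsManifold.of_le (n := ∞) two_le_infty
  have hd : ∀ u, MDifferentiableAt 𝓘(ℝ, E) 𝓘(ℝ, E).tangent
      (fun x => (⟨x, A.ρ u x⟩ : TangentBundle 𝓘(ℝ, E) M)) ((extChartAt 𝓘(ℝ, E) x₀).symm z) :=
    fun u => (A.smooth u).mdifferentiableAt (by simp)
  have h := VectorField.mpullback_mlieBracket (n := ∞) (hd u) (hd v)
    (contMDiffAt_extChartAt_symm hz) (by
      rw [minSmoothness_of_isRCLikeNormedField, ← one_add_one_eq_two]; exact two_le_infty)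
  rw [← A.map_lie, ← VectorField.mlieBracketWithin_univ,
    VectorField.mlieBracketWithin_eq_lieBracketWithin] at h
  refine h.trans ?_
  exact congrFun (VectorField.lieBracketWithin_univ (𝕜 := ℝ)
    (V := fun z => (A.chartField x₀ z u : E)) (W := fun z => (A.chartField x₀ z v : E))) z

theorem Action.mfderiv_extChartAt_apply (A : Action 𝔤 E M) (u : 𝔤) {x₀ x : M}
    (hx : x ∈ (extChartAt 𝓘(ℝ, E) x₀).source) :
    mfderiv 𝓘(ℝ, E) 𝓘(ℝ, E) (extChartAt 𝓘(ℝ, E) x₀) x (A.ρ u x) =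
      A.chartField x₀ (extChartAt 𝓘(ℝ, E) x₀ x) u := by
  have : IsManifold 𝓘(ℝ, E) 1 M := IsManifold.of_le (n := ∞) (by norm_num)
  obtain ⟨z, hz, rfl⟩ : ∃ z ∈ (extChartAt 𝓘(ℝ, E) x₀).target, (extChartAt 𝓘(ℝ, E) x₀).symm z = x :=
    ⟨_, (extChartAt 𝓘(ℝ, E) x₀).map_source hx, (extChartAt 𝓘(ℝ, E) x₀).left_inv hx⟩
  rw [(extChartAt 𝓘(ℝ, E) x₀).right_inv hz]
  have h1 := mfderiv_extChartAt_comp_mfderivWithin_extChartAt_symm (I := 𝓘(ℝ, E)) hz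
  have h2 := mfderivWithin_extChartAt_symm_comp_mfderiv_extChartAt (I := 𝓘(ℝ, E)) hz
  rw [mfderivWithin_range_eq] at h1 h2
  change _ = (mfderiv 𝓘(ℝ, E) 𝓘(ℝ, E) (extChartAt 𝓘(ℝ, E) x₀).symm z).inverse
    (A.ρ u ((extChartAt 𝓘(ℝ, E) x₀).symm z))
  rw [ContinuousLinearMap.inverse_eq h2 h1]

theorem Action.injective_mfderiv_extChartAt {x₀ x : M}
    (hx : x ∈ (extChartAt 𝓘(ℝ, E) x₀).source) :
    Function.Injective (mfderiv 𝓘(ℝ, E) 𝓘(ℝ, E) (extChartAt 𝓘(ℝ, E) x₀) x) := by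
  have : IsManifold 𝓘(ℝ, E) 1 M := IsManifold.of_le (n := ∞) (by norm_num)
  obtain ⟨e, he⟩ := isInvertible_mfderiv_extChartAt (I := 𝓘(ℝ, E)) (𝕜 := ℝ) hx
  rw [← he]
  exact e.injective

/-- The linearization of the flow of a time-dependent field in `𝔠` carries elements of the
stabilizer at `y s₀` to elements of nearby stabilizers. -/
theorem Action.exists_path_stabilizer (A : Action 𝔤 E M) (𝔠 : LieSubalgebra ℝ 𝔤) {m : ℕ}
    (e : Module.Basis (Fin m) ℝ 𝔠) {y : ℝ → M} {k : ℕ} {u : Fin k → 𝔠} {a : Fin k → ℝ → ℝ}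
    (ha : ∀ i, Continuous (a i))
    (hy : ∀ s ∈ Icc (0 : ℝ) 1, HasVelocityWithinAt y (Icc 0 1) s (∑ i, a i s • A.ρ (u i) (y s)))
    {s₀ : ℝ} (hs₀ : s₀ ∈ Icc (0 : ℝ) 1) {v : Fin m → ℝ}
    (hv : A.ρ (e.equivFun.symm v : 𝔤) (y s₀) = 0) :
    ∃ U : ℝ → Fin m → ℝ, U s₀ = v ∧ ContinuousAt U s₀ ∧
      ∀ᶠ s in 𝓝[Icc 0 1] s₀, A.ρ (e.equivFun.symm (U s) : 𝔤) (y s) = 0 := by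
  let N : Fin k → (Fin m → ℝ) →L[ℝ] (Fin m → ℝ) := fun i => LinearMap.toContinuousLinearMap
    (e.equivFun.toLinearMap ∘ₗ (LieAlgebra.ad ℝ 𝔠 (u i) : 𝔠 →ₗ[ℝ] 𝔠) ∘ₗ
      e.equivFun.symm.toLinearMap)
  -- With w = Σ aᵢuᵢ the generator of the curve, U solves U′ = −[w, U]: transport of Lie algebra
  -- elements along the curve.
  let B : ℝ → (Fin m → ℝ) →L[ℝ] (Fin m → ℝ) := fun s => -∑ i, a i s • N i
  have hB : Continuous B := by
    refine Continuous.neg (continuous_finsetSum _ fun i _ => (ha i).smul continuous_const)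
  obtain ⟨U, hU₀, hU⟩ := exists_solution_linear hB s₀ v
  refine ⟨U, hU₀, hU.self_of_nhds.continuousAt, ?_⟩
  let φ := extChartAt 𝓘(ℝ, E) (y s₀)
  let R : E → 𝔤 →ₗ[ℝ] E := A.chartField (y s₀)
  let c : ℝ → E := fun s => φ (y s)
  have hyc : ContinuousWithinAt y (Icc 0 1) s₀ := (hy s₀ hs₀).continuousWithinAt
  have hsrc : ∀ᶠ s in 𝓝[Icc 0 1] s₀, y s ∈ φ.source :=
    hyc.eventually (extChartAt_source_mem_nhds (y s₀))
  let Z : ℝ → E := fun s => R (c s) (e.equivFun.symm (U s) : 𝔤)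
  have hR : ∀ z (w : Fin m → ℝ), R z (e.equivFun.symm w : 𝔤) = ∑ l, w l • R z (e l : 𝔤) := by
    intro z w
    rw [Module.Basis.equivFun_symm_apply, AddSubmonoidClass.coe_finsetSum, map_sum]
    exact Finset.sum_congr rfl fun l _ => map_smul (R z) (w l) (e l : 𝔤)
  let D : 𝔤 → ℝ → E →L[ℝ] E := fun w s => fderiv ℝ (fun z => R z w) (c s)
  let L : ℝ → E →L[ℝ] E := fun s => ∑ i, a i s • D (u i) s
  have hc : ∀ s ∈ Icc (0 : ℝ) 1, y s ∈ φ.source →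
      HasDerivWithinAt c (∑ i, a i s • R (c s) (u i)) (Icc 0 1) s := by
    intro s hs hys
    have h1 := (hy s hs).comp (mdifferentiableAt_extChartAt (I := 𝓘(ℝ, E))
      (by rwa [← extChartAt_source 𝓘(ℝ, E)]))
    have h2 : mfderiv 𝓘(ℝ, E) 𝓘(ℝ, E) φ (y s) (∑ i, a i s • A.ρ (u i) (y s)) =
        ∑ i, a i s • R (c s) (u i) := by
      rw [map_sum]
      exact Finset.sum_congr rfl fun i _ => by
        rw [map_smul, A.mfderiv_extChartAt_apply _ hys]; rfl
    exact hasVelocityWithinAt_iff.1 (h2 ▸ h1)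
  -- Z is the value of ρ(U(s)) at y(s) in the chart. Expanding U′ with the bracket formula cancels
  -- the terms that differentiate ρ(U) along the curve, leaving the homogeneous equation Z′ = Σ aᵢ
  -- D(ρuᵢ) Z. As Z(s₀) = 0, Z vanishes nearby.
  have hZ : ∀ᶠ s in 𝓝[Icc 0 1] s₀, HasDerivWithinAt Z (L s (Z s)) (Icc 0 1) s := by
    filter_upwards [hsrc, self_mem_nhdsWithin, mem_nhdsWithin_of_mem_nhds hU] with s hys hs hUs
    have hz : c s ∈ φ.target := φ.map_source hys
    have hcs := hc s hs hys
    have hUl : ∀ l, HasDerivWithinAt (fun r => U r l) (B s (U s) l) (Icc 0 1) s := fun l =>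
      (hasDerivAt_pi.1 hUs l).hasDerivWithinAt
    have hRl : ∀ l, HasDerivWithinAt (fun r => R (c r) (e l : 𝔤))
        (D (e l) s (∑ i, a i s • R (c s) (u i))) (Icc 0 1) s := fun l =>
      ((A.contDiffAt_chartField (e l : 𝔤) hz).differentiableAt
        (by simp)).hasFDerivAt.comp_hasDerivWithinAt s hcs
    have hsum := HasDerivWithinAt.fun_sum (u := Finset.univ)
      fun l (_ : l ∈ Finset.univ) => (hUl l).smul (hRl l)
    have hZe : Z = fun r => ∑ l, U r l • R (c r) (e l : 𝔤) := funext fun r => hR _ _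
    rw [hZe]
    refine hsum.congr_deriv ?_
    have hlie : ∀ i l, R (c s) (⁅(u i : 𝔤), (e l : 𝔤)⁆) =
        D (e l) s (R (c s) (u i)) - D (u i) s (R (c s) (e l)) := fun i l =>
      A.chartField_lie (u i : 𝔤) (e l : 𝔤) hz
    have hN : ∀ i, (e.equivFun.symm (N i (U s)) : 𝔤) = ∑ l, U s l • ⁅(u i : 𝔤), (e l : 𝔤)⁆ := by
      intro i
      have h1 : e.equivFun.symm (N i (U s)) = ⁅u i, e.equivFun.symm (U s)⁆ := by
        change e.equivFun.symm (e.equivFun ⁅u i, e.equivFun.symm (U s)⁆) = _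
        rw [LinearEquiv.symm_apply_apply]
      rw [h1, LieSubalgebra.coe_bracket, Module.Basis.equivFun_symm_apply,
        AddSubmonoidClass.coe_finsetSum, lie_sum]
      exact Finset.sum_congr rfl fun l _ => lie_smul (U s l) (u i : 𝔤) (e l : 𝔤)
    have h1 : ∑ l, B s (U s) l • R (c s) (e l : 𝔤) =
        -∑ i, a i s • ∑ l, U s l • R (c s) ⁅(u i : 𝔤), (e l : 𝔤)⁆ := by
      rw [← hR]
      have h2 : (e.equivFun.symm (B s (U s)) : 𝔤) =
          -∑ i, a i s • (e.equivFun.symm (N i (U s)) : 𝔤) := by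
        simp only [B, neg_apply, sum_apply, smul_apply, map_neg, map_sum, map_smul]
        rw [NegMemClass.coe_neg, AddSubmonoidClass.coe_finsetSum]
        rfl
      rw [h2, map_neg, map_sum]
      congr 1
      refine Finset.sum_congr rfl fun i _ => ?_
      rw [map_smul, hN, map_sum]
      congr 1
      exact Finset.sum_congr rfl fun l _ => map_smul _ _ _
    rw [Finset.sum_add_distrib, h1]
    simp only [L, sum_apply, smul_apply, map_sum, map_smul,
      hlie, smul_sub, Finset.sum_sub_distrib, Finset.smul_sum]
    have h3 : ∑ l, ∑ i, U s l • a i s • D (e l) s (R (c s) (u i)) =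
        ∑ i, ∑ l, a i s • U s l • D (e l) s (R (c s) (u i)) := by
      rw [Finset.sum_comm]
      exact Finset.sum_congr rfl fun i _ => Finset.sum_congr rfl fun l _ => smul_comm _ _ _
    have h4 : ∑ l, ∑ i, U s l • a i s • D (u i) s (R (c s) (e l)) =
        ∑ i, ∑ l, a i s • U s l • D (u i) s (R (c s) (e l)) := by
      rw [Finset.sum_comm]
      exact Finset.sum_congr rfl fun i _ => Finset.sum_congr rfl fun l _ => smul_comm _ _ _
    rw [h3, h4]
    abel
  have hL : ContinuousWithinAt L (Icc 0 1) s₀ := by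
    have hz : c s₀ ∈ φ.target := mem_extChartAt_target (y s₀)
    have hcc : ContinuousWithinAt c (Icc 0 1) s₀ :=
      (hc s₀ hs₀ (mem_extChartAt_source (y s₀))).continuousWithinAt
    refine tendsto_finsetSum _ fun i _ => ((ha i).continuousWithinAt).smul ?_
    have h1 : ContinuousAt (fderiv ℝ (fun z => R z (u i))) (c s₀) :=
      ((A.contDiffAt_chartField (u i : 𝔤) hz).fderiv_right (m := 0)
        (by norm_num)).continuousAt
    exact h1.comp_continuousWithinAt hcc
  have hLb : ∀ᶠ s in 𝓝[Icc 0 1] s₀, ‖L s‖ ≤ ‖L s₀‖ + 1 := by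
    filter_upwards [hL.norm.eventually (gt_mem_nhds (show ‖L s₀‖ < ‖L s₀‖ + 1 by linarith))]
      with s hs using hs.le
  have hZρ : ∀ s, y s ∈ φ.source → Z s =
      mfderiv 𝓘(ℝ, E) 𝓘(ℝ, E) φ (y s) (A.ρ (e.equivFun.symm (U s) : 𝔤) (y s)) := fun s hys =>
    (A.mfderiv_extChartAt_apply _ hys).symm
  have hZ₀ : Z s₀ = 0 := by
    rw [hZρ s₀ (mem_extChartAt_source (y s₀)), hU₀, hv]
    exact map_zero _
  filter_upwards [eventually_eq_zero_of_linear hs₀ hLb hZ hZ₀, hsrc] with s hs hys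
  rw [hZρ s hys] at hs
  exact Action.injective_mfderiv_extChartAt hys (hs.trans (map_zero _).symm)

theorem ContinuousAlong.eventually_finrank_span_le [T2Space M] {γ : ℝ → M} {T : Set ℝ} {s₀ : ℝ}
    (hs₀ : s₀ ∈ T) (hγ : ContinuousWithinAt γ T s₀) {ι : Type*}
    {X : ι → ∀ s, TangentSpace 𝓘(ℝ, E) (γ s)} (hX : ∀ i, ContinuousAlong γ T (X i)) :
    ∀ᶠ s in 𝓝[T] s₀, Module.finrank ℝ (Submodule.span ℝ (range fun i => X i s₀)) ≤
      Module.finrank ℝ (Submodule.span ℝ (range fun i => X i s)) := by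
  obtain ⟨Ψ, hΨ, -, hbij⟩ := exists_smooth_chart (E := E) (γ s₀)
  let W : ι → ℝ → E := fun i s => mfderiv 𝓘(ℝ, E) 𝓘(ℝ, E) Ψ (γ s) (X i s)
  have hfr : ∀ s, Function.Injective (mfderiv 𝓘(ℝ, E) 𝓘(ℝ, E) Ψ (γ s)) →
      Module.finrank ℝ (Submodule.span ℝ (range fun i => W i s)) =
        Module.finrank ℝ (Submodule.span ℝ (range fun i => X i s)) := by
    intro s hs
    have h1 : Submodule.span ℝ (range fun i => W i s) =
        (Submodule.span ℝ (range fun i => X i s)).map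
          ((mfderiv 𝓘(ℝ, E) 𝓘(ℝ, E) Ψ (γ s)).toLinearMap : _ →ₗ[ℝ] E) := by
      rw [Submodule.map_span, ← range_comp]
      rfl
    rw [h1]
    exact (Submodule.equivMapOfInjective _ hs _).finrank_eq.symm
  filter_upwards [CentralReduction.eventually_finrank_span_le (W := W) fun i =>
    (hX i).continuousOn_mfderiv hΨ s₀ hs₀, hγ.eventually hbij] with s hs hbs
  rwa [hfr s hbs.1, hfr s₀ hbij.self_of_nhds.1] at hs

variable [FiniteDimensional ℝ 𝔤] [T2Space M]

/-- The dimension of `ρ(𝔠)` is constant along `𝔠`-orbits. -/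
theorem Action.finrank_orbitSpace_eq {A : Action 𝔤 E M} {𝔠 : LieSubalgebra ℝ 𝔤} {x x' : M}
    (h : x' ∈ A.orbitOf 𝔠 x) :
    Module.finrank ℝ (A.orbitSpace 𝔠 x') = Module.finrank ℝ (A.orbitSpace 𝔠 x) := by
  induction h with
  | refl => rfl
  | tail _ hj ih =>
    rw [← ih]
    obtain ⟨k, X, a, y, hX, ha, rfl, rfl, hy⟩ := joined_iff.1 hj
    choose u hu hXu using hX
    obtain rfl : X = fun i => A.ρ (u i) := funext hXu
    let e := Module.finBasis ℝ 𝔠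
    let Λ : ∀ s, (Fin (Module.finrank ℝ 𝔠) → ℝ) →ₗ[ℝ] TangentSpace 𝓘(ℝ, E) (y s) := fun s =>
      A.eval (y s) ∘ₗ 𝔠.toSubmodule.subtype ∘ₗ e.equivFun.symm.toLinearMap
    have hrange : ∀ s, LinearMap.range (Λ s) = A.orbitSpace 𝔠 (y s) := by
      intro s
      ext v
      rw [A.mem_orbitSpace]
      constructor
      · rintro ⟨w, rfl⟩
        exact ⟨_, (e.equivFun.symm w).2, rfl⟩
      · rintro ⟨w, hw, rfl⟩
        refine ⟨e.equivFun ⟨w, hw⟩, ?_⟩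
        change A.ρ (e.equivFun.symm (e.equivFun ⟨w, hw⟩) : 𝔤) (y s) = A.ρ w (y s)
        rw [LinearEquiv.symm_apply_apply]
    have hrn : ∀ s, Module.finrank ℝ (A.orbitSpace 𝔠 (y s)) +
        Module.finrank ℝ (LinearMap.ker (Λ s)) = Module.finrank ℝ (Fin (Module.finrank ℝ 𝔠) → ℝ) :=
      fun s => hrange s ▸ (Λ s).finrank_range_add_finrank_ker
    -- The rank of u ↦ ρ(u) on 𝔠 is lower semicontinuous, and so is its nullity, by transport of
    -- stabilizers. Their sum is dim 𝔠, so both are locally constant.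
    have hloc : ∀ s₀ ∈ Icc (0 : ℝ) 1, ∀ᶠ s in 𝓝[Icc 0 1] s₀,
        Module.finrank ℝ (A.orbitSpace 𝔠 (y s)) = Module.finrank ℝ (A.orbitSpace 𝔠 (y s₀)) := by
      intro s₀ hs₀
      have hyc : ContinuousOn y (Icc 0 1) := fun s hs => (hy s hs).continuousWithinAt
      have h1 : ∀ᶠ s in 𝓝[Icc 0 1] s₀, Module.finrank ℝ (A.orbitSpace 𝔠 (y s₀)) ≤
          Module.finrank ℝ (A.orbitSpace 𝔠 (y s)) := by
        filter_upwards [ContinuousAlong.eventually_finrank_span_le hs₀ (hyc s₀ hs₀)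
          (X := fun (u : 𝔠) s => A.ρ u (y s))
          fun u => ContinuousAlong.of_field hyc (A.continuous_dR (u : 𝔤))] with s hs
        rw [← A.span_range_eq_orbitSpace, ← A.span_range_eq_orbitSpace]
        exact hs
      -- A basis of the stabilizer at s₀ is transported; its members stay in the nearby stabilizers
      -- and still span at least as large a space.
      let b := Module.finBasis ℝ (LinearMap.ker (Λ s₀))
      choose U hU₀ hUc hU using fun i => A.exists_path_stabilizer 𝔠 e (u := fun i => ⟨u i, hu i⟩)
        ha hy hs₀ (v := (b i : Fin (Module.finrank ℝ 𝔠) → ℝ)) (b i).2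
      have h2 := CentralReduction.eventually_finrank_span_le (T := Icc 0 1) (W := U)
        fun i => (hUc i).continuousWithinAt
      have h3 : Submodule.span ℝ (range fun i => U i s₀) = LinearMap.ker (Λ s₀) := by
        have h4 : (range fun i => U i s₀) = (LinearMap.ker (Λ s₀)).subtype '' range b := by
          rw [← range_comp]
          exact congrArg range (funext hU₀)
        rw [h4, ← Submodule.map_span, b.span_eq, Submodule.map_top, Submodule.range_subtype]
      rw [h3] at h2
      filter_upwards [h1, h2, eventually_all.2 hU] with s hs1 hs2 hs3
      have h5 : Submodule.span ℝ (range fun i => U i s) ≤ LinearMap.ker (Λ s) := by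
        rw [Submodule.span_le]
        rintro _ ⟨i, rfl⟩
        exact hs3 i
      have h6 := Submodule.finrank_mono h5
      have h7 := hrn s
      have h8 := hrn s₀
      omega
    exact (forall_Icc_of_local (R := fun r s => Module.finrank ℝ (A.orbitSpace 𝔠 (y s)) =
      Module.finrank ℝ (A.orbitSpace 𝔠 (y r))) (fun _ _ _ h h' => h'.trans h)
      (fun s hs => (hloc s hs).mono fun r hr => ⟨hr, hr.symm⟩))
      0 (left_mem_Icc.2 zero_le_one) 1 (right_mem_Icc.2 zero_le_one)

end ChartField

end

end CentralReduction

namespace CentralReduction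

open Filter Topology

noncomputable section

/-! ### Symplectic leaves and tangential curves. -/

section Leaves

variable {E : Type*} [NormedAddCommGroup E] [NormedSpace ℝ E] [FiniteDimensional ℝ E]
  {M : Type*} [TopologicalSpace M] [T2Space M] [ChartedSpace E M] [IsManifold 𝓘(ℝ, E) ∞ M]

namespace Bivector

theorem span_range_hamiltonian (π : Bivector E M) (x : M) :
    Submodule.span ℝ (range fun g : {g : M → ℝ // ContMDiff 𝓘(ℝ, E) 𝓘(ℝ, ℝ) ∞ g} =>
      π.hamiltonian g x) = LinearMap.range (π.anchor x) := by
  have : (range fun g : {g : M → ℝ // ContMDiff 𝓘(ℝ, E) 𝓘(ℝ, ℝ) ∞ g} => π.hamiltonian g x) =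
      (LinearMap.range (π.anchor x) : Set (TangentSpace 𝓘(ℝ, E) x)) := by
    ext v
    constructor
    · rintro ⟨g, rfl⟩
      exact ⟨_, rfl⟩
    · rintro ⟨α, rfl⟩
      obtain ⟨g, hg, rfl⟩ := exists_dR_eq x α
      exact ⟨⟨g, hg⟩, rfl⟩
  rw [this, Submodule.span_eq]

/-- A curve tangent to the characteristic distribution, along which the rank is constant, stays in
a symplectic leaf. -/
theorem mem_symplecticLeaf_of_joinedTangentially (π : Bivector E M) {S : Set M}
    (hrank : ∀ x ∈ S, ∀ y ∈ S, Module.finrank ℝ (LinearMap.range (π.anchor x)) =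
      Module.finrank ℝ (LinearMap.range (π.anchor y)))
    {x y : M} (h : JoinedTangentially S π.image x y) : y ∈ π.symplecticLeaf x := by
  obtain ⟨γ, hγ, rfl, rfl, hS⟩ := h
  refine forall_Icc_of_local (R := fun r s => γ s ∈ π.symplecticLeaf (γ r))
    (fun _ _ _ => mem_orbit_trans) (fun s₀ hs₀ => ?_) 0 (left_mem_Icc.2 zero_le_one) 1
    (right_mem_Icc.2 zero_le_one)
  have hγc : ContinuousOn γ (Icc 0 1) := hγ.continuousOn
  -- Hamiltonian fields span the image of π♯, whose rank is constant along γ, so the velocity is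
  -- locally a combination of them with continuous coefficients.
  obtain ⟨n, j, b, U, hU, hUT, hb, hsum⟩ := ContinuousAlong.exists_coeffs hs₀ (hγc s₀ hs₀)
    (X := fun (g : {g : M → ℝ // ContMDiff 𝓘(ℝ, E) 𝓘(ℝ, ℝ) ∞ g}) s => π.hamiltonian g (γ s))
    (fun g => ContinuousAlong.of_field hγc (π.continuous_dR_hamiltonian g.2))
    (continuousAlong_mfderivWithin hγ)
    (fun s hs => by
      rw [π.span_range_hamiltonian]
      have := (hS s hs).2
      rwa [π.image_eq_range] at this)
    (fun s hs => by
      rw [π.span_range_hamiltonian, π.span_range_hamiltonian]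
      exact hrank _ (hS s hs).1 _ (hS s₀ hs₀).1)
  have hj := eventually_joined_of_coeffs (G := π.hamiltonianFields) (γ := γ) hs₀ hU
    (X := fun i => π.hamiltonian (j i)) (fun i => π.hamiltonian_mem (j i).2) hb
    (fun s hs => hsum s hs ▸ hasVelocityWithinAt_mfderivWithin
      (hγ.mdifferentiableOn (by simp) s (hUT hs)))
  exact hj.mono fun s hs => ⟨Relation.ReflTransGen.single hs, Relation.ReflTransGen.single hs.symm⟩

/-- Each initial piece of the curve is itself a Hamiltonian curve starting at x, so invariance of S
keeps the whole curve in S. -/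
theorem joinedTangentially_of_joined (π : Bivector E M) {S : Set M}
    (hS : ∀ x ∈ S, ∀ y, Joined π.hamiltonianFields x y → y ∈ S) {x y : M} (hx : x ∈ S)
    (h : Joined π.hamiltonianFields x y) : JoinedTangentially S π.image x y := by
  obtain ⟨k, X, a, γ, hX, ha, rfl, rfl, hγ⟩ := joined_iff.1 h
  choose g hg hXg using fun i => π.eq_hamiltonian_of_mem (hX i)
  obtain rfl : X = fun i => π.hamiltonian (g i) := funext hXg
  have hγc : ContinuousOn γ (Icc 0 1) := fun s hs => (hγ s hs).continuousWithinAt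
  refine ⟨γ, contMDiffOn_of_hasVelocity hγ (ContinuousAlong.sum_smul
    (fun i => ContinuousAlong.of_field hγc (π.continuous_dR_hamiltonian (hg i)))
    fun i => (ha i).continuousOn), rfl, rfl, fun s hs => ⟨?_, ?_⟩⟩
  · have hsub : uIcc 0 s ⊆ Icc (0 : ℝ) 1 :=
      ordConnected_Icc.uIcc_subset (left_mem_Icc.2 zero_le_one) hs
    exact hS _ hx _ (joined_of_uIcc hX (fun i => (ha i).continuousOn)
      fun r hr => (hγ r (hsub hr)).mono hsub)
  · rw [(hγ s hs).mfderivWithin_eq hs, π.image_eq_range]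
    exact Submodule.sum_mem _ fun i _ => Submodule.smul_mem _ _ ⟨_, rfl⟩

/-- The components of a saturated set on which the rank is constant are symplectic leaves. -/
theorem immersedComponent_eq_symplecticLeaf (π : Bivector E M) {S : Set M}
    (hS : ∀ x ∈ S, ∀ y, Joined π.hamiltonianFields x y → y ∈ S)
    (hrank : ∀ x ∈ S, ∀ y ∈ S, Module.finrank ℝ (LinearMap.range (π.anchor x)) =
      Module.finrank ℝ (LinearMap.range (π.anchor y))) {x : M} (hx : x ∈ S) :
    immersedComponent S π.image x = π.symplecticLeaf x := by
  ext y
  constructor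
  · intro h
    induction h with
    | refl => exact mem_orbit_self _ _
    | tail _ hj ih =>
      exact mem_orbit_trans ih (π.mem_symplecticLeaf_of_joinedTangentially hrank hj)
  · intro h
    suffices h' : y ∈ S ∧ y ∈ immersedComponent S π.image x from h'.2
    induction h with
    | refl => exact ⟨hx, Relation.ReflTransGen.refl⟩
    | tail _ hj ih =>
      exact ⟨hS _ ih.1 _ hj, ih.2.tail (π.joinedTangentially_of_joined hS ih.1 hj)⟩

end Bivector

end Leaves

/-! ### Invariance and constant rank of the reduced space. -/

section Reduction

variable {𝔤 : Type*} [LieRing 𝔤] [LieAlgebra ℝ 𝔤] [FiniteDimensional ℝ 𝔤] {t : 𝔤 ⊗[ℝ] 𝔤}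
  {E : Type*} [NormedAddCommGroup E] [NormedSpace ℝ E] [FiniteDimensional ℝ E]
  {M : Type*} [TopologicalSpace M] [T2Space M] [ChartedSpace E M] [IsManifold 𝓘(ℝ, E) ∞ M]
  {EL : Type*} [NormedAddCommGroup EL] [NormedSpace ℝ EL] [FiniteDimensional ℝ EL]
  {NL : Type*} [TopologicalSpace NL] [T2Space NL] [ChartedSpace EL NL] [IsManifold 𝓘(ℝ, EL) ∞ NL]
  {ER : Type*} [NormedAddCommGroup ER] [NormedSpace ℝ ER] [FiniteDimensional ℝ ER]
  {NR : Type*} [TopologicalSpace NR] [T2Space NR] [ChartedSpace ER NR] [IsManifold 𝓘(ℝ, ER) ∞ NR]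
  {F : Type*} [NormedAddCommGroup F] [NormedSpace ℝ F] [FiniteDimensional ℝ F]
  {Q : Type*} [TopologicalSpace Q] [T2Space Q] [ChartedSpace F Q] [IsManifold 𝓘(ℝ, F) ∞ Q]
  {P : QuasiPoisson E M t} {CL : QuasiPoisson EL NL t} {CR : QuasiPoisson ER NR t}
  {μL : M → NL} {μR : M → NR} {𝔠 : LieSubalgebra ℝ 𝔤} {p : M → Q} {OL : Set NL} {OR : Set NR}

/-- The level set `μ_L⁻¹(O_L) ∩ μ_R⁻¹(O_R)` is saturated. -/
theorem IsCentralPair.mem_image_iff (hpair : IsCentralPair P CL CR μL μR)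
    (hp : P.toAction.IsQuotient (F := F) 𝔠 p) (hOL : CL.toAction.IsOrbit 𝔠 OL)
    (hOR : CR.toAction.IsOrbit 𝔠 OR) {x : M} :
    p x ∈ p '' (μL ⁻¹' OL ∩ μR ⁻¹' OR) ↔ x ∈ μL ⁻¹' OL ∩ μR ⁻¹' OR := by
  refine ⟨?_, mem_image_of_mem p⟩
  rintro ⟨z, ⟨hzL, hzR⟩, hz⟩
  have h := (hp.fibre z x).1 hz
  exact ⟨hOL.mem_of_mem_orbitOf hzL (hpair.left.equivariant.mem_orbitOf h),
    hOR.mem_of_mem_orbitOf hzR (hpair.right.equivariant.mem_orbitOf h)⟩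

/-- The reduced space is invariant under Hamiltonian vector fields. -/
theorem IsCentralPair.mem_image_of_joined (hpair : IsCentralPair P CL CR μL μR)
    (ht : IsInvariantSymmetric t) (h𝔠 : IsLagrangian t 𝔠.toSubmodule)
    (hp : P.toAction.IsQuotient (F := F) 𝔠 p) (hOL : CL.toAction.IsOrbit 𝔠 OL)
    (hOR : CR.toAction.IsOrbit 𝔠 OR) {q q' : Q} (hq : q ∈ p '' (μL ⁻¹' OL ∩ μR ⁻¹' OR))
    (h : Joined (P.reduced hp).hamiltonianFields q q') : q' ∈ p '' (μL ⁻¹' OL ∩ μR ⁻¹' OR) := by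
  obtain ⟨k, X, a, γ, hX, ha, rfl, rfl, hγ⟩ := joined_iff.1 h
  choose g hg hXg using fun i => (P.reduced hp).eq_hamiltonian_of_mem (hX i)
  obtain rfl : X = fun i => (P.reduced hp).hamiltonian (g i) := funext hXg
  -- Lifts exist only for short times, but through any point over γ s₀. So "in S" is shown to be a
  -- locally constant property along γ, from an arbitrary s₀ and in both directions.
  refine forall_Icc_of_local (R := fun r s => γ r ∈ p '' (μL ⁻¹' OL ∩ μR ⁻¹' OR) →
    γ s ∈ p '' (μL ⁻¹' OL ∩ μR ⁻¹' OR)) (fun _ _ _ h h' hr => h' (h hr)) (fun s₀ hs₀ => ?_) 0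
    (left_mem_Icc.2 zero_le_one) 1 (right_mem_Icc.2 zero_le_one) hq
  obtain ⟨x₀, hx₀⟩ := hp.surjective (γ s₀)
  filter_upwards [QuasiPoisson.eventually_exists_lift hp hg ha hγ hs₀ hx₀] with s hs
  obtain ⟨x, hx, hj⟩ := hs
  have hL := hOL.mem_iff (QuasiPoisson.mem_orbitOf_of_joined h𝔠 ht hp hpair.left.equivariant
    (hpair.left.mfderiv_anchor ht) hj)
  have hR := hOR.mem_iff (QuasiPoisson.mem_orbitOf_of_joined h𝔠 ht hp hpair.right.equivariant
    hpair.right.mfderiv_anchor hj)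
  have : γ s₀ ∈ p '' (μL ⁻¹' OL ∩ μR ⁻¹' OR) ↔ γ s ∈ p '' (μL ⁻¹' OL ∩ μR ⁻¹' OR) := by
    rw [← hx₀, ← hx, hpair.mem_image_iff hp hOL hOR, hpair.mem_image_iff hp hOL hOR]
    exact and_congr hL hR
  exact ⟨this.1, this.2⟩

/-- The reduced Poisson structure has constant rank on the reduced space. -/
theorem IsSplitSymplecticPair.finrank_range_anchor_eq
    (hpair : IsSplitSymplecticPair P CL CR μL μR)
    (ht : IsInvariantSymmetric t) (h𝔠 : IsLagrangian t 𝔠.toSubmodule)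
    (hp : P.toAction.IsQuotient (F := F) 𝔠 p) (hOL : CL.toAction.IsOrbit 𝔠 OL)
    (hOR : CR.toAction.IsOrbit 𝔠 OR)
    (htrans : IsTransverse (E := E) 𝔠 CL.toAction CR.toAction μL μR OL OR) :
    ∀ q ∈ p '' (μL ⁻¹' OL ∩ μR ⁻¹' OR), ∀ q' ∈ p '' (μL ⁻¹' OL ∩ μR ⁻¹' OR),
      Module.finrank ℝ (LinearMap.range ((P.reduced hp).anchor q)) =
        Module.finrank ℝ (LinearMap.range ((P.reduced hp).anchor q')) := by
  rintro _ ⟨x, hx, rfl⟩ _ ⟨x', hx', rfl⟩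
  have h1 := hpair.finrank_range_anchor ht h𝔠 hp htrans hx
  have h2 := hpair.finrank_range_anchor ht h𝔠 hp htrans hx'
  obtain ⟨y, rfl⟩ := hOL
  obtain ⟨z, rfl⟩ := hOR
  rw [Action.finrank_orbitSpace_eq hx.1, Action.finrank_orbitSpace_eq hx.2] at h1
  rw [Action.finrank_orbitSpace_eq hx'.1, Action.finrank_orbitSpace_eq hx'.2] at h2
  omega

end Reduction

end

end CentralReduction

namespace CentralReduction

open Filter Topology

noncomputable section

/-! ### Connected components of embedded submanifolds. -/

section Embedded

variable {E : Type*} [NormedAddCommGroup E] [NormedSpace ℝ E] [FiniteDimensional ℝ E]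
  {M : Type*} [TopologicalSpace M] [T2Space M] [ChartedSpace E M] [IsManifold 𝓘(ℝ, E) ∞ M]
  {S : Set M} {T : ∀ x : M, Set (TangentSpace 𝓘(ℝ, E) x)}

/-- A curve in a level set of a function has its velocity in the kernel of the differential. -/
theorem HasVelocityWithinAt.mfderiv_eq_zero {k : ℕ} {h : M → Fin k → ℝ} {γ : ℝ → M} {s : ℝ}
    (hs : s ∈ Icc (0 : ℝ) 1) {v : TangentSpace 𝓘(ℝ, E) (γ s)}
    (hγ : HasVelocityWithinAt γ (Icc 0 1) s v)
    (hh : MDifferentiableAt 𝓘(ℝ, E) 𝓘(ℝ, Fin k → ℝ) h (γ s))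
    (h0 : ∀ r ∈ Icc (0 : ℝ) 1, h (γ r) = 0) : mfderiv 𝓘(ℝ, E) 𝓘(ℝ, Fin k → ℝ) h (γ s) v = 0 := by
  have h1 := hasVelocityWithinAt_iff.1 (hγ.comp hh)
  have h2 : HasDerivWithinAt (fun r => h (γ r)) 0 (Icc 0 1) s :=
    (hasDerivWithinAt_const s (Icc 0 1) (0 : Fin k → ℝ)).congr h0 (h0 s hs)
  exact UniqueDiffWithinAt.eq_deriv (F := Fin k → ℝ) _ (uniqueDiffOn_Icc zero_lt_one s hs) h1 h2

/-- Nearby points of an embedded submanifold are joined by curves in the submanifold. -/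
theorem IsEmbeddedSubmanifold.eventually_joinedTangentially (hS : IsEmbeddedSubmanifold S T)
    {x : M} (hx : x ∈ S) : ∀ᶠ y in 𝓝[S] x, JoinedTangentially S T x y := by
  obtain ⟨U, hU, hxU, k, h, hh, hSU, hT⟩ := hS x hx
  let φ := extChartAt 𝓘(ℝ, E) x
  obtain ⟨A, hA, hxA, hAφ, hAU, hhA⟩ := contDiffOn_writtenInExtChartAt hU hxU hh
  let w := writtenInExtChartAt 𝓘(ℝ, E) 𝓘(ℝ, Fin k → ℝ) x h
  have hw : ∀ z, w z = h (φ.symm z) := fun z => rfl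
  let D : E →L[ℝ] (Fin k → ℝ) := fderiv ℝ w (φ x)
  have hwD : HasFDerivAt w D (φ x) :=
    ((hhA.contDiffAt (hA.mem_nhds hxA)).differentiableAt (by simp)).hasFDerivAt
  have hD : Function.Surjective D := by
    have h1 := (hT x ⟨hxU, hx⟩).1
    rw [((hh.contMDiffAt (hU.mem_nhds hxU)).mdifferentiableAt (by simp)).mfderiv] at h1
    simp only [ModelWithCorners.range_eq_univ, fderivWithin_univ] at h1
    exact h1
  let K : Submodule ℝ E := LinearMap.ker D.toLinearMap
  obtain ⟨π', hπ⟩ := K.subtype.exists_leftInverse_of_injective K.ker_subtype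
  let π : E →L[ℝ] K := LinearMap.toContinuousLinearMap π'
  have hπK : ∀ v : K, π v = v := fun v => LinearMap.congr_fun hπ v
  have hinj : Function.Injective (D.prod π) := by
    rw [injective_iff_map_eq_zero]
    intro v hv
    have h1 : D v = 0 := congrArg Prod.fst hv
    have h2 : π v = 0 := congrArg Prod.snd hv
    have h3 := hπK ⟨v, h1⟩
    rw [show π ((⟨v, h1⟩ : K) : E) = 0 from h2] at h3
    exact (congrArg Subtype.val h3).symm
  have hfr : Module.finrank ℝ E = Module.finrank ℝ ((Fin k → ℝ) × K) := by
    rw [Module.finrank_prod, ← D.toLinearMap.finrank_range_add_finrank_ker,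
      LinearMap.range_eq_top.2 hD, finrank_top]
  let L : E ≃L[ℝ] (Fin k → ℝ) × K := (LinearEquiv.ofInjectiveOfFinrankEq
    (D.prod π).toLinearMap hinj hfr).toContinuousLinearEquiv
  -- A slice chart: the local equation together with a projection to the kernel of its differential.
  -- Its derivative at φ x is the isomorphism `L`.
  let G : E → (Fin k → ℝ) × K := fun z => (w z, π (z - φ x))
  have hG : ContDiffOn ℝ ∞ G A :=
    hhA.prodMk (π.contDiff.comp (contDiff_id.sub contDiff_const)).contDiffOn
  have hGL : HasFDerivAt G (L : E →L[ℝ] (Fin k → ℝ) × K) (φ x) := by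
    have h1 := hwD.prodMk ((π.hasFDerivAt (x := φ x - φ x)).comp (f := fun z => z - φ x) (φ x)
      ((hasFDerivAt_id (φ x)).sub_const (φ x)))
    exact h1.congr_fderiv (by ext v <;> rfl)
  obtain ⟨e, heG, hxe, heA, he⟩ := exists_smooth_inverse hA hG hxA hGL
  have hG0 : G (φ x) = 0 := by
    have h1 : w (φ x) = 0 := by
      rw [hw, extChartAt_to_inv]; exact (hSU x hxU).1 hx
    simp [G, h1]
  obtain ⟨ε, hε, hεe⟩ := Metric.mem_nhds_iff.1 (e.open_target.mem_nhds (e.map_source hxe))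
  rw [heG, hG0] at hεe
  have hφc : ContinuousAt φ x := continuousAt_extChartAt x
  have h1 : ∀ᶠ y in 𝓝 x, φ y ∈ e.source := hφc.eventually (e.open_source.mem_nhds hxe)
  have h2 : ∀ᶠ y in 𝓝 x, G (φ y) ∈ Metric.ball 0 ε := by
    have hGc : ContinuousAt G (φ x) := (hG.contDiffAt (hA.mem_nhds hxA)).continuousAt
    exact (hGc.comp hφc).eventually (Metric.isOpen_ball.mem_nhds
      (by rw [Function.comp_apply, hG0]; exact Metric.mem_ball_self hε))
  filter_upwards [mem_nhdsWithin_of_mem_nhds h1, mem_nhdsWithin_of_mem_nhds h2,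
    mem_nhdsWithin_of_mem_nhds (extChartAt_source_mem_nhds (I := 𝓘(ℝ, E)) x),
    mem_nhdsWithin_of_mem_nhds (hU.mem_nhds hxU), self_mem_nhdsWithin] with y hye hyε hyφ hyU hyS
  have hball : ∀ s ∈ Icc (0 : ℝ) 1, s • G (φ y) ∈ e.target := by
    intro s hs
    apply hεe
    rw [mem_ball_zero_iff, norm_smul, Real.norm_of_nonneg hs.1] at *
    nlinarith [norm_nonneg (G (φ y)), hs.2]
  -- The segment from x to y in slice coordinates; the first component of its end points is 0, so
  -- the segment stays in S.
  let γ : ℝ → M := fun s => φ.symm (e.symm (s • G (φ y)))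
  have hγ : ContMDiffOn 𝓘(ℝ, ℝ) 𝓘(ℝ, E) 1 γ (Icc 0 1) := by
    have c1 : ContDiffOn ℝ ∞ (fun s : ℝ => e.symm (s • G (φ y))) (Icc 0 1) :=
      he.comp (contDiff_id.smul contDiff_const).contDiffOn hball
    exact ((contMDiffOn_extChartAt_symm x).comp c1.contMDiffOn fun s hs =>
      hAφ (heA (e.map_target (hball s hs)))).of_le (by simp)
  have hγA : ∀ s ∈ Icc (0 : ℝ) 1, e.symm (s • G (φ y)) ∈ A := fun s hs =>
    heA (e.map_target (hball s hs))
  have hγU : ∀ s ∈ Icc (0 : ℝ) 1, γ s ∈ U := fun s hs => (hAU _ (hγA s hs)).1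
  have hγ0 : ∀ s ∈ Icc (0 : ℝ) 1, h (γ s) = 0 := by
    intro s hs
    have h3 := e.right_inv (hball s hs)
    rw [heG] at h3
    have h4 : h (γ s) = s • w (φ y) := congrArg Prod.fst h3
    rw [h4, hw, φ.left_inv hyφ, (hSU y hyU).1 hyS, smul_zero]
  have hγS : ∀ s ∈ Icc (0 : ℝ) 1, γ s ∈ S := fun s hs => (hSU _ (hγU s hs)).2 (hγ0 s hs)
  refine ⟨γ, hγ, ?_, ?_, fun s hs => ⟨hγS s hs, ?_⟩⟩
  · change φ.symm (e.symm ((0 : ℝ) • G (φ y))) = x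
    rw [zero_smul, ← hG0, ← heG, e.left_inv hxe]
    exact extChartAt_to_inv x
  · change φ.symm (e.symm ((1 : ℝ) • G (φ y))) = y
    rw [one_smul, ← heG, e.left_inv hye]
    exact φ.left_inv hyφ
  · rw [(hT _ ⟨hγU s hs, hγS s hs⟩).2]
    exact (hasVelocityWithinAt_mfderivWithin
      (hγ.mdifferentiableOn (by simp) s hs)).mfderiv_eq_zero hs
      ((hh.contMDiffAt (hU.mem_nhds (hγU s hs))).mdifferentiableAt (by simp)) hγ0

/-- The points joined to `x` by curves in `S` lie in the connected component of `x` in `S`. -/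
theorem immersedComponent_subset_connectedComponentIn {x : M} (hx : x ∈ S) :
    immersedComponent S T x ⊆ connectedComponentIn S x := by
  intro y h
  induction h with
  | refl => exact mem_connectedComponentIn hx
  | tail _ hj ih =>
    rw [connectedComponentIn_eq ih]
    obtain ⟨γ, hγ, rfl, rfl, hS⟩ := hj
    refine (isPreconnected_Icc.image γ hγ.continuousOn).subset_connectedComponentIn
      ⟨0, left_mem_Icc.2 zero_le_one, rfl⟩ ?_ ⟨1, right_mem_Icc.2 zero_le_one, rfl⟩
    rintro _ ⟨s, hs, rfl⟩
    exact (hS s hs).1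

/-- The connected components of an embedded submanifold whose immersed components are symplectic
leaves. -/
theorem IsEmbeddedSubmanifold.connectedComponentIn_eq_symplecticLeaf {π : Bivector E M}
    (hS : IsEmbeddedSubmanifold S π.image)
    (hleaf : ∀ x ∈ S, immersedComponent S π.image x = π.symplecticLeaf x) {x : M} (hx : x ∈ S) :
    connectedComponentIn S x = π.symplecticLeaf x := by
  apply Subset.antisymm
  · intro y hy
    have hsub := connectedComponentIn_subset S x
    -- Near each point of S, the other points of S are in the same leaf; on a preconnected set this
    -- equivalence relation has a single class.
    refine (isPreconnected_connectedComponentIn (F := S) (x := x)).induction₂'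
      (fun y z => z ∈ π.symplecticLeaf y) (fun y hy => ?_)
      (fun y z u _ _ _ => mem_orbit_trans) (mem_connectedComponentIn hx) hy
    have h := (hS.eventually_joinedTangentially (hsub hy)).filter_mono (nhdsWithin_mono y hsub)
    refine h.mono fun z hz => ?_
    have h1 : z ∈ π.symplecticLeaf y := by
      rw [← hleaf y (hsub hy)]
      exact Relation.ReflTransGen.single hz
    exact ⟨h1, mem_orbit_symm h1⟩
  · rw [← hleaf x hx]
    exact immersedComponent_subset_connectedComponentIn hx

end Embedded

end

end CentralReduction

namespace CentralReduction

open Filter Topology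

noncomputable section

/-! ### Embeddedness of the reduced space, and the theorem. -/

section Reduction

variable {𝔤 : Type*} [LieRing 𝔤] [LieAlgebra ℝ 𝔤] [FiniteDimensional ℝ 𝔤] {t : 𝔤 ⊗[ℝ] 𝔤}
  {E : Type*} [NormedAddCommGroup E] [NormedSpace ℝ E] [FiniteDimensional ℝ E]
  {M : Type*} [TopologicalSpace M] [T2Space M] [ChartedSpace E M] [IsManifold 𝓘(ℝ, E) ∞ M]
  {EL : Type*} [NormedAddCommGroup EL] [NormedSpace ℝ EL] [FiniteDimensional ℝ EL]
  {NL : Type*} [TopologicalSpace NL] [T2Space NL] [ChartedSpace EL NL] [IsManifold 𝓘(ℝ, EL) ∞ NL]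
  {ER : Type*} [NormedAddCommGroup ER] [NormedSpace ℝ ER] [FiniteDimensional ℝ ER]
  {NR : Type*} [TopologicalSpace NR] [T2Space NR] [ChartedSpace ER NR] [IsManifold 𝓘(ℝ, ER) ∞ NR]
  {F : Type*} [NormedAddCommGroup F] [NormedSpace ℝ F] [FiniteDimensional ℝ F]
  {Q : Type*} [TopologicalSpace Q] [T2Space Q] [ChartedSpace F Q] [IsManifold 𝓘(ℝ, F) ∞ Q]
  {P : QuasiPoisson E M t} {CL : QuasiPoisson EL NL t} {CR : QuasiPoisson ER NR t}
  {μL : M → NL} {μR : M → NR} {𝔠 : LieSubalgebra ℝ 𝔤} {p : M → Q} {OL : Set NL} {OR : Set NR}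

/-- The differential of a local section is a right inverse of that of the submersion. -/
theorem mfderiv_section_apply {p : M → Q} {τ : Q → M} {y : Q}
    (hp : MDifferentiableAt 𝓘(ℝ, E) 𝓘(ℝ, F) p (τ y)) (hτ : MDifferentiableAt 𝓘(ℝ, F) 𝓘(ℝ, E) τ y)
    (h : ∀ᶠ z in 𝓝 y, p (τ z) = z) (w : TangentSpace 𝓘(ℝ, F) y) :
    (mfderiv 𝓘(ℝ, E) 𝓘(ℝ, F) p (τ y) (mfderiv 𝓘(ℝ, F) 𝓘(ℝ, E) τ y w) : F) = w := by
  have h2 := mfderiv_comp y hp hτ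
  have h3 : p ∘ τ =ᶠ[𝓝 y] id := h
  rw [h3.mfderiv_eq, mfderiv_id] at h2
  exact (DFunLike.congr_fun h2 w).symm

/-- The reduced space is embedded if the two orbits are. -/
theorem IsSplitSymplecticPair.isEmbeddedSubmanifold_image
    (hpair : IsSplitSymplecticPair P CL CR μL μR)
    (ht : IsInvariantSymmetric t) (h𝔠 : IsLagrangian t 𝔠.toSubmodule)
    (hp : P.toAction.IsQuotient (F := F) 𝔠 p) (hOL : CL.toAction.IsOrbit 𝔠 OL)
    (hOR : CR.toAction.IsOrbit 𝔠 OR)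
    (htrans : IsTransverse (E := E) 𝔠 CL.toAction CR.toAction μL μR OL OR)
    (hL : IsEmbeddedSubmanifold OL (CL.toAction.orbitTangent 𝔠))
    (hR : IsEmbeddedSubmanifold OR (CR.toAction.orbitTangent 𝔠)) :
    IsEmbeddedSubmanifold (p '' (μL ⁻¹' OL ∩ μR ⁻¹' OR)) (P.reduced hp).image := by
  rintro _ ⟨x, hx, rfl⟩
  obtain ⟨UL, hUL, hxUL, kL, hL, hhL, hOUL, hTL⟩ := hL (μL x) hx.1
  obtain ⟨UR, hUR, hxUR, kR, hR, hhR, hOUR, hTR⟩ := hR (μR x) hx.2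
  obtain ⟨τ, V, hV, hxV, hτ, hτx, hpτ⟩ := exists_local_section x hp.smooth (hp.submersion x)
  have hμL := hpair.left.equivariant.1
  have hμR := hpair.right.equivariant.1
  let U : Set Q := V ∩ τ ⁻¹' (μL ⁻¹' UL ∩ μR ⁻¹' UR)
  have hU : IsOpen U := hτ.continuousOn.isOpen_inter_preimage hV
    ((hUL.preimage hμL.continuous).inter (hUR.preimage hμR.continuous))
  let L : ((Fin kL → ℝ) × (Fin kR → ℝ)) ≃L[ℝ] (Fin (kL + kR) → ℝ) :=
    ContinuousLinearEquiv.ofFinrankEq (by simp)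
  -- Local equations of S: those of the two orbits, composed with μ_L, μ_R and the section τ.
  -- Saturation of Z makes the choice of τ immaterial for membership.
  let H : Q → (Fin kL → ℝ) × (Fin kR → ℝ) := fun y => (hL (μL (τ y)), hR (μR (τ y)))
  have hH : ContMDiffOn 𝓘(ℝ, F) 𝓘(ℝ, (Fin kL → ℝ) × (Fin kR → ℝ)) ∞ H U := by
    refine ContMDiffOn.prodMk_space ?_ ?_
    · exact hhL.comp (hμL.comp_contMDiffOn (hτ.mono inter_subset_left)) fun y hy => hy.2.1
    · exact hhR.comp (hμR.comp_contMDiffOn (hτ.mono inter_subset_left)) fun y hy => hy.2.2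
  refine ⟨U, hU, ⟨hxV, ?_⟩, kL + kR, fun y => L (H y), ?_, ?_, ?_⟩
  · change μL (τ (p x)) ∈ UL ∧ μR (τ (p x)) ∈ UR
    rw [hτx]
    exact ⟨hxUL, hxUR⟩
  · exact L.contDiff.contMDiff.comp_contMDiffOn hH
  · intro y hy
    rw [map_eq_zero_iff L L.injective, Prod.mk_eq_zero, ← hOUL _ hy.2.1, ← hOUR _ hy.2.2]
    conv_lhs => rw [← hpτ y hy.1]
    exact hpair.mem_image_iff hp hOL hOR
  rintro y ⟨hyU, hyS⟩
  have hyp := hpτ y hyU.1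
  have hx' : τ y ∈ μL ⁻¹' OL ∩ μR ⁻¹' OR := by
    rw [← hyp] at hyS
    exact (hpair.mem_image_iff hp hOL hOR).1 hyS
  have hτd : MDifferentiableAt 𝓘(ℝ, F) 𝓘(ℝ, E) τ y :=
    (hτ.contMDiffAt (hV.mem_nhds hyU.1)).mdifferentiableAt (by simp)
  have hLd : MDifferentiableAt 𝓘(ℝ, EL) 𝓘(ℝ, Fin kL → ℝ) hL (μL (τ y)) :=
    (hhL.contMDiffAt (hUL.mem_nhds hyU.2.1)).mdifferentiableAt (by simp)
  have hRd : MDifferentiableAt 𝓘(ℝ, ER) 𝓘(ℝ, Fin kR → ℝ) hR (μR (τ y)) :=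
    (hhR.contMDiffAt (hUR.mem_nhds hyU.2.2)).mdifferentiableAt (by simp)
  have hμLd : MDifferentiableAt 𝓘(ℝ, E) 𝓘(ℝ, EL) μL (τ y) := hμL.mdifferentiableAt (by simp)
  have hμRd : MDifferentiableAt 𝓘(ℝ, E) 𝓘(ℝ, ER) μR (τ y) := hμR.mdifferentiableAt (by simp)
  let dτ := mfderiv 𝓘(ℝ, F) 𝓘(ℝ, E) τ y
  let dp := mfderiv 𝓘(ℝ, E) 𝓘(ℝ, F) p (τ y)
  let dL := mfderiv 𝓘(ℝ, EL) 𝓘(ℝ, Fin kL → ℝ) hL (μL (τ y))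
  let dR := mfderiv 𝓘(ℝ, ER) 𝓘(ℝ, Fin kR → ℝ) hR (μR (τ y))
  let dμL := mfderiv 𝓘(ℝ, E) 𝓘(ℝ, EL) μL (τ y)
  let dμR := mfderiv 𝓘(ℝ, E) 𝓘(ℝ, ER) μR (τ y)
  have hpd : ∀ w : TangentSpace 𝓘(ℝ, F) y, (dp (dτ w) : F) = w := mfderiv_section_apply
    (hp.smooth.mdifferentiableAt (by simp)) hτd
    (by filter_upwards [hV.mem_nhds hyU.1] with z hz using hpτ z hz)
  have hd : ∀ w : TangentSpace 𝓘(ℝ, F) y,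
      (mfderiv 𝓘(ℝ, F) 𝓘(ℝ, Fin (kL + kR) → ℝ) (fun y => L (H y)) y w : Fin (kL + kR) → ℝ) =
        L (dL (dμL (dτ w)), dR (dμR (dτ w))) := by
    intro w
    have h1 := (hLd.hasMFDerivAt.comp (τ y) hμLd.hasMFDerivAt).comp y hτd.hasMFDerivAt
    have h2 := (hRd.hasMFDerivAt.comp (τ y) hμRd.hasMFDerivAt).comp y hτd.hasMFDerivAt
    have h3 : HasMFDerivAt 𝓘(ℝ, F) 𝓘(ℝ, (Fin kL → ℝ) × (Fin kR → ℝ)) H y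
        (((dL ∘L dμL) ∘L dτ).prod ((dR ∘L dμR) ∘L dτ)) :=
      ⟨h1.1.prodMk h2.1, h1.2.prodMk h2.2⟩
    have h4 := L.hasMFDerivAt.comp y h3
    exact DFunLike.congr_fun h4.mfderiv w
  have hkL : ∀ v, dL v = 0 ↔ v ∈ CL.toAction.orbitTangent 𝔠 (μL (τ y)) := fun v => by
    rw [(hTL _ ⟨hyU.2.1, hx'.1⟩).2]; rfl
  have hkR : ∀ v, dR v = 0 ↔ v ∈ CR.toAction.orbitTangent 𝔠 (μR (τ y)) := fun v => by
    rw [(hTR _ ⟨hyU.2.2, hx'.2⟩).2]; rfl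
  have hker : ∀ v, v ∈ levelSpace (E := E) 𝔠 CL.toAction CR.toAction μL μR (τ y) ↔
      dL (dμL v) = 0 ∧ dR (dμR v) = 0 := fun v => by
    rw [hkL, hkR, mem_levelSpace, Action.mem_orbitSpace, Action.mem_orbitSpace]
  -- The lift dτ(w) may be replaced by any v with dp(v) = w: they differ by ρ(𝔠) ⊆ TZ, on which the
  -- differentials of the equations vanish.
  have hdiff : ∀ (w : TangentSpace 𝓘(ℝ, F) y) (v : TangentSpace 𝓘(ℝ, E) (τ y)), (w : F) = dp v →
      dL (dμL (dτ w)) = dL (dμL v) ∧ dR (dμR (dτ w)) = dR (dμR v) := by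
    intro w v hwv
    have h1 : dτ w - v ∈ P.toAction.orbitSpace 𝔠 (τ y) := by
      rw [hp.mem_orbitSpace_iff, map_sub]
      exact sub_eq_zero.2 ((hpd w).trans hwv)
    have h2 := (hker _).1 (hpair.orbitSpace_le_levelSpace _ h1)
    rw [map_sub, map_sub, map_sub, map_sub] at h2
    exact ⟨sub_eq_zero.1 h2.1, sub_eq_zero.1 h2.2⟩
  constructor
  · intro c
    obtain ⟨a', ha'⟩ := (hTL _ ⟨hyU.2.1, hx'.1⟩).1 (L.symm c).1
    obtain ⟨b', hb'⟩ := (hTR _ ⟨hyU.2.2, hx'.2⟩).1 (L.symm c).2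
    -- Transversality yields v reaching the prescribed values up to vectors tangent to the orbits,
    -- which the equations of the orbits do not see.
    obtain ⟨v, l, hl, r, hr, hal, hbr⟩ := htrans (τ y) hx' a' b'
    refine ⟨(dp v : F), (hd _).trans ?_⟩
    obtain ⟨h1, h2⟩ := hdiff (dp v : F) v rfl
    have h3 : dL (dμL v) = (L.symm c).1 := by
      rw [← ha', hal, map_add]
      change _ = _ + dL l
      rw [(hkL l).2 hl, add_zero]
    have h4 : dR (dμR v) = (L.symm c).2 := by
      rw [← hb', hbr, map_add]
      change _ = _ + dR r
      rw [(hkR r).2 hr, add_zero]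
    rw [h1, h2, h3, h4]
    exact L.apply_symm_apply c
  · have himage : ∀ w : F, w ∈ (P.reduced hp).image y ↔
        ∃ v ∈ levelSpace (E := E) 𝔠 CL.toAction CR.toAction μL μR (τ y), w = dp v := by
      intro w
      have h1 : ∀ q, q = y → (w ∈ (P.reduced hp).image y ↔ w ∈ (P.reduced hp).image q) := by
        rintro q rfl; rfl
      rw [h1 _ hyp, Bivector.image_eq_range, ← hpair.map_levelSpace ht h𝔠 hp]
      exact ⟨fun ⟨v, hv, h⟩ => ⟨v, hv, h.symm⟩, fun ⟨v, hv, h⟩ => ⟨v, hv, h.symm⟩⟩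
    ext w
    have hzero : (mfderiv 𝓘(ℝ, F) 𝓘(ℝ, Fin (kL + kR) → ℝ) (fun y => L (H y)) y w :
        Fin (kL + kR) → ℝ) = 0 ↔ dL (dμL (dτ w)) = 0 ∧ dR (dμR (dτ w)) = 0 := by
      rw [hd]
      exact (map_eq_zero_iff L L.injective).trans Prod.mk_eq_zero
    refine (himage w).trans (Iff.trans ?_ hzero.symm)
    constructor
    · rintro ⟨v, hv, hwv⟩
      obtain ⟨h1, h2⟩ := hdiff w v hwv
      have h3 := (hker v).1 hv
      exact ⟨h1.trans h3.1, h2.trans h3.2⟩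
    · intro h
      exact ⟨dτ w, (hker _).2 h, (hpd w).symm⟩

end Reduction

end

end CentralReduction

theorem mainTheorem2
    {𝔤 : Type*} [LieRing 𝔤] [LieAlgebra ℝ 𝔤] [FiniteDimensional ℝ 𝔤]
    (t : 𝔤 ⊗[ℝ] 𝔤) (ht : CentralReduction.IsInvariantSymmetric t)
    -- the manifolds `M`, `N_L`, `N_R`
    {E : Type*} [NormedAddCommGroup E] [NormedSpace ℝ E] [FiniteDimensional ℝ E]
    {M : Type*} [TopologicalSpace M] [T2Space M] [SecondCountableTopology M]
    [ChartedSpace E M] [IsManifold 𝓘(ℝ, E) ∞ M]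
    {EL : Type*} [NormedAddCommGroup EL] [NormedSpace ℝ EL] [FiniteDimensional ℝ EL]
    {NL : Type*} [TopologicalSpace NL] [T2Space NL] [SecondCountableTopology NL]
    [ChartedSpace EL NL] [IsManifold 𝓘(ℝ, EL) ∞ NL]
    {ER : Type*} [NormedAddCommGroup ER] [NormedSpace ℝ ER] [FiniteDimensional ℝ ER]
    {NR : Type*} [TopologicalSpace NR] [T2Space NR] [SecondCountableTopology NR]
    [ChartedSpace ER NR] [IsManifold 𝓘(ℝ, ER) ∞ NR]
    -- a split-symplectic central pair
    (P : CentralReduction.QuasiPoisson E M t)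
    (CL : CentralReduction.QuasiPoisson EL NL t) (CR : CentralReduction.QuasiPoisson ER NR t)
    (μL : M → NL) (μR : M → NR)
    (hpair : CentralReduction.IsSplitSymplecticPair P CL CR μL μR)
    -- a Lagrangian subalgebra and `𝔠`-orbits
    (𝔠 : LieSubalgebra ℝ 𝔤) (h𝔠 : CentralReduction.IsLagrangian t 𝔠.toSubmodule)
    (OL : Set NL) (OR : Set NR)
    (hOL : CL.toAction.IsOrbit 𝔠 OL) (hOR : CR.toAction.IsOrbit 𝔠 OR)
    (htrans : CentralReduction.IsTransverse (E := E) 𝔠 CL.toAction CR.toAction μL μR OL OR)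
    -- `Q = M/𝔠` is a manifold
    {F : Type*} [NormedAddCommGroup F] [NormedSpace ℝ F] [FiniteDimensional ℝ F]
    {Q : Type*} [TopologicalSpace Q] [T2Space Q] [SecondCountableTopology Q]
    [ChartedSpace F Q] [IsManifold 𝓘(ℝ, F) ∞ Q]
    (p : M → Q) (hp : P.toAction.IsQuotient (F := F) 𝔠 p) :
    -- the reduced Poisson structure of `M/𝔠`
    ∃ πQ : CentralReduction.Bivector F Q, πQ.IsPoisson ∧
      CentralReduction.IsPushforward (E := E) (F := F) p P.π πQ ∧
      -- the tangent spaces of the reduced space are those of the symplectic leaves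
      (∀ x ∈ μL ⁻¹' OL ∩ μR ⁻¹' OR,
        mfderiv 𝓘(ℝ, E) 𝓘(ℝ, F) p x ''
          CentralReduction.levelTangent (E := E) 𝔠 CL.toAction CR.toAction μL μR x =
            πQ.image (p x)) ∧
      -- the components of the reduced space are symplectic leaves
      (∀ q ∈ p '' (μL ⁻¹' OL ∩ μR ⁻¹' OR),
        CentralReduction.immersedComponent (p '' (μL ⁻¹' OL ∩ μR ⁻¹' OR)) πQ.image q =
          πQ.symplecticLeaf q) ∧
      -- the case of embedded orbits
      (CentralReduction.IsEmbeddedSubmanifold OL (CL.toAction.orbitTangent 𝔠) →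
        CentralReduction.IsEmbeddedSubmanifold OR (CR.toAction.orbitTangent 𝔠) →
        CentralReduction.IsEmbeddedSubmanifold (p '' (μL ⁻¹' OL ∩ μR ⁻¹' OR)) πQ.image ∧
        ∀ q ∈ p '' (μL ⁻¹' OL ∩ μR ⁻¹' OR),
          connectedComponentIn (p '' (μL ⁻¹' OL ∩ μR ⁻¹' OR)) q = πQ.symplecticLeaf q) := by
  have hS := fun q hq q' => hpair.mem_image_of_joined ht h𝔠 hp hOL hOR (q := q) (q' := q') hq
  have hrank := hpair.finrank_range_anchor_eq ht h𝔠 hp hOL hOR htrans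
  have hleaf := fun q hq => (P.reduced hp).immersedComponent_eq_symplecticLeaf hS hrank (x := q) hq
  refine ⟨P.reduced hp, P.isPoisson_reduced h𝔠 hp, P.isPushforward_reduced hp, fun x _ => ?_, hleaf,
    fun hL hR => ?_⟩
  · rw [CentralReduction.Bivector.image_eq_range, ← hpair.map_levelSpace ht h𝔠 hp,
      ← CentralReduction.coe_levelSpace]
    rfl
  · have h := hpair.isEmbeddedSubmanifold_image ht h𝔠 hp hOL hOR htrans hL hR
    exact ⟨h, fun q hq => h.connectedComponentIn_eq_symplecticLeaf hleaf hq⟩
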